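/- Let $k$ be a field and $(H,\mu,\nu,\Delta,\varepsilon)$ a finite-dimensional $k$-bialgebra. Write $V^n=V^{\otimes n}$, and write $h_1\cdots h_n\otimes l_1\cdots l_m$ for pure tensors of $H^n\otimes (H^*)^m$. Pairings are extended to tensor powers by the rainbow rule $\langle l_1\cdots l_n,h_1\cdots h_n\rangle=\langle l_n,h_1\rangle\cdots\langle l_1,h_n\rangle$, and $H^*$ carries the bialgebra structure dual to that of $H$ for this rule: $\langle ll',h\rangle=\langle l,h_{(2)}\rangle\langle l',h_{(1)}\rangle$, $\langle l_{(1)},h'\rangle\langle l_{(2)},h\rangle=\langle l,hh'\rangle$, with unit $\varepsilon$ and counit $l\mapsto l(1)$. On $T(H)\otimes T(H^*)=\bigoplus_{n,m\ge 0}H^n\otimes(H^*)^m$ consider $$d_{bar}=\sum_{i=1}^{n-1}(-1)^i\,h_1\cdots(h_ih_{i+1})\cdots h_n\otimes l_1\cdots l_m,\qquad d_{cob}=\sum_{i=1}^{m-1}(-1)^i\,h_1\cdots h_n\otimes l_1\cdots(l_il_{i+1})\cdots l_m,$$ $${}^{H^*}\!\pi=\langle l_{1(1)},h_{n(2)}\rangle\cdots\langle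 l_{1(n)},h_{1(2)}\rangle\,h_{1(1)}\cdots h_{n(1)}\otimes l_2\cdots l_m,$$ $$\pi^{H^*}=\langle l_{m(1)},h_{n(1)}\rangle\cdots\langle l_{m(n)},h_{1(1)}\rangle\,h_{1(2)}\cdots h_{n(2)}\otimes l_1\cdots l_{m-1},$$ $$\pi^{H}=\langle l_{m(1)},h_{n(1)}\rangle\cdots\langle l_{1(1)},h_{n(m)}\rangle\,h_1\cdots h_{n-1}\otimes l_{1(2)}\cdots l_{m(2)},$$ $${}^{H}\!\pi=\langle l_{m(2)},h_{1(1)}\rangle\cdots\langle l_{1(2)},h_{1(m)}\rangle\,h_2\cdots h_n\otimes l_{1(1)}\cdots l_{m(1)}$$ (values on $h_1\cdots h_n\otimes l_1\cdots l_m$; a $0$-fold iterated comultiplication is the counit). **(a)** Each of the following four pairs of families $d_{n,m}:H^n\otimes(H^*)^m\to H^{n-1}\otimes(H^*)^m$ $(n\ge1)$ and $d'_{n,m}:H^n\otimes(H^*)^m\to H^n\otimes(H^*)^{m-1}$ $(m\ge 1)$ is a bicomplex structure, i.e. $d_{n-1,m}d_{n,m}=0$, $d'_{n,m-1}d'_{n,m}=0$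 and $d_{n,m-1}d'_{n,m}+d'_{n-1,m}d_{n,m}=0$: 1. $d=d_{bar}$, $d'=(-1)^nd_{cob}$; 2. $d=d_{bar}+(-1)^n\pi^H$, $d'=(-1)^nd_{cob}+(-1)^n\,{}^{H^*}\!\pi$; 3. $d=d_{bar}+{}^H\!\pi$, $d'=(-1)^nd_{cob}+(-1)^{n+m}\pi^{H^*}$; 4. $d=d_{bar}+(-1)^n\pi^H+{}^H\!\pi$, $d'=(-1)^nd_{cob}+(-1)^n\,{}^{H^*}\!\pi+(-1)^{n+m}\pi^{H^*}$. **(b)** The fourth one is the Gerstenhaber–Schack bialgebra complex, in its homological form. Namely, $x\otimes y\mapsto(z\mapsto\langle y,z\rangle x)$ is an isomorphism $H^n\otimes(H^*)^m\cong\operatorname{Hom}_k(H^m,H^n)$; and the Gerstenhaber–Schack cochain bicomplex $\operatorname{Hom}_k(H^n,H^m)$ with differentials $\delta_h$ and $(-1)^n\delta_c$, $$\delta_hf(h_1\cdots h_{n+1})=h_1\cdot f(h_2\cdots h_{n+1})+\sum_{i=1}^n(-1)^if(h_1\cdots(h_ih_{i+1})\cdots h_{n+1})+(-1)^{n+1}f(h_1\cdots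 h_n)\cdot h_{n+1},$$ $$\delta_cf(h_1\cdots h_n)=h_{1(1)}\!\cdot\ldots\cdot h_{n(1)}\otimes f(h_{1(2)}\cdots h_{n(2)})+\sum_{j=1}^m(-1)^j\Delta_jf(h_1\cdots h_n)+(-1)^{m+1}f(h_{1(1)}\cdots h_{n(1)})\otimes h_{1(2)}\!\cdot\ldots\cdot h_{n(2)}$$ ($H$ acts diagonally on $H^m$ by left and right multiplication, $\Delta_j$ is $\Delta$ applied to the $j$-th factor), is isomorphic to the linear dual of bicomplex 4 through $f\mapsto\big(x\otimes y\mapsto(-1)^{m(m+1)/2}\langle y,f(x)\rangle\big)$. **(c)** Let $(M,\rho,\delta)$ be a right-right Hopf module over $H$ and $(N,\lambda,\gamma)$ a left-left Hopf module over $H^*$. On $M\otimes H^n\otimes(H^*)^m\otimes N$ let $d_{bar}$ and $d_{cob}$ act on the middle factors, let ${}^H\!\pi$ be $\rho$ applied to the two leftmost factors, $\pi^{H^*}$ be $\lambda$ applied to the two rightmost factors, and let $\pi^H$ and ${}^{H^*}\!\pi$ send $a\otimes h_1\cdots h_n\otimes l_1\cdots l_m\otimes b$ respectively to $$\langle l_{1(1)},h_{n(m+1)}\rangle\cdots\langle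 l_{m(1)},h_{n(2)}\rangle\langle b_{(-1)},h_{n(1)}\rangle\,a\otimes h_1\cdots h_{n-1}\otimes l_{1(2)}\cdots l_{m(2)}\otimes b_{(0)},$$ $$\langle l_{1(1)},h_{n(2)}\rangle\cdots\langle l_{1(n)},h_{1(2)}\rangle\langle l_{1(n+1)},a_{(1)}\rangle\,a_{(0)}\otimes h_{1(1)}\cdots h_{n(1)}\otimes l_2\cdots l_m\otimes b.$$ Then $d_{bar}+(-1)^n\pi^H+{}^H\!\pi$ and $(-1)^nd_{cob}+(-1)^n\,{}^{H^*}\!\pi+(-1)^{n+m}\pi^{H^*}$ define a bicomplex, which recovers the Panaite–Ştefan deformation complex of Hopf modules. Namely, $N^*$ with the action $(\varphi\cdot h)(b)=\langle b_{(-1)},h\rangle\varphi(b_{(0)})$ and the coaction determined by $\varphi_{(0)}(b)\langle l,\varphi_{(1)}\rangle=\varphi(l\cdot b)$ is a right-right Hopf module over $H$; if $N$ is finite-dimensional, $x\otimes y\otimes b\mapsto(\varphi\otimes z\mapsto\varphi(b)\langle y,z\rangle x)$ is an isomorphism $M\otimes H^n\otimes(H^*)^m\otimes N\cong\operatorname{Hom}_k(N^*\otimes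 H^m,M\otimes H^n)$; and, with $P=N^*$, the Panaite–Ştefan cochain bicomplex $\operatorname{Hom}_k(M\otimes H^n,P\otimes H^m)$ with differentials $\partial_h$ and $(-1)^n\partial_c$, $$\partial_hf(a\otimes h_1\cdots h_{n+1})=f(ah_1\otimes h_2\cdots h_{n+1})+\sum_{i=1}^n(-1)^if(a\otimes h_1\cdots(h_ih_{i+1})\cdots h_{n+1})+(-1)^{n+1}f(a\otimes h_1\cdots h_n)\cdot h_{n+1},$$ $$\partial_cf(x)=(\delta_P\otimes\operatorname{Id})f(x)+\sum_{j=1}^m(-1)^j\Delta_jf(x)+(-1)^{m+1}f(x_{(0)})\otimes x_{(1)}$$ ($P\otimes H^m$ with the diagonal action $(p\otimes x_1\cdots x_m)\cdot h=p\,h_{(1)}\otimes x_1h_{(2)}\cdots x_mh_{(m+1)}$, $M\otimes H^n$ with the codiagonal coaction, $\delta_P$ the coaction of $P$, $\Delta_j$ the comultiplication of the $j$-th factor of $H^m$), is isomorphic to its linear dual through $f\mapsto\big(x\otimes y\otimes b\mapsto(-1)^{m(m+1)/2}\langle y\otimes b,f(x)\rangle\big)$, where $\langle y\otimes b,\varphi\otimes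 z\rangle=\varphi(b)\langle y,z\rangle$. -/

import Mathlib

open scoped TensorProduct

noncomputable section

namespace BialgCx

/-! ### Elementary operations on tensor powers -/

section TensorPowers

variable (k : Type*) [Field k] (V : Type*) [AddCommGroup V] [Module k V]

/-- `v ⊗ (v₁ ⋯ vₙ) ↦ v v₁ ⋯ vₙ`. -/
def cons (n : ℕ) : V ⊗[k] (⨂[k]^n V) ≃ₗ[k] ⨂[k]^(n + 1) V :=
  TensorProduct.congr (PiTensorProduct.subsingletonEquiv (R := k) (s := fun _ : Fin 1 => V) 0).symm
      (LinearEquiv.refl k _) ≪≫ₗ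
    TensorPower.mulEquiv ≪≫ₗ TensorPower.cast k V (Nat.add_comm 1 n)

/-- `(v₁ ⋯ vₙ) ⊗ v ↦ v₁ ⋯ vₙ v`. -/
def snoc (n : ℕ) : (⨂[k]^n V) ⊗[k] V ≃ₗ[k] ⨂[k]^(n + 1) V :=
  TensorProduct.congr (LinearEquiv.refl k _)
      (PiTensorProduct.subsingletonEquiv (R := k) (s := fun _ : Fin 1 => V) 0).symm ≪≫ₗ
    TensorPower.mulEquiv

end TensorPowers

section Algebra

variable (k : Type*) [Field k] (A : Type*) [Ring A] [Algebra k A]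

/-- Multiplication of two neighbours: in zero-based numbering, the factors at places `i`, `i + 1`
are replaced with their product. -/
def mulAt : (n : ℕ) → Fin n → ((⨂[k]^(n + 1) A) →ₗ[k] (⨂[k]^n A))
  | 0 => fun i => i.elim0
  | n + 1 => Fin.cases
      ((cons k A n).toLinearMap ∘ₗ
        (LinearMap.mul' k A).rTensor (⨂[k]^n A) ∘ₗ
        (TensorProduct.assoc k A A (⨂[k]^n A)).symm.toLinearMap ∘ₗ
        (cons k A n).symm.toLinearMap.lTensor A ∘ₗ
        (cons k A (n + 1)).symm.toLinearMap)
      (fun i => (cons k A n).toLinearMap ∘ₗ (mulAt n i).lTensor A ∘ₗ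
        (cons k A (n + 1)).symm.toLinearMap)

/-- The bar differential `a₁ ⋯ aₙ₊₁ ↦ ∑_{i=1}^{n} (-1)^i a₁ ⋯ (aᵢ aᵢ₊₁) ⋯ aₙ₊₁`. -/
def bar (n : ℕ) : (⨂[k]^(n + 1) A) →ₗ[k] (⨂[k]^n A) :=
  ∑ i : Fin n, (-1 : k) ^ ((i : ℕ) + 1) • mulAt k A n i

/-- `a₁ ⋯ aₙ ↦ a₁ · a₂ · … · aₙ`. -/
def prodAll (n : ℕ) : (⨂[k]^n A) →ₗ[k] A :=
  PiTensorProduct.lift (MultilinearMap.mkPiAlgebraFin k n A)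

end Algebra

section Coalgebra

variable (k : Type*) [Field k] (C : Type*) [AddCommGroup C] [Module k C] [Coalgebra k C]

/-- Comultiplication applied to the factor at the (zero-based) place `i`. -/
def comulAt : (n : ℕ) → Fin n → ((⨂[k]^n C) →ₗ[k] (⨂[k]^(n + 1) C))
  | 0 => fun i => i.elim0
  | n + 1 => Fin.cases
      ((cons k C (n + 1)).toLinearMap ∘ₗ
        (cons k C n).toLinearMap.lTensor C ∘ₗ
        (TensorProduct.assoc k C C (⨂[k]^n C)).toLinearMap ∘ₗ
        (Coalgebra.comul (R := k) (A := C)).rTensor (⨂[k]^n C) ∘ₗ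
        (cons k C n).symm.toLinearMap)
      (fun i => (cons k C (n + 1)).toLinearMap ∘ₗ (comulAt n i).lTensor C ∘ₗ
        (cons k C n).symm.toLinearMap)

/-- The iterated comultiplication `c ↦ c₍₁₎ c₍₂₎ ⋯ c₍ₙ₎` (the counit for `n = 0`). -/
def iterComul : (n : ℕ) → (C →ₗ[k] (⨂[k]^n C))
  | 0 => TensorPower.algebraMap₀.toLinearMap ∘ₗ Coalgebra.counit (R := k) (A := C)
  | n + 1 => (cons k C n).toLinearMap ∘ₗ (iterComul n).lTensor C ∘ₗ
      Coalgebra.comul (R := k) (A := C)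

/-- `c₁ ⋯ cₙ ↦ (c₁₍₁₎ ⋯ cₙ₍₁₎) ⊗ (c₁₍₂₎ ⋯ cₙ₍₂₎)`. -/
def split : (n : ℕ) → ((⨂[k]^n C) →ₗ[k] (⨂[k]^n C) ⊗[k] (⨂[k]^n C))
  | 0 => (TensorProduct.mk k (⨂[k]^0 C) (⨂[k]^0 C)).flip (PiTensorProduct.tprod k Fin.elim0)
  | n + 1 => TensorProduct.map (cons k C n).toLinearMap (cons k C n).toLinearMap ∘ₗ
      (TensorProduct.tensorTensorTensorComm k C C (⨂[k]^n C) (⨂[k]^n C)).toLinearMap ∘ₗ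
      TensorProduct.map (Coalgebra.comul (R := k) (A := C)) (split n) ∘ₗ
      (cons k C n).symm.toLinearMap

end Coalgebra

section Pairings

variable {k : Type*} [Field k] {A B : Type*} [AddCommGroup A] [Module k A]
  [AddCommGroup B] [Module k B]

/-- The rainbow extension of a pairing `p` to tensor powers:
`⟨a₁ ⋯ aₙ, b₁ ⋯ bₙ⟩ = p(aₙ, b₁) ⋯ p(a₁, bₙ)`. -/
def rainbow (p : A →ₗ[k] B →ₗ[k] k) (n : ℕ) : (⨂[k]^n A) →ₗ[k] (⨂[k]^n B) →ₗ[k] k :=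
  TensorPower.pairingDual k B n ∘ₗ
    PiTensorProduct.map (fun _ : Fin n => p) ∘ₗ
    (PiTensorProduct.reindex k (fun _ : Fin n => A) Fin.revPerm).toLinearMap

/-- `a ⊗ b ⊗ x ↦ p(a, b) x`. -/
def contractLeft (p : A →ₗ[k] B →ₗ[k] k) (X : Type*) [AddCommGroup X] [Module k X] :
    A ⊗[k] (B ⊗[k] X) →ₗ[k] X :=
  (TensorProduct.lid k X).toLinearMap ∘ₗ (TensorProduct.lift p).rTensor X ∘ₗ
    (TensorProduct.assoc k A B X).symm.toLinearMap

end Pairings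

/-! ### The dual bialgebra, with the rainbow conventions -/

/-- The linear dual `H*`, to be endowed with its bialgebra structure. -/
def HDual (k H : Type*) [Field k] [Ring H] [Bialgebra k H] : Type _ := Module.Dual k H

namespace HDual

section Structure

variable {k H : Type*} [Field k] [Ring H] [Bialgebra k H]

instance instAddCommGroup : AddCommGroup (HDual k H) :=
  inferInstanceAs (AddCommGroup (Module.Dual k H))

instance instModule : Module k (HDual k H) := inferInstanceAs (Module k (Module.Dual k H))

/-- The identity map from the dual bialgebra to the dual vector space. -/
def toDual : HDual k H ≃ₗ[k] Module.Dual k H := LinearEquiv.refl k (Module.Dual k H)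

/-- `⟨l l', h⟩ = ⟨l, h₍₂₎⟩ ⟨l', h₍₁₎⟩`. -/
instance instMul : Mul (HDual k H) where
  mul l l' := toDual.symm
    (LinearMap.mul' k k ∘ₗ TensorProduct.map (toDual l') (toDual l) ∘ₗ Coalgebra.comul)

instance instOne : One (HDual k H) where
  one := toDual.symm (Coalgebra.counit (R := k) (A := H))

/-- The pairing `⟨l, h⟩ = l(h)`. -/
def ev (k H : Type*) [Field k] [Ring H] [Bialgebra k H] : HDual k H →ₗ[k] H →ₗ[k] k :=
  toDual.toLinearMap

theorem mul_eq (l l' : HDual k H) :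
    l * l' = toDual.symm (WithConv.toConv (toDual l') * WithConv.toConv (toDual l)).ofConv := rfl

theorem one_eq : (1 : HDual k H) =
    toDual.symm (1 : WithConv (H →ₗ[k] k)).ofConv := by
  apply toDual.injective
  ext h
  rfl

instance instRing : Ring (HDual k H) where
  __ := instAddCommGroup
  mul_assoc a b c := by
    simp only [mul_eq, LinearEquiv.apply_symm_apply, WithConv.toConv_ofConv, mul_assoc]
  one_mul a := by
    simp only [mul_eq, one_eq, LinearEquiv.apply_symm_apply, WithConv.toConv_ofConv, mul_one]
    rfl
  mul_one a := by
    simp only [mul_eq, one_eq, LinearEquiv.apply_symm_apply, WithConv.toConv_ofConv, one_mul]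
    rfl
  left_distrib a b c := by
    simp only [mul_eq, map_add, WithConv.toConv_add, add_mul, WithConv.ofConv_add]
  right_distrib a b c := by
    simp only [mul_eq, map_add, WithConv.toConv_add, mul_add, WithConv.ofConv_add]
  zero_mul a := by
    simp only [mul_eq, map_zero, WithConv.toConv_zero, mul_zero, WithConv.ofConv_zero]
  mul_zero a := by
    simp only [mul_eq, map_zero, WithConv.toConv_zero, zero_mul, WithConv.ofConv_zero]

instance instAlgebra : Algebra k (HDual k H) :=
  Algebra.ofModule
    (fun r x y => by
      simp only [mul_eq, map_smul, WithConv.toConv_smul, mul_smul_comm, WithConv.ofConv_smul])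
    (fun r x y => by
      simp only [mul_eq, map_smul, WithConv.toConv_smul, smul_mul_assoc, WithConv.ofConv_smul])

theorem dual_ext_two {f g : Module.Dual k (H ⊗[k] H)}
    (hfg : ∀ h h' : H, f (h ⊗ₜ[k] h') = g (h ⊗ₜ[k] h')) : f = g :=
  TensorProduct.ext' hfg

theorem ev_ext {l l' : HDual k H} (h : ∀ x : H, ev k H l x = ev k H l' x) : l = l' :=
  LinearMap.ext (f := toDual l) (g := toDual l') h

theorem ev_mul_repr (l l' : HDual k H) {ι : Type*} {h : H} (r : Coalgebra.Repr k h ι) :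
    ev k H (l * l') h = ∑ i ∈ r.index, ev k H l (r.right i) * ev k H l' (r.left i) := by
  have : ev k H (l * l') h =
      (WithConv.toConv (toDual l') * WithConv.toConv (toDual l)) h := rfl
  rw [this, r.convMul_apply]
  exact Finset.sum_congr rfl fun i _ => mul_comm _ _

theorem ev_one (h : H) : ev k H 1 h = Coalgebra.counit (R := k) h := rfl

variable [Module.Finite k H]

instance instFinite : Module.Finite k (HDual k H) :=
  inferInstanceAs (Module.Finite k (Module.Dual k H))

/-- The canonical isomorphism `H* ⊗ H* ≃ (H ⊗ H)*` for the rainbow pairing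
`⟨l l', h h'⟩ = ⟨l, h'⟩ ⟨l', h⟩`. -/
def rainbowTwo : HDual k H ⊗[k] HDual k H ≃ₗ[k] Module.Dual k (H ⊗[k] H) :=
  TensorProduct.comm k (HDual k H) (HDual k H) ≪≫ₗ
    TensorProduct.congr toDual toDual ≪≫ₗ TensorProduct.dualDistribEquiv k H H

theorem rainbowTwo_tmul (l l' : HDual k H) (h h' : H) :
    rainbowTwo (l ⊗ₜ[k] l') (h ⊗ₜ[k] h') = ev k H l h' * ev k H l' h := by
  rw [mul_comm]
  rfl

/-- `⟨l₍₁₎, h'⟩ ⟨l₍₂₎, h⟩ = ⟨l, h h'⟩` and `ε(l) = ⟨l, 1⟩`. -/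
instance instCoalgebraStruct : CoalgebraStruct k (HDual k H) where
  comul := rainbowTwo.symm.toLinearMap ∘ₗ (LinearMap.mul' k H).dualMap ∘ₗ toDual.toLinearMap
  counit := (ev k H).flip 1

theorem counit_apply (l : HDual k H) :
    Coalgebra.counit (R := k) l = ev k H l 1 := rfl

theorem rainbowTwo_comul (l : HDual k H) (h h' : H) :
    rainbowTwo (Coalgebra.comul (R := k) l) (h ⊗ₜ[k] h') = ev k H l (h * h') := by
  have : rainbowTwo (Coalgebra.comul (R := k) l) = (LinearMap.mul' k H).dualMap (toDual l) :=
    rainbowTwo.apply_symm_apply _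
  rw [this]
  rfl

/-- The canonical isomorphism `H* ⊗ (H* ⊗ H*) ≃ ((H ⊗ H) ⊗ H)*` for the rainbow pairing. -/
def rainbowThree : HDual k H ⊗[k] (HDual k H ⊗[k] HDual k H) ≃ₗ[k]
    Module.Dual k ((H ⊗[k] H) ⊗[k] H) :=
  TensorProduct.comm k (HDual k H) (HDual k H ⊗[k] HDual k H) ≪≫ₗ
    TensorProduct.congr rainbowTwo toDual ≪≫ₗ TensorProduct.dualDistribEquiv k (H ⊗[k] H) H

theorem rainbowThree_tmul (l : HDual k H) (t : HDual k H ⊗[k] HDual k H) (z : H ⊗[k] H) (h : H) :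
    rainbowThree (l ⊗ₜ[k] t) (z ⊗ₜ[k] h) = ev k H l h * rainbowTwo t z := by
  rw [mul_comm]
  rfl

theorem rainbowThree_lTensor (t : HDual k H ⊗[k] HDual k H) (h h' h'' : H) :
    rainbowThree ((Coalgebra.comul (R := k)).lTensor (HDual k H) t)
      ((h ⊗ₜ[k] h') ⊗ₜ[k] h'') = rainbowTwo t ((h * h') ⊗ₜ[k] h'') := by
  induction t with
  | zero => simp
  | tmul a b =>
    rw [LinearMap.lTensor_tmul, rainbowThree_tmul, rainbowTwo_comul, rainbowTwo_tmul]
  | add x y hx hy => simp only [map_add, LinearMap.add_apply, hx, hy]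

theorem rainbowThree_assoc (s : HDual k H ⊗[k] HDual k H) (b : HDual k H) (h h' h'' : H) :
    rainbowThree (TensorProduct.assoc k _ _ _ (s ⊗ₜ[k] b)) ((h ⊗ₜ[k] h') ⊗ₜ[k] h'') =
      rainbowTwo s (h' ⊗ₜ[k] h'') * ev k H b h := by
  induction s with
  | zero => simp
  | tmul c d =>
    rw [TensorProduct.assoc_tmul, rainbowThree_tmul, rainbowTwo_tmul, rainbowTwo_tmul, mul_assoc]
  | add x y hx hy =>
    simp only [TensorProduct.add_tmul, map_add, LinearMap.add_apply, hx, hy, add_mul]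

theorem rainbowThree_rTensor (t : HDual k H ⊗[k] HDual k H) (h h' h'' : H) :
    rainbowThree (TensorProduct.assoc k _ _ _
      ((Coalgebra.comul (R := k)).rTensor (HDual k H) t))
      ((h ⊗ₜ[k] h') ⊗ₜ[k] h'') = rainbowTwo t (h ⊗ₜ[k] (h' * h'')) := by
  induction t with
  | zero => simp
  | tmul a b =>
    rw [LinearMap.rTensor_tmul, rainbowThree_assoc, rainbowTwo_comul, rainbowTwo_tmul]
  | add x y hx hy => simp only [map_add, LinearMap.add_apply, hx, hy]

theorem counit_lid (t : HDual k H ⊗[k] HDual k H) (h : H) :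
    ev k H (TensorProduct.lid k _ ((Coalgebra.counit (R := k)).rTensor (HDual k H) t)) h =
      rainbowTwo t (h ⊗ₜ[k] 1) := by
  induction t with
  | zero => simp
  | tmul a b =>
    rw [LinearMap.rTensor_tmul, TensorProduct.lid_tmul, map_smul, LinearMap.smul_apply,
      rainbowTwo_tmul, counit_apply, smul_eq_mul]
  | add x y hx hy => simp only [map_add, LinearMap.add_apply, hx, hy]

theorem counit_rid (t : HDual k H ⊗[k] HDual k H) (h : H) :
    ev k H (TensorProduct.rid k _ ((Coalgebra.counit (R := k)).lTensor (HDual k H) t)) h =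
      rainbowTwo t (1 ⊗ₜ[k] h) := by
  induction t with
  | zero => simp
  | tmul a b =>
    rw [LinearMap.lTensor_tmul, TensorProduct.rid_tmul, map_smul, LinearMap.smul_apply,
      rainbowTwo_tmul, counit_apply, smul_eq_mul, mul_comm]
  | add x y hx hy => simp only [map_add, LinearMap.add_apply, hx, hy]

instance instCoalgebra : Coalgebra k (HDual k H) where
  coassoc := by
    refine LinearMap.ext fun l => rainbowThree.injective ?_
    refine TensorProduct.ext_threefold fun h h' h'' => ?_
    simp only [LinearMap.comp_apply, LinearEquiv.coe_coe]
    rw [rainbowThree_rTensor, rainbowThree_lTensor, rainbowTwo_comul, rainbowTwo_comul, mul_assoc]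
  rTensor_counit_comp_comul := by
    refine LinearMap.ext fun l => (TensorProduct.lid k _).injective (ev_ext fun h => ?_)
    rw [LinearMap.comp_apply, counit_lid, rainbowTwo_comul, mul_one]
    simp
  lTensor_counit_comp_comul := by
    refine LinearMap.ext fun l => (TensorProduct.rid k _).injective (ev_ext fun h => ?_)
    rw [LinearMap.comp_apply, counit_rid, rainbowTwo_comul, one_mul]
    simp

theorem rainbowTwo_mul_repr (t t' : HDual k H ⊗[k] HDual k H) {ι ι' : Type*} {h h' : H}
    (r : Coalgebra.Repr k h ι) (r' : Coalgebra.Repr k h' ι') :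
    rainbowTwo (t * t') (h ⊗ₜ[k] h') = ∑ i ∈ r.index, ∑ j ∈ r'.index,
      rainbowTwo t (r.right i ⊗ₜ[k] r'.right j) * rainbowTwo t' (r.left i ⊗ₜ[k] r'.left j) := by
  induction t with
  | zero => simp
  | tmul a b =>
    induction t' with
    | zero => simp
    | tmul c d =>
      rw [Algebra.TensorProduct.tmul_mul_tmul, rainbowTwo_tmul, ev_mul_repr a c r',
        ev_mul_repr b d r, Finset.sum_mul_sum, Finset.sum_comm]
      refine Finset.sum_congr rfl fun i _ => Finset.sum_congr rfl fun j _ => ?_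
      simp only [rainbowTwo_tmul]
      ring
    | add x y hx hy =>
      simp only [mul_add, map_add, LinearMap.add_apply, hx, hy, Finset.sum_add_distrib]
  | add x y hx hy =>
    simp only [add_mul, map_add, LinearMap.add_apply, hx, hy, Finset.sum_add_distrib]

instance instBialgebra : Bialgebra k (HDual k H) :=
  Bialgebra.mk' k (HDual k H)
    (by rw [counit_apply, ev_one, Bialgebra.counit_one])
    (by
      intro a b
      have h1 : Coalgebra.comul (R := k) (1 : H) = 1 ⊗ₜ[k] 1 := Bialgebra.comul_one
      rw [counit_apply, counit_apply, counit_apply,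
        ev_mul_repr a b (r := (⟨{()}, fun _ => 1, fun _ => 1, by simp [h1]⟩ :
          Coalgebra.Repr k (1 : H) Unit))]
      simp)
    (by
      refine rainbowTwo.injective (dual_ext_two fun h h' => ?_)
      rw [rainbowTwo_comul, Algebra.TensorProduct.one_def, rainbowTwo_tmul, ev_one, ev_one, ev_one,
        Bialgebra.counit_mul, mul_comm])
    (by
      intro a b
      refine rainbowTwo.injective (dual_ext_two fun h h' => ?_)
      have r := Coalgebra.Repr.arbitrary k h
      have r' := Coalgebra.Repr.arbitrary k h'
      rw [rainbowTwo_comul, rainbowTwo_mul_repr _ _ r r', ev_mul_repr a b (r.mul r')]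
      refine (Finset.sum_product _ _ _).trans ?_
      refine Finset.sum_congr rfl fun i _ => Finset.sum_congr rfl fun j _ => ?_
      rw [rainbowTwo_comul, rainbowTwo_comul]
      rfl)

end Structure

end HDual

/-! ### Bicomplexes -/

/-- The families `d : C (n+1) m → C n m` and `d' : C n (m+1) → C n m` turn the bigraded vector
space `C` into a (chain) bicomplex with anticommuting differentials. -/
structure IsBicomplex {k : Type*} [Field k] {C : ℕ → ℕ → Type*}
    [∀ n m, AddCommGroup (C n m)] [∀ n m, Module k (C n m)]
    (d : ∀ n m, C (n + 1) m →ₗ[k] C n m) (d' : ∀ n m, C n (m + 1) →ₗ[k] C n m) : Prop where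
  d_comp_d : ∀ n m, d n m ∘ₗ d (n + 1) m = 0
  d'_comp_d' : ∀ n m, d' n m ∘ₗ d' n (m + 1) = 0
  anticomm : ∀ n m, d n m ∘ₗ d' (n + 1) m + d' n m ∘ₗ d n (m + 1) = 0

/-! ### Adjoint actions -/

section Adjoint

variable {k : Type*} [Field k] {A B : Type*} [AddCommGroup A] [Module k A] [Coalgebra k A]
  [AddCommGroup B] [Module k B] [Coalgebra k B]

/-- The left adjoint action of `A` on `Bⁿ` for a pairing `p` of `A` with `B`:
`a ⊗ b₁ ⋯ bₙ ↦ p(a₍₁₎, bₙ₍₁₎) p(a₍₂₎, bₙ₋₁₍₁₎) ⋯ p(a₍ₙ₎, b₁₍₁₎) b₁₍₂₎ ⋯ bₙ₍₂₎`. -/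
def leftAdj (p : A →ₗ[k] B →ₗ[k] k) (n : ℕ) : A ⊗[k] (⨂[k]^n B) →ₗ[k] (⨂[k]^n B) :=
  contractLeft (rainbow p n) (⨂[k]^n B) ∘ₗ
    TensorProduct.map (iterComul k A n) (split k B n)

/-- The right adjoint action of `A` on `Bⁿ` for a pairing `p` of `A` with `B`:
`b₁ ⋯ bₙ ⊗ a ↦ p(a₍₁₎, bₙ₍₂₎) p(a₍₂₎, bₙ₋₁₍₂₎) ⋯ p(a₍ₙ₎, b₁₍₂₎) b₁₍₁₎ ⋯ bₙ₍₁₎`. -/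
def rightAdj (p : A →ₗ[k] B →ₗ[k] k) (n : ℕ) : (⨂[k]^n B) ⊗[k] A →ₗ[k] (⨂[k]^n B) :=
  contractLeft (rainbow p n) (⨂[k]^n B) ∘ₗ
    TensorProduct.map (iterComul k A n)
      ((TensorProduct.comm k (⨂[k]^n B) (⨂[k]^n B)).toLinearMap ∘ₗ split k B n) ∘ₗ
    (TensorProduct.comm k (⨂[k]^n B) A).toLinearMap

end Adjoint

/-! ### The four bicomplex structures on `T(H) ⊗ T(H*)` -/

section Table

variable (k H : Type*) [Field k] [Ring H] [Bialgebra k H] [Module.Finite k H]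

/-- The component `Hⁿ ⊗ (H*)ᵐ` of `T(H) ⊗ T(H*)`. -/
abbrev Cx (n m : ℕ) : Type _ := (⨂[k]^n H) ⊗[k] (⨂[k]^m (HDual k H))

/-- The bar differential on `T(H) ⊗ T(H*)`. -/
def dBar (n m : ℕ) : Cx k H (n + 1) m →ₗ[k] Cx k H n m := (bar k H n).rTensor _

/-- The (dual of the) cobar differential on `T(H) ⊗ T(H*)`: the bar differential of `H*`. -/
def dCob (n m : ℕ) : Cx k H n (m + 1) →ₗ[k] Cx k H n m := (bar k (HDual k H) m).lTensor _

/-- The endomorphism `^{H*}π`: the leftmost factor `l₁` acts from the right on `h₁ ⋯ hₙ`. -/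
def piDualRight (n m : ℕ) : Cx k H n (m + 1) →ₗ[k] Cx k H n m :=
  (rightAdj (HDual.ev k H) n).rTensor _ ∘ₗ
    (TensorProduct.assoc k _ _ _).symm.toLinearMap ∘ₗ
    (cons k (HDual k H) m).symm.toLinearMap.lTensor _

/-- The endomorphism `π^{H*}`: the rightmost factor `lₘ` acts from the left on `h₁ ⋯ hₙ`. -/
def piDualLeft (n m : ℕ) : Cx k H n (m + 1) →ₗ[k] Cx k H n m :=
  (leftAdj (HDual.ev k H) n).rTensor _ ∘ₗ
    (TensorProduct.assoc k _ _ _).symm.toLinearMap ∘ₗ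
    (TensorProduct.comm k (Cx k H n m) (HDual k H)).toLinearMap ∘ₗ
    (TensorProduct.assoc k _ _ _).symm.toLinearMap ∘ₗ
    (snoc k (HDual k H) m).symm.toLinearMap.lTensor _

/-- The endomorphism `π^H`: the rightmost factor `hₙ` acts from the left on `l₁ ⋯ lₘ`. -/
def piLeft (n m : ℕ) : Cx k H (n + 1) m →ₗ[k] Cx k H n m :=
  (leftAdj (HDual.ev k H).flip m).lTensor _ ∘ₗ
    (TensorProduct.assoc k _ _ _).toLinearMap ∘ₗ
    (snoc k H n).symm.toLinearMap.rTensor _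

/-- The endomorphism `^Hπ`: the leftmost factor `h₁` acts from the right on `l₁ ⋯ lₘ`. -/
def piRight (n m : ℕ) : Cx k H (n + 1) m →ₗ[k] Cx k H n m :=
  (rightAdj (HDual.ev k H).flip m).lTensor _ ∘ₗ
    (TensorProduct.assoc k _ _ _).toLinearMap ∘ₗ
    (TensorProduct.comm k H (Cx k H n m)).toLinearMap ∘ₗ
    (TensorProduct.assoc k _ _ _).toLinearMap ∘ₗ
    (cons k H n).symm.toLinearMap.rTensor _

/-- The differentials `d_{n+1,m}` of the four bicomplexes (numbered from zero). -/
def tableD : Fin 4 → ∀ n m, Cx k H (n + 1) m →ₗ[k] Cx k H n m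
  | 0 => fun n m => dBar k H n m
  | 1 => fun n m => dBar k H n m + (-1 : k) ^ (n + 1) • piLeft k H n m
  | 2 => fun n m => dBar k H n m + piRight k H n m
  | 3 => fun n m => dBar k H n m + (-1 : k) ^ (n + 1) • piLeft k H n m + piRight k H n m

/-- The differentials `d'_{n,m+1}` of the four bicomplexes. -/
def tableD' : Fin 4 → ∀ n m, Cx k H n (m + 1) →ₗ[k] Cx k H n m
  | 0 => fun n m => (-1 : k) ^ n • dCob k H n m
  | 1 => fun n m => (-1 : k) ^ n • dCob k H n m + (-1 : k) ^ n • piDualRight k H n m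
  | 2 => fun n m => (-1 : k) ^ n • dCob k H n m + (-1 : k) ^ (n + (m + 1)) • piDualLeft k H n m
  | 3 => fun n m => (-1 : k) ^ n • dCob k H n m + (-1 : k) ^ n • piDualRight k H n m +
      (-1 : k) ^ (n + (m + 1)) • piDualLeft k H n m

end Table

/-! ### The Gerstenhaber-Schack bicomplex -/

section GerstenhaberSchack

variable (k H : Type*) [Field k] [Ring H] [Bialgebra k H]

/-- Gerstenhaber-Schack cochains `Hom(Hⁿ, Hᵐ)`. -/
abbrev GS (n m : ℕ) : Type _ := (⨂[k]^n H) →ₗ[k] (⨂[k]^m H)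

/-- The Hochschild differential with coefficients in `Hᵐ` with the diagonal `H`-bimodule structure:
`f ↦ (h₁ ⋯ hₙ₊₁ ↦ Δᵐ(h₁) f(h₂ ⋯ hₙ₊₁) + ∑_{i=1}^{n} (-1)^i f(h₁ ⋯ (hᵢ hᵢ₊₁) ⋯ hₙ₊₁)
+ (-1)^{n+1} f(h₁ ⋯ hₙ) Δᵐ(hₙ₊₁))`. -/
def gsHoch (n m : ℕ) : GS k H n m →ₗ[k] GS k H (n + 1) m where
  toFun f :=
    LinearMap.mul' k (⨂[k]^m H) ∘ₗ TensorProduct.map (iterComul k H m) f ∘ₗ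
        (cons k H n).symm.toLinearMap +
      f ∘ₗ bar k H n +
      (-1 : k) ^ (n + 1) • (LinearMap.mul' k (⨂[k]^m H) ∘ₗ
        TensorProduct.map f (iterComul k H m) ∘ₗ (snoc k H n).symm.toLinearMap)
  map_add' f g := by
    simp only [TensorProduct.map_add_left, TensorProduct.map_add_right, LinearMap.add_comp,
      LinearMap.comp_add, smul_add]
    abel
  map_smul' r f := by
    simp only [TensorProduct.map_smul_left, TensorProduct.map_smul_right, LinearMap.smul_comp,
      LinearMap.comp_smul, smul_add, RingHom.id_apply, smul_comm r]

/-- The co-Hochschild (Cartier) differential with coefficients in `Hⁿ` with the codiagonal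
`H`-bicomodule structure:
`f ↦ (h ↦ (h₁₍₁₎ ⋯ hₙ₍₁₎) ⊗ f(h₍₂₎) + ∑_{j=1}^{m} (-1)^j Δ_j f(h)
+ (-1)^{m+1} f(h₍₁₎) ⊗ (h₁₍₂₎ ⋯ hₙ₍₂₎))`,
where `Δ_j` is the comultiplication of the `j`-th factor, and the bracketed expressions are products
in `H`. -/
def gsCoHoch (n m : ℕ) : GS k H n m →ₗ[k] GS k H n (m + 1) where
  toFun f :=
    (cons k H m).toLinearMap ∘ₗ TensorProduct.map (prodAll k H n) f ∘ₗ split k H n +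
      (∑ j : Fin m, (-1 : k) ^ ((j : ℕ) + 1) • comulAt k H m j) ∘ₗ f +
      (-1 : k) ^ (m + 1) • ((snoc k H m).toLinearMap ∘ₗ
        TensorProduct.map f (prodAll k H n) ∘ₗ split k H n)
  map_add' f g := by
    simp only [TensorProduct.map_add_left, TensorProduct.map_add_right, LinearMap.add_comp,
      LinearMap.comp_add, smul_add]
    abel
  map_smul' r f := by
    simp only [TensorProduct.map_smul_left, TensorProduct.map_smul_right, LinearMap.smul_comp,
      LinearMap.comp_smul, smul_add, RingHom.id_apply, smul_comm r]

end GerstenhaberSchack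

/-! ### Hopf modules -/

section HopfModules

variable {k A : Type*} [Field k] [Ring A] [Bialgebra k A] {M : Type*} [AddCommGroup M] [Module k M]

/-- `(M, ρ, δ)` is a right-right Hopf module over the bialgebra `A`. -/
structure IsRightHopfModule (ρ : M ⊗[k] A →ₗ[k] M) (δ : M →ₗ[k] M ⊗[k] A) : Prop where
  act_one : ∀ a, ρ (a ⊗ₜ 1) = a
  act_mul : ∀ a x y, ρ (ρ (a ⊗ₜ x) ⊗ₜ y) = ρ (a ⊗ₜ (x * y))
  coact_counit : ∀ a, TensorProduct.rid k M
    ((Coalgebra.counit (R := k) (A := A)).lTensor M (δ a)) = a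
  coact_comul : ∀ a, TensorProduct.assoc k M A A (δ.rTensor A (δ a)) =
    (Coalgebra.comul (R := k) (A := A)).lTensor M (δ a)
  compat : δ ∘ₗ ρ = TensorProduct.map ρ (LinearMap.mul' k A) ∘ₗ
    (TensorProduct.tensorTensorTensorComm k M A A A).toLinearMap ∘ₗ
    TensorProduct.map δ Coalgebra.comul

/-- `(N, θ, γ)` is a left-left Hopf module over the bialgebra `A`. -/
structure IsLeftHopfModule (θ : A ⊗[k] M →ₗ[k] M) (γ : M →ₗ[k] A ⊗[k] M) : Prop where
  act_one : ∀ b, θ (1 ⊗ₜ b) = b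
  act_mul : ∀ x y b, θ (x ⊗ₜ θ (y ⊗ₜ b)) = θ ((x * y) ⊗ₜ b)
  coact_counit : ∀ b, TensorProduct.lid k M
    ((Coalgebra.counit (R := k) (A := A)).rTensor M (γ b)) = b
  coact_comul : ∀ b, TensorProduct.assoc k A A M
    ((Coalgebra.comul (R := k) (A := A)).rTensor M (γ b)) = γ.lTensor A (γ b)
  compat : γ ∘ₗ θ = TensorProduct.map (LinearMap.mul' k A) θ ∘ₗ
    (TensorProduct.tensorTensorTensorComm k A A A M).toLinearMap ∘ₗ
    TensorProduct.map Coalgebra.comul γ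

end HopfModules

section DualHopfModule

variable {k H : Type*} [Field k] [Ring H] [Bialgebra k H]
  {N : Type*} [AddCommGroup N] [Module k N]

/-- The right `H`-action on `N*` induced by a left `H*`-coaction `γ` on `N`:
`(φ · h)(b) = ⟨b₍₋₁₎, h⟩ φ(b₍₀₎)`. -/
def dualAct (γ : N →ₗ[k] HDual k H ⊗[k] N) : Module.Dual k N ⊗[k] H →ₗ[k] Module.Dual k N :=
  TensorProduct.lift (LinearMap.mk₂ k
    (fun φ h => LinearMap.mul' k k ∘ₗ TensorProduct.map ((HDual.ev k H).flip h) φ ∘ₗ γ)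
    (fun φ φ' h => by simp only [TensorProduct.map_add_right, LinearMap.add_comp, LinearMap.comp_add])
    (fun r φ h => by
      simp only [TensorProduct.map_smul_right, LinearMap.smul_comp, LinearMap.comp_smul])
    (fun φ h h' => by
      simp only [map_add, TensorProduct.map_add_left, LinearMap.add_comp, LinearMap.comp_add])
    (fun r φ h => by
      simp only [map_smul, TensorProduct.map_smul_left, LinearMap.smul_comp, LinearMap.comp_smul]))

/-- The right `H`-coaction on `N*` dual to a left `H*`-action `θ` on `N`: it is characterised by
`⟨l, φ₍₁₎⟩ φ₍₀₎(b) = φ(l · b)`, i.e. `φ ↦ ∑ᵢ φ(eⁱ · -) ⊗ eᵢ` for dual bases of `H` and `H*`. -/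
def dualCoact [Module.Finite k H] (θ : HDual k H ⊗[k] N →ₗ[k] N) :
    Module.Dual k N →ₗ[k] Module.Dual k N ⊗[k] H :=
  ∑ i, (TensorProduct.mk k (Module.Dual k N) H).flip (Module.finBasis k H i) ∘ₗ
    (θ ∘ₗ TensorProduct.mk k (HDual k H) N
      (HDual.toDual.symm ((Module.finBasis k H).coord i))).dualMap

end DualHopfModule

/-! ### The bicomplex with Hopf module coefficients -/

section Coefficients

variable {k H : Type*} [Field k] [Ring H] [Bialgebra k H]
  {M : Type*} [AddCommGroup M] [Module k M] {N : Type*} [AddCommGroup N] [Module k N]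

variable (k H M N) in
/-- The component `M ⊗ Hⁿ ⊗ (H*)ᵐ ⊗ N`. -/
abbrev CoefCx (n m : ℕ) : Type _ :=
  (M ⊗[k] (⨂[k]^n H)) ⊗[k] ((⨂[k]^m (HDual k H)) ⊗[k] N)

/-- The action on the left coefficients `a ⊗ h₁ ⋯ hₙ₊₁ ↦ a h₁ ⊗ h₂ ⋯ hₙ₊₁`. -/
def actFirst (ρ : M ⊗[k] H →ₗ[k] M) (n : ℕ) :
    M ⊗[k] (⨂[k]^(n + 1) H) →ₗ[k] M ⊗[k] (⨂[k]^n H) :=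
  ρ.rTensor _ ∘ₗ (TensorProduct.assoc k _ _ _).symm.toLinearMap ∘ₗ
    (cons k H n).symm.toLinearMap.lTensor M

/-- `a ⊗ h₁ ⋯ hₙ ↦ (a₍₀₎ ⊗ h₁₍₁₎ ⋯ hₙ₍₁₎) ⊗ (a₍₁₎ h₁₍₂₎ ⋯ hₙ₍₂₎)`, the last bracket being an element
of `Hⁿ⁺¹`. -/
def splitLeft (δ : M →ₗ[k] M ⊗[k] H) (n : ℕ) :
    M ⊗[k] (⨂[k]^n H) →ₗ[k] (M ⊗[k] (⨂[k]^n H)) ⊗[k] (⨂[k]^(n + 1) H) :=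
  (cons k H n).toLinearMap.lTensor _ ∘ₗ
    (TensorProduct.tensorTensorTensorComm k _ _ _ _).toLinearMap ∘ₗ
    TensorProduct.map δ (split k H n)

variable [Module.Finite k H]

/-- `l₁ ⋯ lₘ ⊗ b ↦ (l₁₍₁₎ ⋯ lₘ₍₁₎ b₍₋₁₎) ⊗ (l₁₍₂₎ ⋯ lₘ₍₂₎ ⊗ b₍₀₎)`, the first bracket being an
element of `(H*)ᵐ⁺¹`. -/
def splitRight (γ : N →ₗ[k] HDual k H ⊗[k] N) (m : ℕ) :
    (⨂[k]^m (HDual k H)) ⊗[k] N →ₗ[k]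
      (⨂[k]^(m + 1) (HDual k H)) ⊗[k] ((⨂[k]^m (HDual k H)) ⊗[k] N) :=
  (snoc k (HDual k H) m).toLinearMap.rTensor _ ∘ₗ
    (TensorProduct.tensorTensorTensorComm k _ _ _ _).toLinearMap ∘ₗ
    TensorProduct.map (split k (HDual k H) m) γ

/-- `^Hπ` with coefficients: the action `ρ` on the two leftmost factors. -/
def coefPiRight (ρ : M ⊗[k] H →ₗ[k] M) (n m : ℕ) :
    CoefCx k H M N (n + 1) m →ₗ[k] CoefCx k H M N n m :=
  (actFirst ρ n).rTensor _

/-- `π^{H*}` with coefficients: the action `θ` on the two rightmost factors. -/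
def coefPiDualLeft (θ : HDual k H ⊗[k] N →ₗ[k] N) (n m : ℕ) :
    CoefCx k H M N n (m + 1) →ₗ[k] CoefCx k H M N n m :=
  (θ.lTensor _ ∘ₗ (TensorProduct.assoc k _ _ _).toLinearMap ∘ₗ
    (snoc k (HDual k H) m).symm.toLinearMap.rTensor N).lTensor _

/-- `π^H` with coefficients: `a ⊗ h₁ ⋯ hₙ ⊗ l₁ ⋯ lₘ ⊗ b` is sent to
`⟨l₁₍₁₎, hₙ₍ₘ₊₁₎⟩ ⋯ ⟨lₘ₍₁₎, hₙ₍₂₎⟩ ⟨b₍₋₁₎, hₙ₍₁₎⟩ a ⊗ h₁ ⋯ hₙ₋₁ ⊗ l₁₍₂₎ ⋯ lₘ₍₂₎ ⊗ b₍₀₎`. -/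
def coefPiLeft (γ : N →ₗ[k] HDual k H ⊗[k] N) (n m : ℕ) :
    CoefCx k H M N (n + 1) m →ₗ[k] CoefCx k H M N n m :=
  (contractLeft (rainbow (HDual.ev k H).flip (m + 1)) _ ∘ₗ
      TensorProduct.map (iterComul k H (m + 1)) (splitRight γ m)).lTensor _ ∘ₗ
    (TensorProduct.assoc k _ _ _).toLinearMap ∘ₗ
    ((TensorProduct.assoc k _ _ _).symm.toLinearMap ∘ₗ
      (snoc k H n).symm.toLinearMap.lTensor M).rTensor _

/-- `^{H*}π` with coefficients: `a ⊗ h₁ ⋯ hₙ ⊗ l₁ ⋯ lₘ ⊗ b` is sent to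
`⟨l₁₍₁₎, hₙ₍₂₎⟩ ⋯ ⟨l₁₍ₙ₎, h₁₍₂₎⟩ ⟨l₁₍ₙ₊₁₎, a₍₁₎⟩ a₍₀₎ ⊗ h₁₍₁₎ ⋯ hₙ₍₁₎ ⊗ l₂ ⋯ lₘ ⊗ b`. -/
def coefPiDualRight (δ : M →ₗ[k] M ⊗[k] H) (n m : ℕ) :
    CoefCx k H M N n (m + 1) →ₗ[k] CoefCx k H M N n m :=
  (contractLeft (rainbow (HDual.ev k H) (n + 1)) _ ∘ₗ
      TensorProduct.map (iterComul k (HDual k H) (n + 1))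
        ((TensorProduct.comm k _ _).toLinearMap ∘ₗ splitLeft δ n) ∘ₗ
      (TensorProduct.comm k (M ⊗[k] (⨂[k]^n H)) (HDual k H)).toLinearMap).rTensor _ ∘ₗ
    (TensorProduct.assoc k _ _ _).symm.toLinearMap ∘ₗ
    ((TensorProduct.assoc k _ _ _).toLinearMap ∘ₗ
      (cons k (HDual k H) m).symm.toLinearMap.rTensor N).lTensor _

/-- The differential `d_{n+1,m} = d_bar + (-1)^{n+1} π^H + ^Hπ` with coefficients. -/
def coefD (ρ : M ⊗[k] H →ₗ[k] M) (γ : N →ₗ[k] HDual k H ⊗[k] N) (n m : ℕ) :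
    CoefCx k H M N (n + 1) m →ₗ[k] CoefCx k H M N n m :=
  ((bar k H n).lTensor M).rTensor _ + (-1 : k) ^ (n + 1) • coefPiLeft γ n m + coefPiRight ρ n m

/-- The differential `d'_{n,m+1} = (-1)^n d_cob + (-1)^n ^{H*}π + (-1)^{n+m+1} π^{H*}` with
coefficients. -/
def coefD' (δ : M →ₗ[k] M ⊗[k] H) (θ : HDual k H ⊗[k] N →ₗ[k] N) (n m : ℕ) :
    CoefCx k H M N n (m + 1) →ₗ[k] CoefCx k H M N n m :=
  (-1 : k) ^ n • ((bar k (HDual k H) m).rTensor N).lTensor _ +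
    (-1 : k) ^ n • coefPiDualRight δ n m + (-1 : k) ^ (n + (m + 1)) • coefPiDualLeft θ n m

end Coefficients

/-! ### The Panaite-Ştefan bicomplex of a pair of Hopf modules -/

section PanaiteStefan

variable {k H : Type*} [Field k] [Ring H] [Bialgebra k H]
  {M : Type*} [AddCommGroup M] [Module k M] {P : Type*} [AddCommGroup P] [Module k P]

variable (k H M P) in
/-- Panaite-Ştefan cochains `Hom(M ⊗ Hⁿ, P ⊗ Hᵐ)`. -/
abbrev PS (n m : ℕ) : Type _ := (M ⊗[k] (⨂[k]^n H)) →ₗ[k] (P ⊗[k] (⨂[k]^m H))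

/-- The diagonal right action of `H` on `P ⊗ Hᵐ`:
`(q ⊗ x₁ ⋯ xₘ) · h = q h₍₁₎ ⊗ (x₁ h₍₂₎) ⋯ (xₘ h₍ₘ₊₁₎)`. -/
def diagAct (ρ : P ⊗[k] H →ₗ[k] P) (m : ℕ) :
    (P ⊗[k] (⨂[k]^m H)) ⊗[k] H →ₗ[k] P ⊗[k] (⨂[k]^m H) :=
  TensorProduct.map ρ (LinearMap.mul' k (⨂[k]^m H)) ∘ₗ
    (TensorProduct.tensorTensorTensorComm k _ _ _ _).toLinearMap ∘ₗ
    ((cons k H m).symm.toLinearMap ∘ₗ iterComul k H (m + 1)).lTensor _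

/-- The codiagonal right coaction of `H` on `M ⊗ Hⁿ`:
`a ⊗ h₁ ⋯ hₙ ↦ a₍₀₎ ⊗ h₁₍₁₎ ⋯ hₙ₍₁₎ ⊗ (a₍₁₎ · h₁₍₂₎ · … · hₙ₍₂₎)`. -/
def diagCoact (δ : M →ₗ[k] M ⊗[k] H) (n : ℕ) :
    M ⊗[k] (⨂[k]^n H) →ₗ[k] (M ⊗[k] (⨂[k]^n H)) ⊗[k] H :=
  (prodAll k H (n + 1)).lTensor _ ∘ₗ splitLeft δ n

/-- The differential
`f ↦ (a ⊗ h₁ ⋯ hₙ₊₁ ↦ f(a h₁ ⊗ h₂ ⋯ hₙ₊₁) + ∑_{i=1}^{n} (-1)^i f(a ⊗ h₁ ⋯ (hᵢ hᵢ₊₁) ⋯ hₙ₊₁)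
+ (-1)^{n+1} f(a ⊗ h₁ ⋯ hₙ) · hₙ₊₁)`, with the diagonal action of `H` on `P ⊗ Hᵐ`. -/
def psHoch (ρM : M ⊗[k] H →ₗ[k] M) (ρP : P ⊗[k] H →ₗ[k] P) (n m : ℕ) :
    PS k H M P n m →ₗ[k] PS k H M P (n + 1) m where
  toFun f :=
    f ∘ₗ actFirst ρM n + f ∘ₗ (bar k H n).lTensor M +
      (-1 : k) ^ (n + 1) • (diagAct ρP m ∘ₗ f.rTensor H ∘ₗ
        (TensorProduct.assoc k _ _ _).symm.toLinearMap ∘ₗ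
        (snoc k H n).symm.toLinearMap.lTensor M)
  map_add' f g := by
    simp only [LinearMap.rTensor_add, LinearMap.add_comp, LinearMap.comp_add, smul_add]
    abel
  map_smul' r f := by
    simp only [LinearMap.rTensor_smul, LinearMap.smul_comp, LinearMap.comp_smul, smul_add,
      RingHom.id_apply, smul_comm r]

/-- The differential
`f ↦ (x ↦ (δ_P ⊗ Id) f(x) + ∑_{j=1}^{m} (-1)^j Δ_j f(x) + (-1)^{m+1} f(x₍₀₎) ⊗ x₍₁₎)` for `x` in
`M ⊗ Hⁿ` with its codiagonal coaction, where `Δ_j` is the comultiplication of the `j`-th factor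
of `Hᵐ`. -/
def psCoHoch (δM : M →ₗ[k] M ⊗[k] H) (δP : P →ₗ[k] P ⊗[k] H) (n m : ℕ) :
    PS k H M P n m →ₗ[k] PS k H M P n (m + 1) where
  toFun f :=
    (cons k H m).toLinearMap.lTensor P ∘ₗ (TensorProduct.assoc k _ _ _).toLinearMap ∘ₗ
        δP.rTensor _ ∘ₗ f +
      (∑ j : Fin m, (-1 : k) ^ ((j : ℕ) + 1) • comulAt k H m j).lTensor P ∘ₗ f +
      (-1 : k) ^ (m + 1) • ((snoc k H m).toLinearMap.lTensor P ∘ₗ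
        (TensorProduct.assoc k _ _ _).toLinearMap ∘ₗ f.rTensor H ∘ₗ diagCoact δM n)
  map_add' f g := by
    simp only [LinearMap.rTensor_add, LinearMap.add_comp, LinearMap.comp_add, smul_add]
    abel
  map_smul' r f := by
    simp only [LinearMap.rTensor_smul, LinearMap.smul_comp, LinearMap.comp_smul, smul_add,
      RingHom.id_apply, smul_comm r]

end PanaiteStefan

end BialgCx

end

noncomputable section

namespace BialgCx

/-! ### Adding a letter at either end of a tensor power -/

section TensorPowers

variable {k : Type*} [Field k] {V : Type*} [AddCommGroup V] [Module k V]

/-! Everything rests on one symmetric notion, `IsBialgebraPairing`: a pairing of two bialgebras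
under which each multiplication is dual to the comultiplication of the other side, with the order
reversal of the rainbow rule. Evaluation of H* on H is such a pairing, and the flip of such a
pairing is one again. So H and H* play interchangeable roles, and a fact about d becomes one about
d' by flipping the pairing and interchanging the tensor factors (`swapMap`).

Under the rainbow pairing, the left adjoint action of a is the transpose of z ↦ z Δⁿ(a), the right
one of z ↦ Δⁿ(a) z, and multiplication of two neighbours is the transpose of comultiplication of one
factor. The pairing of tensor powers is perfect (`rainbow_bijective`), so identities between these
operators may be checked on transposes. Multiplicativity of Δⁿ then makes (H*)ᵐ a bimodule over H,
and coassociativity makes the bar differential of H* equivariant.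

Hence d is the Hochschild boundary of H with coefficients in (H*)ᵐ, each of the two actions being
kept or switched off by an idempotent scalar; `hoch_comp_hoch` gives d² = 0, and likewise for d'.
Without the sign (-1)ⁿ the two differentials commute term by term: the bar parts live on different
factors, a bar part commutes with a face by equivariance, and for two faces, consuming a letter a of
H and a letter b of H*, both composites are the same sum: one Sweedler component of a is paired with
one of b, and the remaining components act on the two remaining words. The sign (-1)ⁿ turns
commutation into anticommutation.

For the Gerstenhaber–Schack complex, f ↦ ⟨y, f(x)⟩ transposes each term of the cochain differentials
into one term of d or d'. The rainbow reversal matches comultiplication of the j-th factor with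
multiplication at place m+1-j, which costs a global sign (-1)^{m+1} in the second differential; the
sign (-1)^{m(m+1)/2} absorbs it.

With Hopf module coefficients, H acts on (H*)ᵐ ⊗ N by the tensor product of the adjoint action and
the action coming from the coaction of N, and on M by ρ, so d is again a Hochschild boundary;
symmetrically for d'. The Hopf compatibility is what makes the two faces at the M-end commute, and
the two faces at the N-end. The axioms for N* are tested by contracting the H-leg with every l in
H*. The comparison with the Panaite–Ştefan complex repeats the previous argument; since N* ⊗ Hᵐ is
the full dual of (H*)ᵐ ⊗ N for every N, it needs no finiteness of N. -/

theorem cons_tprod (n : ℕ) (v : V) (x : Fin n → V) :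
    cons k V n (v ⊗ₜ PiTensorProduct.tprod k x) =
      PiTensorProduct.tprod k (Fin.cons (α := fun _ => V) v x) := by
  have h : (PiTensorProduct.subsingletonEquiv (R := k) (s := fun _ : Fin 1 => V) 0).symm v =
      PiTensorProduct.tprod k (fun _ => v) := by
    rw [LinearEquiv.symm_apply_eq, PiTensorProduct.subsingletonEquiv_apply_tprod]
  simp only [cons, LinearEquiv.trans_apply, TensorProduct.congr_tmul, LinearEquiv.refl_apply, h]
  rw [← TensorPower.gMul_def, TensorPower.tprod_mul_tprod, TensorPower.cast_tprod]
  congr 1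
  funext i
  refine Fin.cases ?_ (fun j => ?_) i
  · have : Fin.cast (Nat.add_comm 1 n).symm 0 = Fin.castAdd n (0 : Fin 1) := by ext; simp
    simp only [Function.comp_apply, this, Fin.append_left, Fin.cons_zero]
  · have : Fin.cast (Nat.add_comm 1 n).symm j.succ = Fin.natAdd 1 j := by
      ext; simp [Nat.add_comm]
    simp only [Function.comp_apply, this, Fin.append_right, Fin.cons_succ]

theorem snoc_tprod (n : ℕ) (x : Fin n → V) (v : V) :
    snoc k V n (PiTensorProduct.tprod k x ⊗ₜ v) =
      PiTensorProduct.tprod k (Fin.snoc (α := fun _ => V) x v) := by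
  have h : (PiTensorProduct.subsingletonEquiv (R := k) (s := fun _ : Fin 1 => V) 0).symm v =
      PiTensorProduct.tprod k (fun _ => v) := by
    rw [LinearEquiv.symm_apply_eq, PiTensorProduct.subsingletonEquiv_apply_tprod]
  simp only [snoc, LinearEquiv.trans_apply, TensorProduct.congr_tmul, LinearEquiv.refl_apply, h]
  rw [← TensorPower.gMul_def, TensorPower.tprod_mul_tprod]
  congr 1
  exact Fin.append_right_eq_snoc x _

variable {W : Type*} [AddCommGroup W] [Module k W]

theorem tprod_induction {n : ℕ} {f g : (⨂[k]^n V) →ₗ[k] W}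
    (h : ∀ x : Fin n → V, f (PiTensorProduct.tprod k x) = g (PiTensorProduct.tprod k x)) :
    f = g :=
  PiTensorProduct.ext (MultilinearMap.ext h)

theorem cons_ext {n : ℕ} {f g : (⨂[k]^(n + 1) V) →ₗ[k] W}
    (h : ∀ v x, f (cons k V n (v ⊗ₜ x)) = g (cons k V n (v ⊗ₜ x))) : f = g := by
  refine LinearMap.ext fun z => ?_
  obtain ⟨t, rfl⟩ := (cons k V n).surjective z
  exact LinearMap.congr_fun (f := f ∘ₗ (cons k V n).toLinearMap)
    (g := g ∘ₗ (cons k V n).toLinearMap) (TensorProduct.ext' h) t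

theorem snoc_ext {n : ℕ} {f g : (⨂[k]^(n + 1) V) →ₗ[k] W}
    (h : ∀ x v, f (snoc k V n (x ⊗ₜ v)) = g (snoc k V n (x ⊗ₜ v))) : f = g := by
  refine LinearMap.ext fun z => ?_
  obtain ⟨t, rfl⟩ := (snoc k V n).surjective z
  exact LinearMap.congr_fun (f := f ∘ₗ (snoc k V n).toLinearMap)
    (g := g ∘ₗ (snoc k V n).toLinearMap) (TensorProduct.ext' h) t

theorem cons_induction {n : ℕ} {P : (⨂[k]^(n + 1) V) → Prop} (hadd : ∀ x y, P x → P y → P (x + y))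
    (h : ∀ v x, P (cons k V n (v ⊗ₜ x))) (z : ⨂[k]^(n + 1) V) : P z := by
  obtain ⟨t, rfl⟩ := (cons k V n).surjective z
  induction t with
  | zero => simpa using h 0 0
  | tmul v x => exact h v x
  | add x y hx hy => rw [map_add]; exact hadd _ _ hx hy

theorem snoc_induction {n : ℕ} {P : (⨂[k]^(n + 1) V) → Prop} (hadd : ∀ x y, P x → P y → P (x + y))
    (h : ∀ x v, P (snoc k V n (x ⊗ₜ v))) (z : ⨂[k]^(n + 1) V) : P z := by
  obtain ⟨t, rfl⟩ := (snoc k V n).surjective z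
  induction t with
  | zero => simpa using h 0 0
  | tmul v x => exact h v x
  | add x y hx hy => rw [map_add]; exact hadd _ _ hx hy

variable (k V) in
/-- The empty tensor. -/
def emptyTensor : ⨂[k]^0 V := PiTensorProduct.tprod k Fin.elim0

theorem exists_smul_emptyTensor (x : ⨂[k]^0 V) : ∃ c : k, x = c • emptyTensor k V :=
  ⟨TensorPower.algebraMap₀.symm x, by
    have := TensorPower.algebraMap₀_eq_smul_one (M := V) (TensorPower.algebraMap₀.symm x)
    rw [LinearEquiv.apply_symm_apply] at this
    exact this⟩

theorem algebraMap₀_eq (c : k) :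
    (TensorPower.algebraMap₀ c : ⨂[k]^0 V) = c • emptyTensor k V :=
  TensorPower.algebraMap₀_eq_smul_one c

theorem zero_ext {f g : (⨂[k]^0 V) →ₗ[k] W} (h : f (emptyTensor k V) = g (emptyTensor k V)) :
    f = g := by
  refine LinearMap.ext fun x => ?_
  obtain ⟨c, rfl⟩ := exists_smul_emptyTensor x
  rw [map_smul, map_smul, h]

/-- The bridge between recursions that peel the first letter and statements about the last letter.
-/
theorem cons_snoc (n : ℕ) (v w : V) (x : ⨂[k]^n V) :
    cons k V (n + 1) (v ⊗ₜ snoc k V n (x ⊗ₜ w)) = snoc k V (n + 1) (cons k V n (v ⊗ₜ x) ⊗ₜ w) := by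
  let f : (⨂[k]^n V) →ₗ[k] (⨂[k]^(n + 1 + 1) V) := (cons k V (n + 1)).toLinearMap ∘ₗ
    TensorProduct.mk k _ _ v ∘ₗ (snoc k V n).toLinearMap ∘ₗ (TensorProduct.mk k _ _).flip w
  let g : (⨂[k]^n V) →ₗ[k] (⨂[k]^(n + 1 + 1) V) := (snoc k V (n + 1)).toLinearMap ∘ₗ
    (TensorProduct.mk k _ _).flip w ∘ₗ (cons k V n).toLinearMap ∘ₗ TensorProduct.mk k _ _ v
  refine LinearMap.congr_fun (f := f) (g := g) (tprod_induction fun y => ?_) x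
  simp only [f, g, LinearMap.comp_apply, LinearEquiv.coe_coe, LinearMap.flip_apply,
    TensorProduct.mk_apply, snoc_tprod, cons_tprod, Fin.cons_snoc_eq_snoc_cons]

theorem cons_zero (v : V) :
    cons k V 0 (v ⊗ₜ emptyTensor k V) = snoc k V 0 (emptyTensor k V ⊗ₜ v) := by
  rw [emptyTensor, cons_tprod, snoc_tprod]
  congr 1
  funext i
  have : Subsingleton (Fin (0 + 1)) := inferInstanceAs (Subsingleton (Fin 1))
  rw [Subsingleton.elim i 0]
  exact (Fin.snoc_last (α := fun _ => V) v _).symm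

end TensorPowers

/-! ### Multiplication of neighbours and products of all letters -/

section Algebra

variable {k : Type*} [Field k] {A : Type*} [Ring A] [Algebra k A]

theorem cons_mul_cons (n : ℕ) (a b : A) (x y : ⨂[k]^n A) :
    cons k A n (a ⊗ₜ x) * cons k A n (b ⊗ₜ y) = cons k A n ((a * b) ⊗ₜ (x * y)) := by
  let f : (⨂[k]^n A) →ₗ[k] (⨂[k]^n A) →ₗ[k] (⨂[k]^(n + 1) A) :=
    (LinearMap.mul k (⨂[k]^(n + 1) A)).compl₁₂ ((cons k A n).toLinearMap ∘ₗ TensorProduct.mk k _ _ a)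
      ((cons k A n).toLinearMap ∘ₗ TensorProduct.mk k _ _ b)
  let g : (⨂[k]^n A) →ₗ[k] (⨂[k]^n A) →ₗ[k] (⨂[k]^(n + 1) A) :=
    (LinearMap.mul k (⨂[k]^n A)).compr₂ ((cons k A n).toLinearMap ∘ₗ TensorProduct.mk k _ _ (a * b))
  refine LinearMap.congr_fun₂ (f := f) (g := g)
    (tprod_induction fun u => tprod_induction fun v => ?_) x y
  simp only [f, g, LinearMap.compl₁₂_apply, LinearMap.compr₂_apply, LinearMap.comp_apply,
    LinearEquiv.coe_coe, LinearMap.mul_apply', TensorProduct.mk_apply, cons_tprod,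
    PiTensorProduct.tprod_mul_tprod]
  congr 1
  funext i
  refine Fin.cases ?_ (fun j => ?_) i <;> simp

theorem snoc_mul_snoc (n : ℕ) (a b : A) (x y : ⨂[k]^n A) :
    snoc k A n (x ⊗ₜ a) * snoc k A n (y ⊗ₜ b) = snoc k A n ((x * y) ⊗ₜ (a * b)) := by
  let f : (⨂[k]^n A) →ₗ[k] (⨂[k]^n A) →ₗ[k] (⨂[k]^(n + 1) A) :=
    (LinearMap.mul k (⨂[k]^(n + 1) A)).compl₁₂
      ((snoc k A n).toLinearMap ∘ₗ (TensorProduct.mk k _ _).flip a)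
      ((snoc k A n).toLinearMap ∘ₗ (TensorProduct.mk k _ _).flip b)
  let g : (⨂[k]^n A) →ₗ[k] (⨂[k]^n A) →ₗ[k] (⨂[k]^(n + 1) A) :=
    (LinearMap.mul k (⨂[k]^n A)).compr₂
      ((snoc k A n).toLinearMap ∘ₗ (TensorProduct.mk k _ _).flip (a * b))
  refine LinearMap.congr_fun₂ (f := f) (g := g)
    (tprod_induction fun u => tprod_induction fun v => ?_) x y
  simp only [f, g, LinearMap.compl₁₂_apply, LinearMap.compr₂_apply, LinearMap.comp_apply,
    LinearEquiv.coe_coe, LinearMap.mul_apply', LinearMap.flip_apply, TensorProduct.mk_apply,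
    snoc_tprod, PiTensorProduct.tprod_mul_tprod]
  congr 1
  funext i
  refine Fin.lastCases ?_ (fun j => ?_) i <;> simp

theorem emptyTensor_eq_one : emptyTensor k A = 1 := by
  rw [PiTensorProduct.one_def, emptyTensor]
  congr 1
  exact Subsingleton.elim _ _

theorem mulAt_zero (n : ℕ) (a b : A) (x : ⨂[k]^n A) :
    mulAt k A (n + 1) 0 (cons k A (n + 1) (a ⊗ₜ cons k A n (b ⊗ₜ x))) =
      cons k A n ((a * b) ⊗ₜ x) := by
  simp [mulAt]

theorem mulAt_succ (n : ℕ) (i : Fin n) (a : A) (x : ⨂[k]^(n + 1) A) :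
    mulAt k A (n + 1) i.succ (cons k A (n + 1) (a ⊗ₜ x)) = cons k A n (a ⊗ₜ mulAt k A n i x) := by
  simp [mulAt]

/-- `mulAt` recurses from the left, so its behaviour at the right end needs an induction that pushes
the first letter out of the way with `cons_snoc`. -/
theorem mulAt_last (n : ℕ) (x : ⨂[k]^n A) (a b : A) :
    mulAt k A (n + 1) (Fin.last n) (snoc k A (n + 1) (snoc k A n (x ⊗ₜ a) ⊗ₜ b)) =
      snoc k A n (x ⊗ₜ (a * b)) := by
  induction n with
  | zero =>
    obtain ⟨c, rfl⟩ := exists_smul_emptyTensor x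
    simp only [← TensorProduct.smul_tmul', map_smul, ← cons_zero, ← cons_snoc]
    rw [← mulAt_zero, Fin.last_zero]
  | succ n ih =>
    induction x using cons_induction with
    | hadd x y hx hy => simp only [TensorProduct.add_tmul, map_add, hx, hy]
    | h c x => rw [← cons_snoc, ← cons_snoc, ← Fin.succ_last, mulAt_succ, ih, cons_snoc]

theorem prodAll_zero : prodAll k A 0 (emptyTensor k A) = 1 := by
  simp [prodAll, emptyTensor]

theorem prodAll_cons (n : ℕ) (a : A) (x : ⨂[k]^n A) :
    prodAll k A (n + 1) (cons k A n (a ⊗ₜ x)) = a * prodAll k A n x := by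
  let f : (⨂[k]^n A) →ₗ[k] A := prodAll k A (n + 1) ∘ₗ (cons k A n).toLinearMap ∘ₗ
    TensorProduct.mk k _ _ a
  let g : (⨂[k]^n A) →ₗ[k] A := LinearMap.mulLeft k a ∘ₗ prodAll k A n
  refine LinearMap.congr_fun (f := f) (g := g) (tprod_induction fun u => ?_) x
  simp [f, g, cons_tprod, prodAll]

end Algebra

/-! ### Iterated comultiplication and letterwise splitting -/

section Coalgebra

variable {k : Type*} [Field k] {C : Type*} [AddCommGroup C] [Module k C] [Coalgebra k C]

theorem comulAt_zero_repr (n : ℕ) (c : C) (x : ⨂[k]^n C) {ι : Type*} (r : Coalgebra.Repr k c ι) :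
    comulAt k C (n + 1) 0 (cons k C n (c ⊗ₜ x)) =
      ∑ i ∈ r.index, cons k C (n + 1) (r.left i ⊗ₜ cons k C n (r.right i ⊗ₜ x)) := by
  simp [comulAt, ← r.eq, TensorProduct.sum_tmul]

theorem comulAt_succ (n : ℕ) (i : Fin n) (c : C) (x : ⨂[k]^n C) :
    comulAt k C (n + 1) i.succ (cons k C n (c ⊗ₜ x)) =
      cons k C (n + 1) (c ⊗ₜ comulAt k C n i x) := by
  simp [comulAt]

theorem comulAt_castSucc (n : ℕ) (i : Fin n) (x : ⨂[k]^n C) (c : C) :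
    comulAt k C (n + 1) i.castSucc (snoc k C n (x ⊗ₜ c)) =
      snoc k C (n + 1) (comulAt k C n i x ⊗ₜ c) := by
  induction n with
  | zero => exact i.elim0
  | succ n ih =>
    induction x using cons_induction with
    | hadd x y hx hy => simp only [TensorProduct.add_tmul, map_add, hx, hy]
    | h b x =>
      rw [← cons_snoc]
      refine Fin.cases ?_ (fun j => ?_) i
      · have r := Coalgebra.Repr.arbitrary k b
        rw [Fin.castSucc_zero, comulAt_zero_repr _ _ _ r, comulAt_zero_repr _ _ _ r]
        simp only [TensorProduct.sum_tmul, map_sum, cons_snoc]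
      · rw [← Fin.succ_castSucc, comulAt_succ, ih, comulAt_succ, cons_snoc]

theorem comulAt_last_repr (n : ℕ) (x : ⨂[k]^n C) (c : C) {ι : Type*} (r : Coalgebra.Repr k c ι) :
    comulAt k C (n + 1) (Fin.last n) (snoc k C n (x ⊗ₜ c)) =
      ∑ i ∈ r.index, snoc k C (n + 1) (snoc k C n (x ⊗ₜ r.left i) ⊗ₜ r.right i) := by
  induction n with
  | zero =>
    obtain ⟨c, rfl⟩ := exists_smul_emptyTensor x
    simp only [← TensorProduct.smul_tmul', map_smul, ← cons_zero, ← cons_snoc, ← Finset.smul_sum]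
    rw [Fin.last_zero, comulAt_zero_repr _ _ _ r]
  | succ n ih =>
    induction x using cons_induction with
    | hadd x y hx hy => simp only [TensorProduct.add_tmul, map_add, hx, hy, Finset.sum_add_distrib]
    | h b x =>
      rw [← cons_snoc, ← Fin.succ_last, comulAt_succ, ih]
      simp only [TensorProduct.tmul_sum, map_sum, cons_snoc]

theorem iterComul_zero (c : C) :
    iterComul k C 0 c = Coalgebra.counit (R := k) c • emptyTensor k C := by
  simp [iterComul, algebraMap₀_eq]

theorem iterComul_succ (n : ℕ) (c : C) :
    iterComul k C (n + 1) c =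
      cons k C n ((iterComul k C n).lTensor C (Coalgebra.comul (R := k) c)) := rfl

theorem iterComul_succ_repr (n : ℕ) (c : C) {ι : Type*} (r : Coalgebra.Repr k c ι) :
    iterComul k C (n + 1) c =
      ∑ i ∈ r.index, cons k C n (r.left i ⊗ₜ iterComul k C n (r.right i)) := by
  simp [iterComul_succ, ← r.eq]

/-- Coassociativity: the iterated comultiplication, defined by splitting off the first factor, may
as well be built by splitting off the last. -/
theorem iterComul_succ' (n : ℕ) (c : C) :
    iterComul k C (n + 1) c =
      snoc k C n ((iterComul k C n).rTensor C (Coalgebra.comul (R := k) c)) := by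
  induction n generalizing c with
  | zero =>
    -- The counit axiom, pushed forward along the map sending a scalar to that multiple of the empty
    -- tensor.
    have h : (iterComul k C 0).lTensor C (Coalgebra.comul (R := k) c) =
        c ⊗ₜ emptyTensor k C := by
      have := congrArg ((LinearMap.toSpanSingleton k _ (emptyTensor k C)).lTensor C)
        (Coalgebra.lTensor_counit_comul (R := k) c)
      rw [← LinearMap.comp_apply, ← LinearMap.lTensor_comp] at this
      convert this using 1
      · congr 2
      · simp
    have h' : (iterComul k C 0).rTensor C (Coalgebra.comul (R := k) c) =
        emptyTensor k C ⊗ₜ c := by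
      have := congrArg ((LinearMap.toSpanSingleton k _ (emptyTensor k C)).rTensor C)
        (Coalgebra.rTensor_counit_comul (R := k) c)
      rw [← LinearMap.comp_apply, ← LinearMap.rTensor_comp] at this
      convert this using 1
      · congr 2
      · simp
    rw [iterComul_succ, h, h', cons_zero]
  | succ n ih =>
    have h1 : iterComul k C (n + 1) = ((snoc k C n).toLinearMap ∘ₗ
        (iterComul k C n).rTensor C) ∘ₗ Coalgebra.comul (R := k) := LinearMap.ext ih
    have h2 : iterComul k C (n + 1) = ((cons k C n).toLinearMap ∘ₗ
        (iterComul k C n).lTensor C) ∘ₗ Coalgebra.comul (R := k) := rfl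
    rw [iterComul_succ]
    -- On the left the inner iterated comultiplication loses its last factor, on the right its
    -- first; both sides become functions of the threefold comultiplication and agree by
    -- `cons_snoc`.
    nth_rw 1 [h1]
    rw [h2, LinearMap.lTensor_comp, LinearMap.rTensor_comp, LinearMap.comp_apply,
      LinearMap.comp_apply, ← Coalgebra.coassoc_apply]
    generalize (Coalgebra.comul (R := k) (A := C)).rTensor C (Coalgebra.comul (R := k) c) = t
    induction t with
    | zero => simp
    | add x y hx hy => simp only [map_add, hx, hy]
    | tmul u c =>
      induction u with
      | zero => simp
      | add x y hx hy => simp only [TensorProduct.add_tmul, map_add, hx, hy]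
      | tmul a b => simp [cons_snoc]

theorem iterComul_succ_repr' (n : ℕ) (c : C) {ι : Type*} (r : Coalgebra.Repr k c ι) :
    iterComul k C (n + 1) c =
      ∑ i ∈ r.index, snoc k C n (iterComul k C n (r.left i) ⊗ₜ r.right i) := by
  simp [iterComul_succ', ← r.eq]

/-- Coassociativity again: it does not matter which factor is split further. -/
theorem comulAt_iterComul (n : ℕ) (i : Fin n) (c : C) :
    comulAt k C n i (iterComul k C n c) = iterComul k C (n + 1) c := by
  induction n generalizing c with
  | zero => exact i.elim0
  | succ n ih =>
    refine Fin.cases ?_ (fun j => ?_) i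
    · rw [iterComul_succ, iterComul_succ]
      have h2 : iterComul k C (n + 1) = ((cons k C n).toLinearMap ∘ₗ
        (iterComul k C n).lTensor C) ∘ₗ Coalgebra.comul (R := k) := rfl
      rw [h2, LinearMap.lTensor_comp, LinearMap.comp_apply, ← Coalgebra.coassoc_apply]
      generalize Coalgebra.comul (R := k) c = t
      induction t with
      | zero => simp
      | add x y hx hy => simp only [map_add, hx, hy]
      | tmul a b =>
        rw [LinearMap.lTensor_tmul, LinearMap.rTensor_tmul]
        have r := Coalgebra.Repr.arbitrary k a
        rw [comulAt_zero_repr _ _ _ r, ← r.eq]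
        simp [TensorProduct.sum_tmul]
    · have r := Coalgebra.Repr.arbitrary k c
      simp only [iterComul_succ_repr _ _ r, map_sum, comulAt_succ, ih]

theorem split_zero : split k C 0 (emptyTensor k C) = emptyTensor k C ⊗ₜ emptyTensor k C := rfl

theorem split_cons (n : ℕ) (c : C) (x : ⨂[k]^n C) :
    split k C (n + 1) (cons k C n (c ⊗ₜ x)) =
      TensorProduct.map (cons k C n).toLinearMap (cons k C n).toLinearMap
        (TensorProduct.tensorTensorTensorComm k C C (⨂[k]^n C) (⨂[k]^n C)
          (Coalgebra.comul (R := k) c ⊗ₜ split k C n x)) := by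
  simp [split]

/-- `split` acts letter by letter, so its recursion from the left can also be read from the right.
-/
theorem split_snoc (n : ℕ) (x : ⨂[k]^n C) (c : C) :
    split k C (n + 1) (snoc k C n (x ⊗ₜ c)) =
      TensorProduct.map (snoc k C n).toLinearMap (snoc k C n).toLinearMap
        (TensorProduct.tensorTensorTensorComm k (⨂[k]^n C) (⨂[k]^n C) C C
          (split k C n x ⊗ₜ Coalgebra.comul (R := k) c)) := by
  induction n with
  | zero =>
    obtain ⟨s, rfl⟩ := exists_smul_emptyTensor x
    simp only [← TensorProduct.smul_tmul', map_smul, ← cons_zero, split_cons, split_zero]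
    congr 1
    generalize Coalgebra.comul (R := k) c = t
    induction t with
    | zero => simp
    | add x y hx hy => simp only [TensorProduct.add_tmul, TensorProduct.tmul_add, map_add, hx, hy]
    | tmul a b => simp [cons_zero]
  | succ n ih =>
    induction x using cons_induction with
    | hadd x y hx hy => simp only [TensorProduct.add_tmul, map_add, hx, hy]
    | h b x =>
      rw [← cons_snoc, split_cons, ih, split_cons]
      generalize Coalgebra.comul (R := k) c = t
      generalize Coalgebra.comul (R := k) b = s
      generalize split k C n x = u
      induction t with
      | zero => simp
      | add x y hx hy => simp only [TensorProduct.tmul_add, map_add, hx, hy]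
      | tmul c1 c2 =>
        induction s with
        | zero => simp
        | add x y hx hy => simp only [TensorProduct.add_tmul, map_add, hx, hy]
        | tmul b1 b2 =>
          induction u with
          | zero => simp
          | add x y hx hy =>
            simp only [TensorProduct.add_tmul, TensorProduct.tmul_add, map_add, hx, hy]
          | tmul x1 x2 => simp [cons_snoc]

theorem split_cons_repr (n : ℕ) {c : C} (x : ⨂[k]^n C) {ι : Type*} (r : Coalgebra.Repr k c ι) :
    split k C (n + 1) (cons k C n (c ⊗ₜ x)) = ∑ i ∈ r.index,
      TensorProduct.map ((cons k C n).toLinearMap ∘ₗ TensorProduct.mk k _ _ (r.left i))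
        ((cons k C n).toLinearMap ∘ₗ TensorProduct.mk k _ _ (r.right i)) (split k C n x) := by
  rw [split_cons, ← r.eq]
  generalize split k C n x = u
  induction u with
  | zero => simp
  | add x y hx hy => simp only [TensorProduct.tmul_add, map_add, hx, hy, Finset.sum_add_distrib]
  | tmul x₁ x₂ => simp [TensorProduct.sum_tmul]

theorem split_snoc_repr (n : ℕ) (x : ⨂[k]^n C) {c : C} {ι : Type*} (r : Coalgebra.Repr k c ι) :
    split k C (n + 1) (snoc k C n (x ⊗ₜ c)) = ∑ i ∈ r.index,
      TensorProduct.map ((snoc k C n).toLinearMap ∘ₗ (TensorProduct.mk k _ _).flip (r.left i))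
        ((snoc k C n).toLinearMap ∘ₗ (TensorProduct.mk k _ _).flip (r.right i))
          (split k C n x) := by
  rw [split_snoc, ← r.eq]
  generalize split k C n x = u
  induction u with
  | zero => simp
  | add x y hx hy => simp only [TensorProduct.add_tmul, map_add, hx, hy, Finset.sum_add_distrib]
  | tmul x₁ x₂ => simp [TensorProduct.tmul_sum]

end Coalgebra

/-! ### Compatibility of comultiplication with products of words -/

section Bialgebra

variable {k : Type*} [Field k] {A : Type*} [Ring A] [Bialgebra k A]

theorem iterComul_mul (n : ℕ) (a b : A) :
    iterComul k A n (a * b) = iterComul k A n a * iterComul k A n b := by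
  induction n generalizing a b with
  | zero =>
    simp only [iterComul_zero, emptyTensor_eq_one, Bialgebra.counit_mul, smul_mul_smul_comm,
      one_mul]
  | succ n ih =>
    simp only [iterComul_succ, Bialgebra.comul_mul]
    generalize Coalgebra.comul (R := k) a = s
    generalize Coalgebra.comul (R := k) b = t
    induction s with
    | zero => simp
    | add x y hx hy => simp only [add_mul, map_add, hx, hy]
    | tmul a1 a2 =>
      induction t with
      | zero => simp
      | add x y hx hy => simp only [mul_add, map_add, hx, hy]
      | tmul b1 b2 => simp [ih, cons_mul_cons]

theorem comulAt_mul (n : ℕ) (i : Fin n) (x y : ⨂[k]^n A) :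
    comulAt k A n i (x * y) = comulAt k A n i x * comulAt k A n i y := by
  induction n with
  | zero => exact i.elim0
  | succ n ih =>
    induction x using cons_induction with
    | hadd x y hx hy => simp only [add_mul, map_add, hx, hy]
    | h a x =>
      induction y using cons_induction with
      | hadd x y hx hy => simp only [mul_add, map_add, hx, hy]
      | h b y =>
        rw [cons_mul_cons]
        refine Fin.cases ?_ (fun j => ?_) i
        · have r := Coalgebra.Repr.arbitrary k a
          have s := Coalgebra.Repr.arbitrary k b
          rw [comulAt_zero_repr _ _ _ (r.mul s), comulAt_zero_repr _ _ _ r,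
            comulAt_zero_repr _ _ _ s, Finset.sum_mul_sum]
          simp only [cons_mul_cons]
          exact Finset.sum_product _ _ _
        · simp only [comulAt_succ, ih, cons_mul_cons]

end Bialgebra

/-! ### The rainbow pairing of tensor powers -/

section Pairings

variable {k : Type*} [Field k] {A B : Type*} [AddCommGroup A] [Module k A]
  [AddCommGroup B] [Module k B]

theorem rainbow_tprod (p : A →ₗ[k] B →ₗ[k] k) (n : ℕ) (x : Fin n → A) (y : Fin n → B) :
    rainbow p n (PiTensorProduct.tprod k x) (PiTensorProduct.tprod k y) =
      ∏ i, p (x i.rev) (y i) := by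
  simp [rainbow, TensorPower.pairingDual_tprod_tprod]

theorem rainbow_zero (p : A →ₗ[k] B →ₗ[k] k) :
    rainbow p 0 (emptyTensor k A) (emptyTensor k B) = 1 := by
  simp [emptyTensor, rainbow_tprod]

theorem rainbow_flip (p : A →ₗ[k] B →ₗ[k] k) (n : ℕ) (x : ⨂[k]^n A) (y : ⨂[k]^n B) :
    rainbow p.flip n y x = rainbow p n x y := by
  refine LinearMap.congr_fun₂ (f := (rainbow p.flip n).flip) (g := rainbow p n)
    (tprod_induction fun u => tprod_induction fun v => ?_) x y
  rw [LinearMap.flip_apply, rainbow_tprod, rainbow_tprod]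
  exact Fintype.prod_equiv Fin.revPerm _ _ fun i => by simp

/-- The arcs of the rainbow are nested; the outermost one joins the first letter of one word to the
last letter of the other. -/
theorem rainbow_cons_snoc (p : A →ₗ[k] B →ₗ[k] k) (n : ℕ) (a : A) (x : ⨂[k]^n A)
    (y : ⨂[k]^n B) (b : B) :
    rainbow p (n + 1) (cons k A n (a ⊗ₜ x)) (snoc k B n (y ⊗ₜ b)) = p a b * rainbow p n x y := by
  let f : (⨂[k]^n A) →ₗ[k] (⨂[k]^n B) →ₗ[k] k := (rainbow p (n + 1)).compl₁₂
    ((cons k A n).toLinearMap ∘ₗ TensorProduct.mk k _ _ a)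
    ((snoc k B n).toLinearMap ∘ₗ (TensorProduct.mk k _ _).flip b)
  refine LinearMap.congr_fun₂ (f := f) (g := p a b • rainbow p n)
    (tprod_induction fun u => tprod_induction fun v => ?_) x y
  simp only [f, LinearMap.compl₁₂_apply, LinearMap.comp_apply, LinearEquiv.coe_coe,
    LinearMap.flip_apply, TensorProduct.mk_apply, cons_tprod, snoc_tprod, rainbow_tprod,
    LinearMap.smul_apply, smul_eq_mul]
  rw [Fin.prod_univ_castSucc, mul_comm]
  simp [Fin.rev_castSucc]

theorem rainbow_snoc_cons (p : A →ₗ[k] B →ₗ[k] k) (n : ℕ) (x : ⨂[k]^n A) (a : A)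
    (b : B) (y : ⨂[k]^n B) :
    rainbow p (n + 1) (snoc k A n (x ⊗ₜ a)) (cons k B n (b ⊗ₜ y)) = p a b * rainbow p n x y := by
  rw [← rainbow_flip, rainbow_cons_snoc, rainbow_flip, LinearMap.flip_apply]

@[simp]
theorem contractLeft_tmul (p : A →ₗ[k] B →ₗ[k] k) (X : Type*) [AddCommGroup X] [Module k X]
    (a : A) (b : B) (x : X) : contractLeft p X (a ⊗ₜ (b ⊗ₜ x)) = p a b • x := by
  simp [contractLeft]

end Pairings

/-! ### Recursions for the adjoint actions -/

section Adjoint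

variable {k : Type*} [Field k] {A B : Type*} [AddCommGroup A] [Module k A] [Coalgebra k A]
  [AddCommGroup B] [Module k B] [Coalgebra k B]

/-- Functionals that factor over the first letter have a convolution that factors as well. This is
the induction step of `IsBialgebraPairing.rainbow_mul`. -/
theorem pairing_split_cons (n : ℕ) (b : B) (y : ⨂[k]^n B) (f g : (⨂[k]^(n + 1) B) →ₗ[k] k)
    (f₁ g₁ : B →ₗ[k] k) (f₂ g₂ : (⨂[k]^n B) →ₗ[k] k)
    (hf : ∀ b y, f (cons k B n (b ⊗ₜ y)) = f₁ b * f₂ y)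
    (hg : ∀ b y, g (cons k B n (b ⊗ₜ y)) = g₁ b * g₂ y) :
    LinearMap.mul' k k (TensorProduct.map f g (split k B (n + 1) (cons k B n (b ⊗ₜ y)))) =
      LinearMap.mul' k k (TensorProduct.map f₁ g₁ (Coalgebra.comul (R := k) b)) *
        LinearMap.mul' k k (TensorProduct.map f₂ g₂ (split k B n y)) := by
  rw [split_cons]
  generalize Coalgebra.comul (R := k) b = t
  generalize split k B n y = u
  induction t with
  | zero => simp
  | add x y hx hy => simp only [TensorProduct.add_tmul, map_add, add_mul, hx, hy]
  | tmul b1 b2 =>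
    induction u with
    | zero => simp
    | add x y hx hy => simp only [TensorProduct.tmul_add, map_add, mul_add, hx, hy]
    | tmul y1 y2 =>
      simp [hf, hg]
      ring

theorem leftAdj_apply (p : A →ₗ[k] B →ₗ[k] k) (n : ℕ) (a : A) (y : ⨂[k]^n B) :
    leftAdj p n (a ⊗ₜ y) =
      contractLeft (rainbow p n) (⨂[k]^n B) (iterComul k A n a ⊗ₜ split k B n y) := rfl

theorem rightAdj_apply (p : A →ₗ[k] B →ₗ[k] k) (n : ℕ) (a : A) (y : ⨂[k]^n B) :
    rightAdj p n (y ⊗ₜ a) =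
      contractLeft (rainbow p n) (⨂[k]^n B)
        (iterComul k A n a ⊗ₜ TensorProduct.comm k _ _ (split k B n y)) := rfl

/-- The outermost arc pairs a₍₁₎ with b₍₁₎, and a₍₂₎ acts on the rest of the word. This recursion
and its three companions, for the other end and the other action, isolate the one scalar that
appears when two faces are composed. -/
theorem leftAdj_snoc (p : A →ₗ[k] B →ₗ[k] k) (n : ℕ) {a : A} (y : ⨂[k]^n B) {b : B}
    {ι κ : Type*} (r : Coalgebra.Repr k a ι) (s : Coalgebra.Repr k b κ) :
    leftAdj p (n + 1) (a ⊗ₜ snoc k B n (y ⊗ₜ b)) = ∑ i ∈ r.index, ∑ j ∈ s.index,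
      p (r.left i) (s.left j) • snoc k B n (leftAdj p n (r.right i ⊗ₜ y) ⊗ₜ s.right j) := by
  simp only [leftAdj_apply, split_snoc, iterComul_succ_repr _ _ r, ← s.eq]
  generalize split k B n y = u
  induction u with
  | zero => simp
  | add x y hx hy =>
    simp only [TensorProduct.tmul_add, TensorProduct.add_tmul, map_add, hx, hy, smul_add,
      Finset.sum_add_distrib]
  | tmul y1 y2 =>
    simp [TensorProduct.tmul_sum, TensorProduct.sum_tmul, rainbow_cons_snoc, mul_smul,
      ← TensorProduct.smul_tmul']
    exact Finset.sum_comm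

theorem leftAdj_cons (p : A →ₗ[k] B →ₗ[k] k) (n : ℕ) {a : A} (y : ⨂[k]^n B) {b : B}
    {ι κ : Type*} (r : Coalgebra.Repr k a ι) (s : Coalgebra.Repr k b κ) :
    leftAdj p (n + 1) (a ⊗ₜ cons k B n (b ⊗ₜ y)) = ∑ i ∈ r.index, ∑ j ∈ s.index,
      p (r.right i) (s.left j) • cons k B n (s.right j ⊗ₜ leftAdj p n (r.left i ⊗ₜ y)) := by
  simp only [leftAdj_apply, split_cons, iterComul_succ_repr' _ _ r, ← s.eq]
  generalize split k B n y = u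
  induction u with
  | zero => simp
  | add x y hx hy =>
    simp only [TensorProduct.tmul_add, map_add, hx, hy, smul_add,
      Finset.sum_add_distrib]
  | tmul y1 y2 =>
    simp [TensorProduct.tmul_sum, TensorProduct.sum_tmul, rainbow_snoc_cons, mul_smul]
    exact Finset.sum_comm

theorem rightAdj_snoc (p : A →ₗ[k] B →ₗ[k] k) (n : ℕ) {a : A} (y : ⨂[k]^n B) {b : B}
    {ι κ : Type*} (r : Coalgebra.Repr k a ι) (s : Coalgebra.Repr k b κ) :
    rightAdj p (n + 1) (snoc k B n (y ⊗ₜ b) ⊗ₜ a) = ∑ i ∈ r.index, ∑ j ∈ s.index,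
      p (r.left i) (s.right j) • snoc k B n (rightAdj p n (y ⊗ₜ r.right i) ⊗ₜ s.left j) := by
  simp only [rightAdj_apply, split_snoc, iterComul_succ_repr _ _ r, ← s.eq]
  generalize split k B n y = u
  induction u with
  | zero => simp
  | add x y hx hy =>
    simp only [TensorProduct.tmul_add, TensorProduct.add_tmul, map_add, hx, hy, smul_add,
      Finset.sum_add_distrib]
  | tmul y1 y2 =>
    simp [TensorProduct.tmul_sum, TensorProduct.sum_tmul, rainbow_cons_snoc, mul_smul,
      ← TensorProduct.smul_tmul']
    exact Finset.sum_comm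

theorem rightAdj_cons (p : A →ₗ[k] B →ₗ[k] k) (n : ℕ) {a : A} (y : ⨂[k]^n B) {b : B}
    {ι κ : Type*} (r : Coalgebra.Repr k a ι) (s : Coalgebra.Repr k b κ) :
    rightAdj p (n + 1) (cons k B n (b ⊗ₜ y) ⊗ₜ a) = ∑ i ∈ r.index, ∑ j ∈ s.index,
      p (r.right i) (s.right j) • cons k B n (s.left j ⊗ₜ rightAdj p n (y ⊗ₜ r.left i)) := by
  simp only [rightAdj_apply, split_cons, iterComul_succ_repr' _ _ r, ← s.eq]
  generalize split k B n y = u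
  induction u with
  | zero => simp
  | add x y hx hy =>
    simp only [TensorProduct.tmul_add, map_add, hx, hy, smul_add,
      Finset.sum_add_distrib]
  | tmul y1 y2 =>
    simp [TensorProduct.tmul_sum, TensorProduct.sum_tmul, rainbow_snoc_cons, mul_smul]
    exact Finset.sum_comm

end Adjoint

/-! ### Pairings of bialgebras and transposes of the structure maps -/

section BialgebraPairing

variable {k : Type*} [Field k] {A B : Type*} [Ring A] [Bialgebra k A] [Ring B] [Bialgebra k B]

/-- A pairing of bialgebras for the rainbow conventions:
`⟨a a', b⟩ = ⟨a, b₍₂₎⟩ ⟨a', b₍₁₎⟩`, `⟨a, b b'⟩ = ⟨a₍₁₎, b'⟩ ⟨a₍₂₎, b⟩`. -/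
structure IsBialgebraPairing (p : A →ₗ[k] B →ₗ[k] k) : Prop where
  one_left : ∀ b, p 1 b = Coalgebra.counit (R := k) b
  one_right : ∀ a, p a 1 = Coalgebra.counit (R := k) a
  mul_left : ∀ a a' b, p (a * a') b =
    LinearMap.mul' k k (TensorProduct.map (p a') (p a) (Coalgebra.comul (R := k) b))
  mul_right : ∀ a b b', p a (b * b') =
    LinearMap.mul' k k (TensorProduct.map (p.flip b') (p.flip b) (Coalgebra.comul (R := k) a))

/-- The axioms exchange their roles under the flip; this symmetry lets each statement about d serve
for d'. -/
theorem IsBialgebraPairing.flip {p : A →ₗ[k] B →ₗ[k] k} (hp : IsBialgebraPairing p) :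
    IsBialgebraPairing p.flip where
  one_left := hp.one_right
  one_right := hp.one_left
  mul_left a a' b := hp.mul_right b a a'
  mul_right a b b' := hp.mul_left b b' a

variable {p : A →ₗ[k] B →ₗ[k] k}

theorem IsBialgebraPairing.mul_left_repr (hp : IsBialgebraPairing p) (a a' : A) {b : B} {ι : Type*}
    (r : Coalgebra.Repr k b ι) :
    p (a * a') b = ∑ i ∈ r.index, p a (r.right i) * p a' (r.left i) := by
  rw [hp.mul_left, ← r.eq]
  simp [mul_comm]

theorem IsBialgebraPairing.mul_right_repr (hp : IsBialgebraPairing p) {a : A} (b b' : B)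
    {ι : Type*} (r : Coalgebra.Repr k a ι) :
    p a (b * b') = ∑ i ∈ r.index, p (r.right i) b * p (r.left i) b' :=
  hp.flip.mul_left_repr b b' r

/-- The structure of `HDual` was defined by these very formulas; only the comultiplication, given
through `HDual.rainbowTwo`, has to be unfolded. -/
theorem ev_isBialgebraPairing [Module.Finite k A] : IsBialgebraPairing (HDual.ev k A) where
  one_left b := HDual.ev_one b
  one_right a := rfl
  mul_left a a' b := rfl
  mul_right a b b' := by
    rw [← HDual.rainbowTwo_comul]
    generalize Coalgebra.comul (R := k) a = t
    induction t with
    | zero => simp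
    | add x y hx hy => simp only [map_add, LinearMap.add_apply, hx, hy]
    | tmul l l' => simp [HDual.rainbowTwo_tmul]

/-- `⟨z z', y⟩ = ⟨z', y₍₁₎⟩ ⟨z, y₍₂₎⟩`. -/
theorem IsBialgebraPairing.rainbow_mul (hp : IsBialgebraPairing p) (n : ℕ) (z z' : ⨂[k]^n A)
    (y : ⨂[k]^n B) :
    rainbow p n (z * z') y =
      LinearMap.mul' k k (TensorProduct.map (rainbow p n z') (rainbow p n z) (split k B n y)) := by
  induction n with
  | zero =>
    obtain ⟨c, rfl⟩ := exists_smul_emptyTensor z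
    obtain ⟨c', rfl⟩ := exists_smul_emptyTensor z'
    obtain ⟨d, rfl⟩ := exists_smul_emptyTensor y
    have h : emptyTensor k A * emptyTensor k A = emptyTensor k A := by
      rw [emptyTensor_eq_one, one_mul]
    simp [h, split_zero, rainbow_zero]
  | succ n ih =>
    induction y using cons_induction with
    | hadd x y hx hy => simp only [map_add, hx, hy]
    | h b y =>
      induction z using snoc_induction with
      | hadd x y hx hy => simp only [add_mul, map_add, LinearMap.add_apply, hx, hy,
          TensorProduct.map_add_right]
      | h z a =>
        induction z' using snoc_induction with
        | hadd x y hx hy => simp only [mul_add, map_add, LinearMap.add_apply, hx, hy,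
            TensorProduct.map_add_left]
        | h z' a' =>
          rw [snoc_mul_snoc, rainbow_snoc_cons, hp.mul_left, ih]
          exact (pairing_split_cons n b y _ _ _ _ _ _ (rainbow_snoc_cons p n z' a')
            (rainbow_snoc_cons p n z a)).symm

/-- By `rainbow_mul` the right-hand factor Δⁿ(a) is paired with y₍₁₎ and z with y₍₂₎, which is the
definition of the left action. Thus the left action is the transpose of right multiplication by
Δⁿ(a). -/
theorem IsBialgebraPairing.rainbow_leftAdj (hp : IsBialgebraPairing p) (n : ℕ) (z : ⨂[k]^n A)
    (a : A) (y : ⨂[k]^n B) :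
    rainbow p n z (leftAdj p n (a ⊗ₜ y)) = rainbow p n (z * iterComul k A n a) y := by
  rw [hp.rainbow_mul, leftAdj_apply]
  generalize split k B n y = u
  induction u with
  | zero => simp
  | add x y hx hy => simp only [TensorProduct.tmul_add, map_add, hx, hy]
  | tmul y1 y2 => simp

theorem IsBialgebraPairing.rainbow_rightAdj (hp : IsBialgebraPairing p) (n : ℕ) (z : ⨂[k]^n A)
    (a : A) (y : ⨂[k]^n B) :
    rainbow p n z (rightAdj p n (y ⊗ₜ a)) = rainbow p n (iterComul k A n a * z) y := by
  rw [hp.rainbow_mul, rightAdj_apply]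
  generalize split k B n y = u
  induction u with
  | zero => simp
  | add x y hx hy => simp only [TensorProduct.tmul_add, map_add, hx, hy]
  | tmul y1 y2 => simp [mul_comm]

/-- The rainbow reverses the order of the letters, so multiplication at place i is transposed to
comultiplication at the mirrored place `i.rev`. -/
theorem IsBialgebraPairing.rainbow_mulAt (hp : IsBialgebraPairing p) (n : ℕ) (i : Fin n)
    (z : ⨂[k]^n A) (y : ⨂[k]^(n + 1) B) :
    rainbow p n z (mulAt k B n i y) = rainbow p (n + 1) (comulAt k A n i.rev z) y := by
  induction n with
  | zero => exact i.elim0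
  | succ n ih =>
    induction z using snoc_induction with
    | hadd x y hx hy => simp only [map_add, LinearMap.add_apply, hx, hy]
    | h z a =>
      induction y using cons_induction with
      | hadd x y hx hy => simp only [map_add, hx, hy]
      | h b y =>
        refine Fin.cases ?_ (fun j => ?_) i
        · induction y using cons_induction with
          | hadd x y hx hy => simp only [TensorProduct.tmul_add, map_add, hx, hy]
          | h b' y =>
            have r := Coalgebra.Repr.arbitrary k a
            rw [Fin.rev_zero, comulAt_last_repr _ _ _ r, mulAt_zero, rainbow_snoc_cons,
              hp.mul_right_repr _ _ r]
            simp only [map_sum, LinearMap.sum_apply, rainbow_snoc_cons, Finset.sum_mul, mul_assoc]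
        · rw [mulAt_succ, Fin.rev_succ, comulAt_castSucc, rainbow_snoc_cons, rainbow_snoc_cons, ih]

/-- The n-letter version of ⟨a, b b'⟩ = ⟨a₍₁₎, b'⟩ ⟨a₍₂₎, b⟩. It converts the products in the
Cartier differentials into the pairings that define the faces of d'. -/
theorem IsBialgebraPairing.rainbow_iterComul (hp : IsBialgebraPairing p) (n : ℕ) (a : A)
    (y : ⨂[k]^n B) : rainbow p n (iterComul k A n a) y = p a (prodAll k B n y) := by
  induction n generalizing a with
  | zero =>
    obtain ⟨c, rfl⟩ := exists_smul_emptyTensor y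
    simp [iterComul_zero, rainbow_zero, prodAll_zero, hp.one_right]
  | succ n ih =>
    induction y using cons_induction with
    | hadd x y hx hy => simp only [map_add, hx, hy]
    | h b y =>
      have r := Coalgebra.Repr.arbitrary k a
      rw [iterComul_succ_repr' _ _ r, prodAll_cons, hp.mul_right_repr _ _ r]
      simp only [map_sum, LinearMap.sum_apply, rainbow_snoc_cons, ih]

end BialgebraPairing

/-! ### Perfectness of the rainbow pairing -/

section Perfect

variable {k : Type*} [Field k] {A B : Type*} [AddCommGroup A] [Module k A]
  [AddCommGroup B] [Module k B] [Module.Finite k B]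

/-- The pairing of degree n+1 is the tensor product of the outermost arc with the pairing of degree
n, and for finite-dimensional spaces the dual of a tensor product is the tensor product of the
duals. -/
theorem rainbow_bijective {p : A →ₗ[k] B →ₗ[k] k} (hp : Function.Bijective p) (n : ℕ) :
    Function.Bijective (rainbow p n) := by
  induction n with
  | zero =>
    -- In degree zero, pairing with the empty tensor reads off the scalar.
    have h : ∀ x : ⨂[k]^0 A, x = rainbow p 0 x (emptyTensor k B) • emptyTensor k A := fun x => by
      obtain ⟨c, rfl⟩ := exists_smul_emptyTensor x
      simp [rainbow_zero]
    refine ⟨fun x y hxy => by rw [h x, h y, hxy], fun f =>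
      ⟨f (emptyTensor k B) • emptyTensor k A, zero_ext ?_⟩⟩
    simp [rainbow_zero]
  | succ n ih =>
    let e := (snoc k A n).symm ≪≫ₗ TensorProduct.congr (LinearEquiv.ofBijective _ ih)
      (LinearEquiv.ofBijective p hp) ≪≫ₗ TensorProduct.comm k _ _ ≪≫ₗ
      TensorProduct.dualDistribEquiv k B (⨂[k]^n B) ≪≫ₗ (cons k B n).symm.dualMap
    have he : rainbow p (n + 1) = e.toLinearMap := by
      refine snoc_ext fun x a => cons_ext fun b y => ?_
      rw [rainbow_snoc_cons]
      simp [e, LinearEquiv.dualMap_apply]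
    rw [he]
    exact e.bijective

instance rainbow_isPerfPair (p : A →ₗ[k] B →ₗ[k] k) [p.IsPerfPair] (n : ℕ) :
    (rainbow p n).IsPerfPair :=
  .of_bijective _ (rainbow_bijective (LinearMap.IsPerfPair.bijective_left p) n)

/-- The tool for proving identities in tensor powers by checking their transposes. -/
theorem rainbow_right_ext (p : A →ₗ[k] B →ₗ[k] k) [p.IsPerfPair] {n : ℕ} {y y' : ⨂[k]^n B}
    (h : ∀ z, rainbow p n z y = rainbow p n z y') : y = y' :=
  (LinearMap.IsPerfPair.bijective_right (rainbow p n)).injective (LinearMap.ext h)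

end Perfect

/-! ### The adjoint bimodule and equivariance of the bar differential -/

section Bimodule

variable {k : Type*} [Field k] {A B : Type*} [Ring A] [Bialgebra k A] [Ring B] [Bialgebra k B]
  [Module.Finite k B] {p : A →ₗ[k] B →ₗ[k] k} [p.IsPerfPair]

namespace IsBialgebraPairing

/-- Transposed, this is associativity of multiplication by Δⁿ(a) and Δⁿ(a'), whose product is
Δⁿ(aa'). The next two lemmas transpose to associativity in the same way. -/
theorem leftAdj_leftAdj (hp : IsBialgebraPairing p) (n : ℕ) (a a' : A) (y : ⨂[k]^n B) :
    leftAdj p n (a ⊗ₜ leftAdj p n (a' ⊗ₜ y)) = leftAdj p n ((a * a') ⊗ₜ y) :=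
  rainbow_right_ext p fun z => by
    simp only [hp.rainbow_leftAdj, iterComul_mul, mul_assoc]

theorem rightAdj_rightAdj (hp : IsBialgebraPairing p) (n : ℕ) (a a' : A) (y : ⨂[k]^n B) :
    rightAdj p n (rightAdj p n (y ⊗ₜ a) ⊗ₜ a') = rightAdj p n (y ⊗ₜ (a * a')) :=
  rainbow_right_ext p fun z => by
    simp only [hp.rainbow_rightAdj, iterComul_mul, mul_assoc]

theorem leftAdj_rightAdj (hp : IsBialgebraPairing p) (n : ℕ) (a a' : A) (y : ⨂[k]^n B) :
    leftAdj p n (a ⊗ₜ rightAdj p n (y ⊗ₜ a')) = rightAdj p n (leftAdj p n (a ⊗ₜ y) ⊗ₜ a') :=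
  rainbow_right_ext p fun z => by
    simp only [hp.rainbow_rightAdj, hp.rainbow_leftAdj, mul_assoc]

/-- Each summand is equivariant by itself: its transpose Δ_j is multiplicative and sends Δⁿ(a) to
Δⁿ⁺¹(a). -/
theorem bar_leftAdj (hp : IsBialgebraPairing p) (n : ℕ) (a : A) (y : ⨂[k]^(n + 1) B) :
    bar k B n (leftAdj p (n + 1) (a ⊗ₜ y)) = leftAdj p n (a ⊗ₜ bar k B n y) := by
  simp only [bar, LinearMap.sum_apply, LinearMap.smul_apply, TensorProduct.tmul_sum, map_sum,
    TensorProduct.tmul_smul, map_smul]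
  refine Finset.sum_congr rfl fun i _ => congrArg _ (rainbow_right_ext p fun z => ?_)
  simp only [hp.rainbow_mulAt, hp.rainbow_leftAdj, comulAt_mul, comulAt_iterComul]

theorem bar_rightAdj (hp : IsBialgebraPairing p) (n : ℕ) (a : A) (y : ⨂[k]^(n + 1) B) :
    bar k B n (rightAdj p (n + 1) (y ⊗ₜ a)) = rightAdj p n (bar k B n y ⊗ₜ a) := by
  simp only [bar, LinearMap.sum_apply, LinearMap.smul_apply, TensorProduct.sum_tmul, map_sum,
    ← TensorProduct.smul_tmul', map_smul]
  refine Finset.sum_congr rfl fun i _ => congrArg _ (rainbow_right_ext p fun z => ?_)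
  simp only [hp.rainbow_mulAt, hp.rainbow_rightAdj, comulAt_mul, comulAt_iterComul]

end IsBialgebraPairing

instance ev_isPerfPair {A : Type*} [Ring A] [Bialgebra k A] [Module.Finite k A] :
    (HDual.ev k A).IsPerfPair :=
  .of_bijective _ HDual.toDual.bijective

end Bimodule

/-! ### The Hochschild boundary of a bimodule that need not be unital -/

section Hochschild

variable {k : Type*} [Field k] {A : Type*} [Ring A] [Algebra k A] {W : Type*} [AddCommGroup W]
  [Module k W]

/-- `a₁ ⋯ aₙ₊₁ ⊗ w ↦ a₁ ⋯ aₙ ⊗ aₙ₊₁ w`. -/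
def lastFace (ℓ : A ⊗[k] W →ₗ[k] W) (n : ℕ) :
    (⨂[k]^(n + 1) A) ⊗[k] W →ₗ[k] (⨂[k]^n A) ⊗[k] W :=
  ℓ.lTensor _ ∘ₗ (TensorProduct.assoc k _ _ _).toLinearMap ∘ₗ
    (snoc k A n).symm.toLinearMap.rTensor _

/-- `a₁ ⋯ aₙ₊₁ ⊗ w ↦ a₂ ⋯ aₙ₊₁ ⊗ w a₁`. -/
def firstFace (r : W ⊗[k] A →ₗ[k] W) (n : ℕ) :
    (⨂[k]^(n + 1) A) ⊗[k] W →ₗ[k] (⨂[k]^n A) ⊗[k] W :=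
  r.lTensor _ ∘ₗ (TensorProduct.assoc k _ _ _).toLinearMap ∘ₗ
    (TensorProduct.comm k A ((⨂[k]^n A) ⊗[k] W)).toLinearMap ∘ₗ
    (TensorProduct.assoc k _ _ _).toLinearMap ∘ₗ
    (cons k A n).symm.toLinearMap.rTensor _

/-- The Hochschild differential of the (possibly non-unital) bimodule `W`. -/
def hoch (ℓ : A ⊗[k] W →ₗ[k] W) (r : W ⊗[k] A →ₗ[k] W) (n : ℕ) :
    (⨂[k]^(n + 1) A) ⊗[k] W →ₗ[k] (⨂[k]^n A) ⊗[k] W :=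
  (bar k A n).rTensor W + (-1 : k) ^ (n + 1) • lastFace ℓ n + firstFace r n

/-- A bimodule on which the unit of the algebra need not act as the identity. -/
structure IsNonunitalBimodule (ℓ : A ⊗[k] W →ₗ[k] W) (r : W ⊗[k] A →ₗ[k] W) : Prop where
  left_assoc : ∀ a b w, ℓ (a ⊗ₜ ℓ (b ⊗ₜ w)) = ℓ ((a * b) ⊗ₜ w)
  right_assoc : ∀ w a b, r (r (w ⊗ₜ a) ⊗ₜ b) = r (w ⊗ₜ (a * b))
  middle_assoc : ∀ a w b, ℓ (a ⊗ₜ r (w ⊗ₜ b)) = r (ℓ (a ⊗ₜ w) ⊗ₜ b)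

@[simp]
theorem lastFace_snoc (ℓ : A ⊗[k] W →ₗ[k] W) (n : ℕ) (x : ⨂[k]^n A) (a : A) (w : W) :
    lastFace ℓ n (snoc k A n (x ⊗ₜ a) ⊗ₜ w) = x ⊗ₜ ℓ (a ⊗ₜ w) := by
  simp [lastFace]

@[simp]
theorem firstFace_cons (r : W ⊗[k] A →ₗ[k] W) (n : ℕ) (x : ⨂[k]^n A) (a : A) (w : W) :
    firstFace r n (cons k A n (a ⊗ₜ x) ⊗ₜ w) = x ⊗ₜ r (w ⊗ₜ a) := by
  simp [firstFace]

/-- `x ⊗ w ↦ a x ⊗ w`, where `a` is inserted as a new first factor. -/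
def consMap (W : Type*) [AddCommGroup W] [Module k W] (a : A) (n : ℕ) :
    (⨂[k]^n A) ⊗[k] W →ₗ[k] (⨂[k]^(n + 1) A) ⊗[k] W :=
  ((cons k A n).toLinearMap ∘ₗ TensorProduct.mk k _ _ a).rTensor W

/-- Left multiplication of the leftmost factor of `a₁ ⋯ aₙ ⊗ w` by `a`. -/
def mulFirst (ℓ : A ⊗[k] W →ₗ[k] W) (a : A) :
    ∀ n : ℕ, (⨂[k]^n A) ⊗[k] W →ₗ[k] (⨂[k]^n A) ⊗[k] W
  | 0 => (ℓ ∘ₗ TensorProduct.mk k _ _ a).lTensor _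
  | n + 1 => ((cons k A n).toLinearMap ∘ₗ (LinearMap.mulLeft k a).rTensor _ ∘ₗ
      (cons k A n).symm.toLinearMap).rTensor W

theorem consMap_tmul (a : A) (n : ℕ) (x : ⨂[k]^n A) (w : W) :
    consMap W a n (x ⊗ₜ w) = cons k A n (a ⊗ₜ x) ⊗ₜ w := rfl

theorem mulFirst_consMap (ℓ : A ⊗[k] W →ₗ[k] W) (a b : A) (n : ℕ) (z : (⨂[k]^n A) ⊗[k] W) :
    mulFirst ℓ a (n + 1) (consMap W b n z) = consMap W (a * b) n z := by
  induction z with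
  | zero => simp
  | add x y hx hy => simp only [map_add, hx, hy]
  | tmul x w => simp [consMap_tmul, mulFirst]

theorem consMap_ext {Z : Type*} [AddCommGroup Z] [Module k Z] {n : ℕ}
    {f g : (⨂[k]^(n + 1) A) ⊗[k] W →ₗ[k] Z}
    (h : ∀ a z, f (consMap W a n z) = g (consMap W a n z)) : f = g := by
  refine TensorProduct.ext' fun x w => ?_
  induction x using cons_induction with
  | hadd x y hx hy => simp only [TensorProduct.add_tmul, map_add, hx, hy]
  | h a x => exact h a (x ⊗ₜ w)

theorem bar_zero : bar k A 0 = 0 := by simp [bar]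

/-- The first product separates from the rest, whose indices are shifted by one; this shift produces
the minus sign. -/
theorem bar_cons_cons (n : ℕ) (a b : A) (x : ⨂[k]^n A) :
    bar k A (n + 1) (cons k A (n + 1) (a ⊗ₜ cons k A n (b ⊗ₜ x))) =
      -cons k A n ((a * b) ⊗ₜ x) - cons k A n (a ⊗ₜ bar k A n (cons k A n (b ⊗ₜ x))) := by
  have h : ∀ i : Fin n, mulAt k A (n + 1) i.succ (cons k A (n + 1) (a ⊗ₜ cons k A n (b ⊗ₜ x))) =
      cons k A n (a ⊗ₜ mulAt k A n i (cons k A n (b ⊗ₜ x))) := fun i => mulAt_succ n i a _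
  rw [bar, LinearMap.sum_apply, Fin.sum_univ_succ, sub_eq_add_neg]
  congr 1
  · rw [LinearMap.smul_apply, mulAt_zero]
    simp
  · simp only [LinearMap.smul_apply, h, bar, LinearMap.sum_apply, TensorProduct.tmul_sum, map_sum,
      TensorProduct.tmul_smul, map_smul, ← Finset.sum_neg_distrib, Fin.val_succ, ← neg_smul]
    refine Finset.sum_congr rfl fun i _ => ?_
    rw [pow_succ _ ((i : ℕ) + 1), mul_neg_one]

/-- The Hochschild differential without the term of the right action. -/
def hochLeft (ℓ : A ⊗[k] W →ₗ[k] W) (n : ℕ) :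
    (⨂[k]^(n + 1) A) ⊗[k] W →ₗ[k] (⨂[k]^n A) ⊗[k] W :=
  (bar k A n).rTensor W + (-1 : k) ^ (n + 1) • lastFace ℓ n

theorem hochLeft_zero_consMap (ℓ : A ⊗[k] W →ₗ[k] W) (a : A) (z : (⨂[k]^0 A) ⊗[k] W) :
    hochLeft ℓ 0 (consMap W a 0 z) = -mulFirst ℓ a 0 z := by
  induction z with
  | zero => simp
  | add x y hx hy => simp only [map_add, hx, hy, neg_add]
  | tmul x w =>
    obtain ⟨c, rfl⟩ := exists_smul_emptyTensor x
    rw [consMap_tmul, ← TensorProduct.smul_tmul', map_smul, TensorProduct.tmul_smul, map_smul,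
      cons_zero, ← TensorProduct.smul_tmul', map_smul]
    simp [hochLeft, bar_zero, mulFirst]

/-- With w regarded as one more letter at the right end, `hochLeft` is a bar boundary. Prepending a
letter a gives ∂(az) = -(a·z) - a(∂z), where a·z multiplies a into the leftmost letter. The case n =
0 has no second term, and there the leftmost letter is w, which explains the degree-zero clause of
`mulFirst`. -/
theorem hochLeft_succ_consMap (ℓ : A ⊗[k] W →ₗ[k] W) (n : ℕ) (a : A)
    (z : (⨂[k]^(n + 1) A) ⊗[k] W) :
    hochLeft ℓ (n + 1) (consMap W a (n + 1) z) =
      -mulFirst ℓ a (n + 1) z - consMap W a n (hochLeft ℓ n z) := by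
  have h1 : ∀ z, (bar k A (n + 1)).rTensor W (consMap W a (n + 1) z) =
      -mulFirst ℓ a (n + 1) z - consMap W a n ((bar k A n).rTensor W z) := fun z => by
    induction z with
    | zero => simp
    | add x y hx hy => simp only [map_add, hx, hy]; abel
    | tmul x w =>
      induction x using cons_induction with
      | hadd x y hx hy => simp only [TensorProduct.add_tmul, map_add, hx, hy]; abel
      | h b x =>
        rw [← consMap_tmul, mulFirst_consMap, consMap_tmul, consMap_tmul, consMap_tmul,
          LinearMap.rTensor_tmul, LinearMap.rTensor_tmul, bar_cons_cons, consMap_tmul,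
          TensorProduct.sub_tmul, TensorProduct.neg_tmul]
  have h2 : ∀ z, lastFace ℓ (n + 1) (consMap W a (n + 1) z) =
      consMap W a n (lastFace ℓ n z) := fun z => by
    induction z with
    | zero => simp
    | add x y hx hy => simp only [map_add, hx, hy]
    | tmul x w =>
      induction x using snoc_induction with
      | hadd x y hx hy => simp only [TensorProduct.add_tmul, map_add, hx, hy]
      | h x b => rw [consMap_tmul, cons_snoc, lastFace_snoc, lastFace_snoc, consMap_tmul]
  simp only [hochLeft, LinearMap.add_apply, LinearMap.smul_apply, h1, h2, map_add, map_smul]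
  rw [pow_succ (-1 : k) (n + 1), mul_neg_one, neg_smul]
  abel

theorem mulFirst_mulFirst {ℓ : A ⊗[k] W →ₗ[k] W}
    (hℓ : ∀ a b w, ℓ (a ⊗ₜ ℓ (b ⊗ₜ w)) = ℓ ((a * b) ⊗ₜ w)) (a b : A) (n : ℕ)
    (z : (⨂[k]^n A) ⊗[k] W) :
    mulFirst ℓ a n (mulFirst ℓ b n z) = mulFirst ℓ (a * b) n z := by
  cases n with
  | zero =>
    induction z with
    | zero => simp
    | add x y hx hy => simp only [map_add, hx, hy]
    | tmul x w => simp [mulFirst, hℓ]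
  | succ n =>
    refine LinearMap.congr_fun (f := mulFirst ℓ a (n + 1) ∘ₗ mulFirst ℓ b (n + 1))
      (consMap_ext fun c z => ?_) z
    simp only [LinearMap.comp_apply, mulFirst_consMap, mul_assoc]

/-- On a word bz both sides expand by the prepending formula, and only (ab)c = a(bc), or its
analogue for the action, is left. -/
theorem mulFirst_hochLeft {ℓ : A ⊗[k] W →ₗ[k] W}
    (hℓ : ∀ a b w, ℓ (a ⊗ₜ ℓ (b ⊗ₜ w)) = ℓ ((a * b) ⊗ₜ w)) (a : A) (n : ℕ)
    (z : (⨂[k]^(n + 1) A) ⊗[k] W) :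
    mulFirst ℓ a n (hochLeft ℓ n z) = hochLeft ℓ n (mulFirst ℓ a (n + 1) z) := by
  refine LinearMap.congr_fun (f := mulFirst ℓ a n ∘ₗ hochLeft ℓ n)
    (g := hochLeft ℓ n ∘ₗ mulFirst ℓ a (n + 1)) (consMap_ext fun b z => ?_) z
  simp only [LinearMap.comp_apply, mulFirst_consMap]
  cases n with
  | zero => simp only [hochLeft_zero_consMap, map_neg, mulFirst_mulFirst hℓ]
  | succ n => simp only [hochLeft_succ_consMap, map_sub, map_neg, mulFirst_mulFirst hℓ,
      mulFirst_consMap]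

/-- Induction through the prepending formula in place of a double sum over faces: ∂∂(az) = -∂(a·z) -
∂(a ∂z) = -a·∂z + a·∂z + a ∂∂z. -/
theorem hochLeft_hochLeft {ℓ : A ⊗[k] W →ₗ[k] W}
    (hℓ : ∀ a b w, ℓ (a ⊗ₜ ℓ (b ⊗ₜ w)) = ℓ ((a * b) ⊗ₜ w)) (n : ℕ)
    (z : (⨂[k]^(n + 2) A) ⊗[k] W) : hochLeft ℓ n (hochLeft ℓ (n + 1) z) = 0 := by
  induction n with
  | zero =>
    refine LinearMap.congr_fun (f := hochLeft ℓ 0 ∘ₗ hochLeft ℓ 1) (g := 0)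
      (consMap_ext fun b z => ?_) z
    rw [LinearMap.comp_apply, LinearMap.zero_apply, hochLeft_succ_consMap, map_sub, map_neg,
      ← mulFirst_hochLeft hℓ, hochLeft_zero_consMap]
    abel
  | succ n ih =>
    refine LinearMap.congr_fun (f := hochLeft ℓ (n + 1) ∘ₗ hochLeft ℓ (n + 2)) (g := 0)
      (consMap_ext fun b z => ?_) z
    rw [LinearMap.comp_apply, LinearMap.zero_apply, hochLeft_succ_consMap, map_sub, map_neg,
      ← mulFirst_hochLeft hℓ, hochLeft_succ_consMap, ih, map_zero]
    abel

/-- `x ⊗ w ↦ x ⊗ w a`. -/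
def mulCoef (r : W ⊗[k] A →ₗ[k] W) (a : A) (n : ℕ) :
    (⨂[k]^n A) ⊗[k] W →ₗ[k] (⨂[k]^n A) ⊗[k] W :=
  (r ∘ₗ (TensorProduct.mk k W A).flip a).lTensor _

theorem firstFace_consMap (r : W ⊗[k] A →ₗ[k] W) (a : A) (n : ℕ) (z : (⨂[k]^n A) ⊗[k] W) :
    firstFace r n (consMap W a n z) = mulCoef r a n z := by
  induction z with
  | zero => simp
  | add x y hx hy => simp only [map_add, hx, hy]
  | tmul x w => rw [consMap_tmul, firstFace_cons]; rfl

theorem hochLeft_mulCoef {ℓ : A ⊗[k] W →ₗ[k] W} {r : W ⊗[k] A →ₗ[k] W}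
    (h : IsNonunitalBimodule ℓ r) (a : A) (n : ℕ) (z : (⨂[k]^(n + 1) A) ⊗[k] W) :
    hochLeft ℓ n (mulCoef r a (n + 1) z) = mulCoef r a n (hochLeft ℓ n z) := by
  induction z with
  | zero => simp
  | add x y hx hy => simp only [map_add, hx, hy]
  | tmul x w =>
    induction x using snoc_induction with
    | hadd x y hx hy => simp only [TensorProduct.add_tmul, map_add, hx, hy]
    | h x b => simp [hochLeft, mulCoef, h.middle_assoc]

/-- On bz both sides give z with coefficient acted on by ab: either a is multiplied into b before b
reaches the coefficient, or a acts first and b afterwards. -/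
theorem firstFace_mulFirst {ℓ : A ⊗[k] W →ₗ[k] W} {r : W ⊗[k] A →ₗ[k] W}
    (h : IsNonunitalBimodule ℓ r) (a : A) (n : ℕ) (z : (⨂[k]^(n + 1) A) ⊗[k] W) :
    firstFace r n (mulFirst ℓ a (n + 1) z) = firstFace r n (mulCoef r a (n + 1) z) := by
  refine LinearMap.congr_fun (f := firstFace r n ∘ₗ mulFirst ℓ a (n + 1))
    (g := firstFace r n ∘ₗ mulCoef r a (n + 1)) (consMap_ext fun b z => ?_) z
  simp only [LinearMap.comp_apply, mulFirst_consMap, firstFace_consMap]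
  induction z with
  | zero => simp
  | add x y hx hy => simp only [map_add, hx, hy]
  | tmul x w => simp [mulCoef, consMap_tmul, h.right_assoc]

/-- Since `hochLeft` squares to zero, only the terms with `firstFace` remain. On az they are
expressed through the right action of a on the coefficient, which commutes with `hochLeft`, and they
cancel in pairs. -/
theorem hoch_comp_hoch {ℓ : A ⊗[k] W →ₗ[k] W} {r : W ⊗[k] A →ₗ[k] W}
    (h : IsNonunitalBimodule ℓ r) (n : ℕ) : hoch ℓ r n ∘ₗ hoch ℓ r (n + 1) = 0 := by
  have e : ∀ n, hoch ℓ r n = hochLeft ℓ n + firstFace r n := fun n => rfl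
  refine LinearMap.ext fun z => ?_
  simp only [e, LinearMap.comp_apply, LinearMap.add_apply, map_add,
    hochLeft_hochLeft h.left_assoc, LinearMap.zero_apply, zero_add]
  refine LinearMap.congr_fun (f := firstFace r n ∘ₗ hochLeft ℓ (n + 1) +
    (hochLeft ℓ n ∘ₗ firstFace r (n + 1) + firstFace r n ∘ₗ firstFace r (n + 1))) (g := 0)
    (consMap_ext fun a z => ?_) z
  simp only [LinearMap.comp_apply, LinearMap.add_apply, firstFace_consMap, hochLeft_succ_consMap,
    map_sub, map_neg, firstFace_mulFirst h, hochLeft_mulCoef h, LinearMap.zero_apply]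
  abel

end Hochschild

/-! ### Commutation of the two Hochschild boundaries -/

section Commutation

variable {k : Type*} [Field k] {A B : Type*} [Ring A] [Bialgebra k A] [Ring B] [Bialgebra k B]
  {p : A →ₗ[k] B →ₗ[k] k}

/-- An operator between tensor products with the two tensor factors interchanged. -/
def swapMap {X Y X' Y' : Type*} [AddCommGroup X] [Module k X] [AddCommGroup Y] [Module k Y]
    [AddCommGroup X'] [Module k X'] [AddCommGroup Y'] [Module k Y']
    (f : X ⊗[k] Y →ₗ[k] X' ⊗[k] Y') : Y ⊗[k] X →ₗ[k] Y' ⊗[k] X' :=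
  (TensorProduct.comm k X' Y').toLinearMap ∘ₗ f ∘ₗ (TensorProduct.comm k Y X).toLinearMap

theorem swapMap_tmul {X Y X' Y' : Type*} [AddCommGroup X] [Module k X] [AddCommGroup Y]
    [Module k Y] [AddCommGroup X'] [Module k X'] [AddCommGroup Y'] [Module k Y']
    (f : X ⊗[k] Y →ₗ[k] X' ⊗[k] Y') (x : X) (y : Y) :
    swapMap f (y ⊗ₜ x) = TensorProduct.comm k X' Y' (f (x ⊗ₜ y)) := rfl

theorem lastFace_comm_lTensor_bar [Module.Finite k B] [p.IsPerfPair] (hp : IsBialgebraPairing p)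
    (n m : ℕ) :
    lastFace (leftAdj p m) n ∘ₗ (bar k B m).lTensor _ =
      (bar k B m).lTensor _ ∘ₗ lastFace (leftAdj p (m + 1)) n := by
  refine TensorProduct.ext' fun x y => ?_
  induction x using snoc_induction with
  | hadd x y hx hy => simp only [TensorProduct.add_tmul, map_add, hx, hy]
  | h x a => simp [hp.bar_leftAdj]

theorem firstFace_comm_lTensor_bar [Module.Finite k B] [p.IsPerfPair] (hp : IsBialgebraPairing p)
    (n m : ℕ) :
    firstFace (rightAdj p m) n ∘ₗ (bar k B m).lTensor _ =
      (bar k B m).lTensor _ ∘ₗ firstFace (rightAdj p (m + 1)) n := by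
  refine TensorProduct.ext' fun x y => ?_
  induction x using cons_induction with
  | hadd x y hx hy => simp only [TensorProduct.add_tmul, map_add, hx, hy]
  | h x a => simp [hp.bar_rightAdj]

variable (p)

/-- For the words xa and yb both orders give ∑ p(a₍₁₎, b₍₁₎) (b₍₂₎·x) ⊗ (a₍₂₎·y). -/
theorem lastFace_comm_lastFace (n m : ℕ) :
    lastFace (leftAdj p m) n ∘ₗ swapMap (lastFace (leftAdj p.flip (n + 1)) m) =
      swapMap (lastFace (leftAdj p.flip n) m) ∘ₗ lastFace (leftAdj p (m + 1)) n := by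
  refine TensorProduct.ext' fun x y => ?_
  induction x using snoc_induction with
  | hadd x y hx hy => simp only [TensorProduct.add_tmul, map_add, hx, hy]
  | h x a =>
    induction y using snoc_induction with
    | hadd x y hx hy => simp only [TensorProduct.tmul_add, map_add, hx, hy]
    | h y b =>
      have r := Coalgebra.Repr.arbitrary k a
      have s := Coalgebra.Repr.arbitrary k b
      simp [swapMap_tmul, leftAdj_snoc _ _ _ r s, leftAdj_snoc _ _ _ s r,
        TensorProduct.tmul_sum]
      exact Finset.sum_comm

/-- For the words ax and by both orders give ∑ p(a₍₂₎, b₍₂₎) (x·b₍₁₎) ⊗ (y·a₍₁₎). -/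
theorem firstFace_comm_firstFace (n m : ℕ) :
    firstFace (rightAdj p m) n ∘ₗ swapMap (firstFace (rightAdj p.flip (n + 1)) m) =
      swapMap (firstFace (rightAdj p.flip n) m) ∘ₗ firstFace (rightAdj p (m + 1)) n := by
  refine TensorProduct.ext' fun x y => ?_
  induction x using cons_induction with
  | hadd x y hx hy => simp only [TensorProduct.add_tmul, map_add, hx, hy]
  | h a x =>
    induction y using cons_induction with
    | hadd x y hx hy => simp only [TensorProduct.tmul_add, map_add, hx, hy]
    | h b y =>
      have r := Coalgebra.Repr.arbitrary k a
      have s := Coalgebra.Repr.arbitrary k b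
      simp [swapMap_tmul, rightAdj_cons _ _ _ r s, rightAdj_cons _ _ _ s r,
        TensorProduct.tmul_sum]
      exact Finset.sum_comm

/-- For the words xa and by both orders give ∑ p(a₍₂₎, b₍₁₎) (x·b₍₂₎) ⊗ (a₍₁₎·y). -/
theorem lastFace_comm_firstFace (n m : ℕ) :
    lastFace (leftAdj p m) n ∘ₗ swapMap (firstFace (rightAdj p.flip (n + 1)) m) =
      swapMap (firstFace (rightAdj p.flip n) m) ∘ₗ lastFace (leftAdj p (m + 1)) n := by
  refine TensorProduct.ext' fun x y => ?_
  induction x using snoc_induction with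
  | hadd x y hx hy => simp only [TensorProduct.add_tmul, map_add, hx, hy]
  | h x a =>
    induction y using cons_induction with
    | hadd x y hx hy => simp only [TensorProduct.tmul_add, map_add, hx, hy]
    | h b y =>
      have r := Coalgebra.Repr.arbitrary k a
      have s := Coalgebra.Repr.arbitrary k b
      simp [swapMap_tmul, leftAdj_cons _ _ _ r s, rightAdj_snoc _ _ _ s r,
        TensorProduct.tmul_sum]
      exact Finset.sum_comm

theorem swapMap_comp {X Y X' Y' X'' Y'' : Type*} [AddCommGroup X] [Module k X] [AddCommGroup Y]
    [Module k Y] [AddCommGroup X'] [Module k X'] [AddCommGroup Y'] [Module k Y']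
    [AddCommGroup X''] [Module k X''] [AddCommGroup Y''] [Module k Y'']
    (g : X' ⊗[k] Y' →ₗ[k] X'' ⊗[k] Y'') (f : X ⊗[k] Y →ₗ[k] X' ⊗[k] Y') :
    swapMap g ∘ₗ swapMap f = swapMap (g ∘ₗ f) := by
  refine LinearMap.ext fun z => ?_
  simp [swapMap]

theorem swapMap_swapMap {X Y X' Y' : Type*} [AddCommGroup X] [Module k X]
    [AddCommGroup Y] [Module k Y] [AddCommGroup X'] [Module k X'] [AddCommGroup Y'] [Module k Y']
    (f : X ⊗[k] Y →ₗ[k] X' ⊗[k] Y') : swapMap (swapMap f) = f := by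
  refine LinearMap.ext fun z => ?_
  simp [swapMap]

theorem swapMap_add {X Y X' Y' : Type*} [AddCommGroup X] [Module k X]
    [AddCommGroup Y] [Module k Y] [AddCommGroup X'] [Module k X'] [AddCommGroup Y'] [Module k Y']
    (f g : X ⊗[k] Y →ₗ[k] X' ⊗[k] Y') : swapMap (f + g) = swapMap f + swapMap g := by
  simp [swapMap, LinearMap.add_comp, LinearMap.comp_add]

theorem swapMap_smul {X Y X' Y' : Type*} [AddCommGroup X] [Module k X]
    [AddCommGroup Y] [Module k Y] [AddCommGroup X'] [Module k X'] [AddCommGroup Y'] [Module k Y']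
    (c : k) (f : X ⊗[k] Y →ₗ[k] X' ⊗[k] Y') : swapMap (c • f) = c • swapMap f := by
  simp [swapMap, LinearMap.smul_comp, LinearMap.comp_smul]

theorem swapMap_zero {X Y X' Y' : Type*} [AddCommGroup X] [Module k X]
    [AddCommGroup Y] [Module k Y] [AddCommGroup X'] [Module k X'] [AddCommGroup Y'] [Module k Y'] :
    swapMap (0 : X ⊗[k] Y →ₗ[k] X' ⊗[k] Y') = 0 := by
  simp [swapMap]

theorem swapMap_lTensor {X Y Y' : Type*} [AddCommGroup X] [Module k X]
    [AddCommGroup Y] [Module k Y] [AddCommGroup Y'] [Module k Y']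
    (f : Y →ₗ[k] Y') : swapMap (f.lTensor X) = f.rTensor X := by
  refine TensorProduct.ext' fun x y => ?_
  simp [swapMap]

theorem swapMap_rTensor {X X' Y : Type*} [AddCommGroup X] [Module k X]
    [AddCommGroup Y] [Module k Y] [AddCommGroup X'] [Module k X']
    (f : X →ₗ[k] X') : swapMap (f.rTensor Y) = f.lTensor Y := by
  refine TensorProduct.ext' fun x y => ?_
  simp [swapMap]

/-- The mirror image of `lastFace_comm_firstFace`, read off for the flipped pairing after
interchanging the tensor factors. -/
theorem firstFace_comm_lastFace (n m : ℕ) :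
    firstFace (rightAdj p m) n ∘ₗ swapMap (lastFace (leftAdj p.flip (n + 1)) m) =
      swapMap (lastFace (leftAdj p.flip n) m) ∘ₗ firstFace (rightAdj p (m + 1)) n := by
  have h := congrArg swapMap (lastFace_comm_firstFace p.flip m n)
  rw [← swapMap_comp, ← swapMap_comp, swapMap_swapMap, swapMap_swapMap] at h
  exact h.symm

/-- The differential of the bicomplex `Aⁿ ⊗ Bᵐ` with two optional terms. -/
def optHoch (c c' : k) (n m : ℕ) :
    (⨂[k]^(n + 1) A) ⊗[k] (⨂[k]^m B) →ₗ[k] (⨂[k]^n A) ⊗[k] (⨂[k]^m B) :=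
  hoch (c • leftAdj p m) (c' • rightAdj p m) n

theorem optHoch_eq (c c' : k) (n m : ℕ) :
    optHoch p c c' n m = (bar k A n).rTensor _ +
      ((-1 : k) ^ (n + 1) * c) • lastFace (leftAdj p m) n + c' • firstFace (rightAdj p m) n := by
  simp only [optHoch, hoch, mul_smul]
  congr 1
  · congr 2
    simp [lastFace, LinearMap.lTensor_smul, LinearMap.smul_comp]
  · simp [firstFace, LinearMap.lTensor_smul, LinearMap.smul_comp]

variable {p}

/-- Scaling an action by an idempotent keeps it associative, so the actions may be kept or switched
off independently of each other. -/
theorem optHoch_comp_optHoch [Module.Finite k B] [p.IsPerfPair] (hp : IsBialgebraPairing p)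
    {c c' : k} (hc : c * c = c) (hc' : c' * c' = c') (n m : ℕ) :
    optHoch p c c' n m ∘ₗ optHoch p c c' (n + 1) m = 0 := by
  refine hoch_comp_hoch ⟨fun a b w => ?_, fun w a b => ?_, fun a w b => ?_⟩ n
  · simp only [LinearMap.smul_apply, TensorProduct.tmul_smul, map_smul, smul_smul, hc,
      hp.leftAdj_leftAdj]
  · simp [← TensorProduct.smul_tmul', smul_smul, hc', hp.rightAdj_rightAdj]
  · simp [← TensorProduct.smul_tmul', TensorProduct.tmul_smul, smul_smul, hp.leftAdj_rightAdj,
      mul_comm]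

/-- Each term of one differential commutes with each term of the other, so the scalars are arbitrary
here. -/
theorem optHoch_comm_optHoch [Module.Finite k A] [Module.Finite k B] [p.IsPerfPair]
    (hp : IsBialgebraPairing p) (c c' d d' : k) (n m : ℕ) :
    optHoch p c c' n m ∘ₗ swapMap (optHoch p.flip d d' m (n + 1)) =
      swapMap (optHoch p.flip d d' m n) ∘ₗ optHoch p c c' n (m + 1) := by
  have h1 : (bar k A n).rTensor (⨂[k]^m B) ∘ₗ (bar k B m).lTensor _ =
      (bar k B m).lTensor _ ∘ₗ (bar k A n).rTensor _ := TensorProduct.ext' fun x y => by simp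
  -- Equivariance for the flipped pairing, with the factors interchanged: the bar part of `A`
  -- commutes with the faces that consume letters of `B`.
  have h2 := congrArg swapMap (lastFace_comm_lTensor_bar hp.flip m n)
  have h3 := congrArg swapMap (firstFace_comm_lTensor_bar hp.flip m n)
  rw [← swapMap_comp, ← swapMap_comp, swapMap_lTensor, swapMap_lTensor] at h2 h3
  have h4 := lastFace_comm_lTensor_bar hp n m
  have h5 := firstFace_comm_lTensor_bar hp n m
  have h6 := lastFace_comm_lastFace p n m
  have h7 := lastFace_comm_firstFace p n m
  have h8 := firstFace_comm_lastFace p n m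
  have h9 := firstFace_comm_firstFace p n m
  refine LinearMap.ext fun z => ?_
  replace h1 := LinearMap.congr_fun h1 z
  replace h2 := LinearMap.congr_fun h2 z
  replace h3 := LinearMap.congr_fun h3 z
  replace h4 := LinearMap.congr_fun h4 z
  replace h5 := LinearMap.congr_fun h5 z
  replace h6 := LinearMap.congr_fun h6 z
  replace h7 := LinearMap.congr_fun h7 z
  replace h8 := LinearMap.congr_fun h8 z
  replace h9 := LinearMap.congr_fun h9 z
  simp only [LinearMap.comp_apply] at h1 h2 h3 h4 h5 h6 h7 h8 h9
  simp only [optHoch_eq, swapMap_add, swapMap_smul, swapMap_rTensor, LinearMap.comp_apply,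
    LinearMap.add_apply, LinearMap.smul_apply, map_add, map_smul, h1, ← h2, ← h3, h4, h5, h6, h7,
    h8, h9]
  module

theorem isBicomplex_of_commute {C : ℕ → ℕ → Type*} [∀ n m, AddCommGroup (C n m)]
    [∀ n m, Module k (C n m)] {d : ∀ n m, C (n + 1) m →ₗ[k] C n m}
    {d' : ∀ n m, C n (m + 1) →ₗ[k] C n m} (hd : ∀ n m, d n m ∘ₗ d (n + 1) m = 0)
    (hd' : ∀ n m, d' n m ∘ₗ d' n (m + 1) = 0)
    (h : ∀ n m, d n m ∘ₗ d' (n + 1) m = d' n m ∘ₗ d n (m + 1)) :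
    IsBicomplex (C := C) d fun n m => (-1 : k) ^ n • d' n m where
  d_comp_d := hd
  d'_comp_d' n m := by rw [LinearMap.smul_comp, LinearMap.comp_smul, hd', smul_zero, smul_zero]
  anticomm n m := by
    rw [LinearMap.comp_smul, LinearMap.smul_comp, h, pow_succ, mul_neg_one, neg_smul,
      neg_add_cancel]

theorem optHoch_isBicomplex [Module.Finite k A] [Module.Finite k B] [p.IsPerfPair]
    (hp : IsBialgebraPairing p) {c c' d d' : k} (hc : c * c = c) (hc' : c' * c' = c')
    (hd : d * d = d) (hd' : d' * d' = d') :
    IsBicomplex (C := fun n m => (⨂[k]^n A) ⊗[k] (⨂[k]^m B)) (optHoch p c c')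
      fun n m => (-1 : k) ^ n • swapMap (optHoch p.flip d d' m n) :=
  isBicomplex_of_commute (optHoch_comp_optHoch hp hc hc')
    (fun n m => by rw [swapMap_comp, optHoch_comp_optHoch hp.flip hd hd', swapMap_zero])
    (optHoch_comm_optHoch hp c c' d d')

end Commutation

/-! ### The four bicomplexes -/

section Table

variable {k H : Type*} [Field k] [Ring H] [Bialgebra k H]

theorem dCob_eq (n m : ℕ) : dCob k H n m = swapMap ((bar k (HDual k H) m).rTensor _) :=
  (swapMap_rTensor _).symm

variable [Module.Finite k H]

theorem piLeft_eq (n m : ℕ) : piLeft k H n m = lastFace (leftAdj (HDual.ev k H).flip m) n := rfl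

theorem piRight_eq (n m : ℕ) :
    piRight k H n m = firstFace (rightAdj (HDual.ev k H).flip m) n := rfl

theorem piDualLeft_eq (n m : ℕ) :
    piDualLeft k H n m = swapMap (lastFace (leftAdj (HDual.ev k H) n) m) := by
  refine TensorProduct.ext' fun x y => ?_
  induction y using snoc_induction with
  | hadd x y hx hy => simp only [TensorProduct.tmul_add, map_add, hx, hy]
  | h y l => simp [swapMap_tmul, piDualLeft]

theorem piDualRight_eq (n m : ℕ) :
    piDualRight k H n m = swapMap (firstFace (rightAdj (HDual.ev k H) n) m) := by
  refine TensorProduct.ext' fun x y => ?_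
  induction y using cons_induction with
  | hadd x y hx hy => simp only [TensorProduct.tmul_add, map_add, hx, hy]
  | h y l => simp [swapMap_tmul, piDualRight]

theorem table_isBicomplex (r : Fin 4) :
    IsBicomplex (C := Cx k H) (tableD k H r) (tableD' k H r) := by
  -- The scalars c, c', d, d' are the switches of π^H, ^Hπ, π^{H*} and ^{H*}π; the four cases insert
  -- the values 0 and 1.
  have key : ∀ c c' d d' : k, c * c = c → c' * c' = c' → d * d = d → d' * d' = d' →
      tableD k H r = (fun n m => dBar k H n m + ((-1 : k) ^ (n + 1) * c) • piLeft k H n m +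
        c' • piRight k H n m) →
      tableD' k H r = (fun n m => (-1 : k) ^ n • (dCob k H n m +
        ((-1 : k) ^ (m + 1) * d) • piDualLeft k H n m + d' • piDualRight k H n m)) →
      IsBicomplex (C := Cx k H) (tableD k H r) (tableD' k H r) := by
    intro c c' d d' hc hc' hd hd' h h'
    have := optHoch_isBicomplex (ev_isBialgebraPairing (k := k) (A := H)).flip hc hc' hd hd'
    have e : optHoch (HDual.ev k H).flip c c' = fun n m => (bar k H n).rTensor _ +
        ((-1 : k) ^ (n + 1) * c) • lastFace (leftAdj (HDual.ev k H).flip m) n +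
        c' • firstFace (rightAdj (HDual.ev k H).flip m) n := by
      funext n m
      exact optHoch_eq _ _ _ _ _
    rw [e] at this
    simp only [optHoch_eq, swapMap_add, swapMap_smul, LinearMap.flip_flip] at this
    rw [h, h']
    simp only [piLeft_eq, piRight_eq, piDualLeft_eq, piDualRight_eq, dCob_eq]
    exact this
  match r with
  | 0 =>
    exact key 0 0 0 0 (by simp) (by simp) (by simp) (by simp)
      (by funext n m; simp [tableD]) (by funext n m; simp [tableD'])
  | 1 =>
    exact key 1 0 0 1 (by simp) (by simp) (by simp) (by simp)
      (by funext n m; simp [tableD]) (by funext n m; simp [tableD'])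
  | 2 =>
    exact key 0 1 1 0 (by simp) (by simp) (by simp) (by simp)
      (by funext n m; simp [tableD])
      (by funext n m; simp only [tableD', pow_add]; module)
  | 3 =>
    exact key 1 1 1 1 (by simp) (by simp) (by simp) (by simp)
      (by funext n m; simp [tableD])
      (by funext n m; simp only [tableD', pow_add]; module)

end Table

/-! ### Hom spaces as duals and tensor products, and the triangular sign -/

section Duality

variable {k : Type*} [Field k] {X Y Z : Type*} [AddCommGroup X] [Module k X]
  [AddCommGroup Y] [Module k Y] [AddCommGroup Z] [Module k Z]

/-- `f ↦ (x ⊗ y ↦ q(y, f(x)))` as an isomorphism, for a pairing `q` identifying `Z` with `Y*`. -/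
def homDualEquiv (X : Type*) [AddCommGroup X] [Module k X] (q : Y →ₗ[k] Z →ₗ[k] k)
    (hq : Function.Bijective q.flip) : (X →ₗ[k] Z) ≃ₗ[k] Module.Dual k (X ⊗[k] Y) :=
  (LinearEquiv.ofBijective q.flip hq).congrRight ≪≫ₗ
    TensorProduct.lift.equiv (.id k) X Y k

@[simp]
theorem homDualEquiv_tmul (q : Y →ₗ[k] Z →ₗ[k] k) (hq : Function.Bijective q.flip)
    (f : X →ₗ[k] Z) (x : X) (y : Y) : homDualEquiv X q hq f (x ⊗ₜ y) = q y (f x) := by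
  simp only [homDualEquiv, LinearEquiv.trans_apply, TensorProduct.lift.equiv_apply]
  rfl

/-- `x ⊗ y ↦ (z ↦ q(y, z) x)` as an isomorphism, for a pairing `q` identifying `Y` with `Z*`. -/
def tensorHomEquiv (X : Type*) [AddCommGroup X] [Module k X] [Module.Finite k Z]
    (q : Y →ₗ[k] Z →ₗ[k] k) (hq : Function.Bijective q) : (X ⊗[k] Y) ≃ₗ[k] (Z →ₗ[k] X) :=
  TensorProduct.comm k X Y ≪≫ₗ
    TensorProduct.congr (LinearEquiv.ofBijective q hq) (LinearEquiv.refl k X) ≪≫ₗ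
    dualTensorHomEquiv k Z X

theorem tensorHomEquiv_tmul [Module.Finite k Z] (q : Y →ₗ[k] Z →ₗ[k] k)
    (hq : Function.Bijective q) (x : X) (y : Y) (z : Z) :
    tensorHomEquiv X q hq (x ⊗ₜ y) z = q y z • x := by
  simp [tensorHomEquiv]

/-- The sign `(-1)^{m(m+1)/2}`. -/
def triSign (k : Type*) [Field k] (m : ℕ) : k := (-1) ^ (m * (m + 1) / 2)

theorem triSign_ne_zero (m : ℕ) : triSign k m ≠ 0 := pow_ne_zero _ (neg_ne_zero.mpr one_ne_zero)

theorem triSign_succ (m : ℕ) : triSign k (m + 1) = triSign k m * (-1) ^ (m + 1) := by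
  rw [triSign, triSign, ← pow_add]
  congr 1
  have : (m + 1) * (m + 1 + 1) = m * (m + 1) + (m + 1) * 2 := by ring
  rw [this, Nat.add_mul_div_right _ _ (by norm_num)]

end Duality

/-! ### Transposing the cobar differential -/

section Cobar

variable {k : Type*} [Field k] {A B : Type*} [Ring A] [Bialgebra k A] [Ring B] [Bialgebra k B]
  {p : A →ₗ[k] B →ₗ[k] k}

/-- The cobar differential is dual to the bar differential, up to sign. -/
theorem IsBialgebraPairing.rainbow_bar (hp : IsBialgebraPairing p) (m : ℕ) (y : ⨂[k]^(m + 1) A)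
    (z : ⨂[k]^m B) :
    rainbow p (m + 1) y ((∑ j : Fin m, (-1 : k) ^ ((j : ℕ) + 1) • comulAt k B m j) z) =
      (-1) ^ (m + 1) * rainbow p m (bar k A m y) z := by
  rw [← rainbow_flip p m, bar, LinearMap.sum_apply, LinearMap.sum_apply, map_sum, map_sum,
    Finset.mul_sum, ← Equiv.sum_comp Fin.revPerm]
  refine Finset.sum_congr rfl fun i _ => ?_
  -- The mirrored places, counted from one, add up to m+1, so their signs differ by the constant
  -- (-1)^{m+1}.
  have e : ((-1 : k)) ^ ((i.rev : ℕ) + 1) = (-1) ^ (m + 1) * (-1) ^ ((i : ℕ) + 1) := by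
    have : m + 1 + ((i : ℕ) + 1) = ((i.rev : ℕ) + 1) + 2 * ((i : ℕ) + 1) := by
      rw [Fin.val_rev]; omega
    rw [← pow_add, this, pow_add _ _ (2 * _), pow_mul]
    simp
  rw [LinearMap.smul_apply, LinearMap.smul_apply, map_smul, map_smul, hp.flip.rainbow_mulAt,
    rainbow_flip, Fin.revPerm_apply, smul_eq_mul, smul_eq_mul, e, mul_assoc]

end Cobar

/-! ### The Gerstenhaber–Schack bicomplex as a linear dual -/

section GerstenhaberSchack

variable {k H : Type*} [Field k] [Ring H] [Bialgebra k H] [Module.Finite k H]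

variable (k H) in
/-- The isomorphism of the Gerstenhaber-Schack cochains with the dual of `Hⁿ ⊗ (H*)ᵐ`, without
its sign. -/
def gsDual (n m : ℕ) : GS k H n m ≃ₗ[k] Module.Dual k (Cx k H n m) :=
  homDualEquiv _ (rainbow (HDual.ev k H) m) (LinearMap.IsPerfPair.bijective_right _)

@[simp]
theorem gsDual_tmul (n m : ℕ) (f : GS k H n m) (x : ⨂[k]^n H) (y : ⨂[k]^m (HDual k H)) :
    gsDual k H n m f (x ⊗ₜ y) = rainbow (HDual.ev k H) m y (f x) :=
  homDualEquiv_tmul _ _ _ _ _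

/-- The transpose of the diagonal left action on Hᵐ is the right adjoint action on (H*)ᵐ, which is
why h₁·f corresponds to ^Hπ. -/
theorem rainbow_iterComul_mul (m : ℕ) (h : H) (y : ⨂[k]^m (HDual k H)) (z : ⨂[k]^m H) :
    rainbow (HDual.ev k H) m y (iterComul k H m h * z) =
      rainbow (HDual.ev k H) m (rightAdj (HDual.ev k H).flip m (y ⊗ₜ h)) z := by
  rw [← rainbow_flip (HDual.ev k H), ← rainbow_flip (HDual.ev k H),
    ev_isBialgebraPairing.flip.rainbow_rightAdj]

theorem rainbow_mul_iterComul (m : ℕ) (h : H) (y : ⨂[k]^m (HDual k H)) (z : ⨂[k]^m H) :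
    rainbow (HDual.ev k H) m y (z * iterComul k H m h) =
      rainbow (HDual.ev k H) m (leftAdj (HDual.ev k H).flip m (h ⊗ₜ y)) z := by
  rw [← rainbow_flip (HDual.ev k H), ← rainbow_flip (HDual.ev k H),
    ev_isBialgebraPairing.flip.rainbow_leftAdj]

theorem gsDual_gsHoch (n m : ℕ) (f : GS k H n m) :
    gsDual k H (n + 1) m (gsHoch k H n m f) = gsDual k H n m f ∘ₗ tableD k H 3 n m := by
  have h1 : ∀ (x : ⨂[k]^(n + 1) H) (y : ⨂[k]^m (HDual k H)),
      rainbow (HDual.ev k H) m y (LinearMap.mul' k (⨂[k]^m H)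
        (TensorProduct.map (iterComul k H m) f ((cons k H n).symm x))) =
      gsDual k H n m f (piRight k H n m (x ⊗ₜ y)) := fun x y => by
    induction x using cons_induction with
    | hadd x y hx hy => simp only [TensorProduct.add_tmul, map_add, hx, hy]
    | h h x => simp [piRight_eq, rainbow_iterComul_mul]
  have h2 : ∀ (x : ⨂[k]^(n + 1) H) (y : ⨂[k]^m (HDual k H)),
      rainbow (HDual.ev k H) m y (LinearMap.mul' k (⨂[k]^m H)
        (TensorProduct.map f (iterComul k H m) ((snoc k H n).symm x))) =
      gsDual k H n m f (piLeft k H n m (x ⊗ₜ y)) := fun x y => by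
    induction x using snoc_induction with
    | hadd x y hx hy => simp only [TensorProduct.add_tmul, map_add, hx, hy]
    | h x h => simp [piLeft_eq, rainbow_mul_iterComul]
  refine TensorProduct.ext' fun x y => ?_
  simp only [gsDual_tmul, gsHoch, tableD, LinearMap.coe_mk, AddHom.coe_mk, LinearMap.add_apply,
    LinearMap.smul_apply, LinearMap.comp_apply, LinearEquiv.coe_coe, map_add, map_smul, h1, h2,
    dBar, LinearMap.rTensor_tmul]
  abel

/-- The outer terms match because ⟨l, x₁ · … · xₙ⟩ = ⟨Δⁿ(l), x₁ ⋯ xₙ⟩: a product in front meets the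
last letter l and yields π^{H*}, a product behind meets the first letter and yields ^{H*}π. The
factor (-1)^{m+1} comes from the reversal in `rainbow_bar`. -/
theorem gsDual_gsCoHoch (n m : ℕ) (f : GS k H n m) :
    (-1 : k) ^ (m + 1) • gsDual k H n (m + 1) ((-1 : k) ^ n • gsCoHoch k H n m f) =
      gsDual k H n m f ∘ₗ tableD' k H 3 n m := by
  have h1 : ∀ (x : ⨂[k]^n H) (y : ⨂[k]^(m + 1) (HDual k H)),
      rainbow (HDual.ev k H) (m + 1) y (cons k H m
        (TensorProduct.map (prodAll k H n) f (split k H n x))) =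
      gsDual k H n m f (piDualLeft k H n m (x ⊗ₜ y)) := fun x y => by
    induction y using snoc_induction with
    | hadd x y hx hy => simp only [TensorProduct.tmul_add, map_add, LinearMap.add_apply, hx, hy]
    | h y l =>
      simp only [piDualLeft_eq, swapMap_tmul, lastFace_snoc, TensorProduct.comm_tmul, gsDual_tmul,
        leftAdj_apply]
      generalize split k H n x = u
      induction u with
      | zero => simp
      | add x y hx hy => simp only [TensorProduct.tmul_add, map_add, hx, hy]
      | tmul x₁ x₂ => simp [rainbow_snoc_cons, ev_isBialgebraPairing.rainbow_iterComul]
  have h2 : ∀ (x : ⨂[k]^n H) (y : ⨂[k]^(m + 1) (HDual k H)),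
      rainbow (HDual.ev k H) (m + 1) y (snoc k H m
        (TensorProduct.map f (prodAll k H n) (split k H n x))) =
      gsDual k H n m f (piDualRight k H n m (x ⊗ₜ y)) := fun x y => by
    induction y using cons_induction with
    | hadd x y hx hy => simp only [TensorProduct.tmul_add, map_add, LinearMap.add_apply, hx, hy]
    | h l y =>
      simp only [piDualRight_eq, swapMap_tmul, firstFace_cons, TensorProduct.comm_tmul,
        gsDual_tmul, rightAdj_apply]
      generalize split k H n x = u
      induction u with
      | zero => simp
      | add x y hx hy => simp only [TensorProduct.tmul_add, map_add, hx, hy]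
      | tmul x₁ x₂ => simp [rainbow_cons_snoc, ev_isBialgebraPairing.rainbow_iterComul]
  -- The cobar sum and the last term carry (-1)^{m+1} twice; the first term carries it once, as it
  -- does in d'.
  have hs : (-1 : k) ^ (m + 1) * (-1 : k) ^ (m + 1) = 1 := by rw [← mul_pow]; simp
  refine TensorProduct.ext' fun x y => ?_
  simp only [gsDual_tmul, gsCoHoch, tableD', LinearMap.coe_mk, AddHom.coe_mk, LinearMap.add_apply,
    LinearMap.smul_apply, LinearMap.comp_apply, LinearEquiv.coe_coe, map_add, map_smul, h1, h2,
    dCob, LinearMap.lTensor_tmul, ev_isBialgebraPairing.rainbow_bar, smul_eq_mul, pow_add _ n]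
  linear_combination ((-1) ^ n * (rainbow (HDual.ev k H) m (bar k (HDual k H) m y) (f x)) +
    (-1) ^ n * gsDual k H n m f (piDualRight k H n m (x ⊗ₜ y))) * hs

/-- The ratio of the triangular signs in degrees m+1 and m is the factor (-1)^{m+1} still missing in
`gsDual_gsCoHoch`; the first differential keeps m fixed and needs no correction. -/
theorem gsDual_spec : ∃ Φ : ∀ n m : ℕ, GS k H n m ≃ₗ[k] Module.Dual k (Cx k H n m),
      (∀ (n m : ℕ) (f : GS k H n m) (x : ⨂[k]^n H) (y : ⨂[k]^m (HDual k H)),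
        Φ n m f (x ⊗ₜ[k] y) =
          (-1) ^ (m * (m + 1) / 2) * rainbow (HDual.ev k H) m y (f x)) ∧
      (∀ (n m : ℕ) (f : GS k H n m),
        Φ (n + 1) m (gsHoch k H n m f) = Φ n m f ∘ₗ tableD k H 3 n m) ∧
      (∀ (n m : ℕ) (f : GS k H n m),
        Φ n (m + 1) ((-1 : k) ^ n • gsCoHoch k H n m f) = Φ n m f ∘ₗ tableD' k H 3 n m) := by
  refine ⟨fun n m => gsDual k H n m ≪≫ₗ LinearEquiv.smulOfNeZero k _ _ (triSign_ne_zero m),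
    fun n m f x y => ?_, fun n m f => ?_, fun n m f => ?_⟩
  · simp [triSign]
  · simp only [LinearEquiv.trans_apply, LinearEquiv.smulOfNeZero_apply, gsDual_gsHoch,
      LinearMap.smul_comp]
  · simp only [LinearEquiv.trans_apply, LinearEquiv.smulOfNeZero_apply, triSign_succ, mul_smul,
      gsDual_gsCoHoch, LinearMap.smul_comp]

end GerstenhaberSchack

section Bialgebra

theorem sum_repr_mul {k : Type*} [Field k] {A : Type*} [Ring A] [Bialgebra k A] {a b : A}
    {ι κ : Type*} (r : Coalgebra.Repr k a ι) (s : Coalgebra.Repr k b κ) {W : Type*}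
    [AddCommMonoid W] (f : A → A → W) :
    ∑ i ∈ (r.mul s).index, f ((r.mul s).left i) ((r.mul s).right i) =
      ∑ i ∈ r.index, ∑ j ∈ s.index, f (r.left i * s.left j) (r.right i * s.right j) :=
  Finset.sum_product _ _ _

end Bialgebra

/-! ### Actions on words with Hopf module coefficients -/

section CoefficientActions

variable {k H : Type*} [Field k] [Ring H] [Bialgebra k H]
  {M : Type*} [AddCommGroup M] [Module k M] {N : Type*} [AddCommGroup N] [Module k N]

/-- The left action `h ▹ b = ⟨b₍₋₁₎, h⟩ b₍₀₎` of `H` on a left `H*`-comodule. -/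
def comoduleLeftAct (γ : N →ₗ[k] HDual k H ⊗[k] N) : H ⊗[k] N →ₗ[k] N :=
  contractLeft (HDual.ev k H).flip N ∘ₗ γ.lTensor H

/-- The right action `a ◃ l = ⟨l, a₍₁₎⟩ a₍₀₎` of `H*` on a right `H`-comodule. -/
def comoduleRightAct (δ : M →ₗ[k] M ⊗[k] H) : M ⊗[k] HDual k H →ₗ[k] M :=
  contractLeft (HDual.ev k H) M ∘ₗ
    ((TensorProduct.comm k M H).toLinearMap ∘ₗ δ).lTensor (HDual k H) ∘ₗ
    (TensorProduct.comm k M (HDual k H)).toLinearMap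

theorem comoduleLeftAct_tmul (γ : N →ₗ[k] HDual k H ⊗[k] N) (h : H) (b : N) :
    comoduleLeftAct γ (h ⊗ₜ b) = contractLeft (HDual.ev k H).flip N (h ⊗ₜ γ b) := rfl

theorem comoduleRightAct_tmul (δ : M →ₗ[k] M ⊗[k] H) (a : M) (l : HDual k H) :
    comoduleRightAct δ (a ⊗ₜ l) =
      contractLeft (HDual.ev k H) M (l ⊗ₜ TensorProduct.comm k M H (δ a)) := rfl

theorem actFirst_cons (ρ : M ⊗[k] H →ₗ[k] M) (n : ℕ) (a : M) (h : H) (x : ⨂[k]^n H) :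
    actFirst ρ n (a ⊗ₜ cons k H n (h ⊗ₜ x)) = ρ (a ⊗ₜ h) ⊗ₜ x := by
  simp [actFirst]

/-- `l₁ ⋯ lₘ₊₁ ⊗ b ↦ l₁ ⋯ lₘ ⊗ lₘ₊₁ b`. -/
def actLast (θ : HDual k H ⊗[k] N →ₗ[k] N) (m : ℕ) :
    (⨂[k]^(m + 1) (HDual k H)) ⊗[k] N →ₗ[k] (⨂[k]^m (HDual k H)) ⊗[k] N :=
  θ.lTensor _ ∘ₗ (TensorProduct.assoc k _ _ _).toLinearMap ∘ₗ
    (snoc k (HDual k H) m).symm.toLinearMap.rTensor N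

theorem actLast_snoc (θ : HDual k H ⊗[k] N →ₗ[k] N) (m : ℕ) (y : ⨂[k]^m (HDual k H))
    (l : HDual k H) (b : N) :
    actLast θ m (snoc k (HDual k H) m (y ⊗ₜ l) ⊗ₜ b) = y ⊗ₜ θ (l ⊗ₜ b) := by
  simp [actLast]

/-- Both sides are ⟨l, a₍₂₎⟩ ⟨l', a₍₁₎⟩ a₍₀₎, by coassociativity of δ and the rainbow convention for
l l'. -/
theorem comoduleRightAct_mul {δ : M →ₗ[k] M ⊗[k] H}
    (h : ∀ a, TensorProduct.assoc k M H H (δ.rTensor H (δ a)) =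
      (Coalgebra.comul (R := k) (A := H)).lTensor M (δ a)) (a : M) (l l' : HDual k H) :
    comoduleRightAct δ (comoduleRightAct δ (a ⊗ₜ l) ⊗ₜ l') =
      comoduleRightAct δ (a ⊗ₜ (l * l')) := by
  let c : HDual k H → M ⊗[k] H →ₗ[k] M := fun l =>
    (TensorProduct.rid k M).toLinearMap ∘ₗ (HDual.ev k H l).lTensor M
  have hc : ∀ l a, comoduleRightAct δ (a ⊗ₜ l) = c l (δ a) := fun l a => by
    rw [comoduleRightAct_tmul]
    generalize δ a = t
    induction t with
    | zero => simp
    | add x y hx hy => simp only [TensorProduct.tmul_add, map_add, hx, hy]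
    | tmul a x => simp [c]
  have h1 : ∀ t : M ⊗[k] H, δ (c l t) =
      (TensorProduct.rid k _).toLinearMap ((HDual.ev k H l).lTensor (M ⊗[k] H)
        (δ.rTensor H t)) := fun t => by
    induction t with
    | zero => simp
    | add x y hx hy => simp only [map_add, hx, hy]
    | tmul a x => simp [c]
  have h2 := (TensorProduct.assoc k M H H).eq_symm_apply.mpr (h a)
  rw [hc, hc, hc, h1, h2]
  generalize δ a = t
  induction t with
  | zero => simp
  | add x y hx hy => simp only [map_add, hx, hy]
  | tmul a x =>
    have r := Coalgebra.Repr.arbitrary k x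
    simp [c, TensorProduct.tmul_sum, ← r.eq, HDual.ev_mul_repr l l' r, smul_smul]

theorem coefPiDualLeft_eq (θ : HDual k H ⊗[k] N →ₗ[k] N) (n m : ℕ) :
    coefPiDualLeft (M := M) θ n m = (actLast θ m).lTensor _ := rfl

variable [Module.Finite k H]

/-- The left action of `H` on `(H*)ᵐ ⊗ N`. -/
def coefLeftAct (γ : N →ₗ[k] HDual k H ⊗[k] N) (m : ℕ) :
    H ⊗[k] ((⨂[k]^m (HDual k H)) ⊗[k] N) →ₗ[k] (⨂[k]^m (HDual k H)) ⊗[k] N :=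
  contractLeft (rainbow (HDual.ev k H).flip (m + 1)) _ ∘ₗ
      TensorProduct.map (iterComul k H (m + 1)) (splitRight γ m)

/-- The right action of `H*` on `M ⊗ Hⁿ`. -/
def coefRightAct (δ : M →ₗ[k] M ⊗[k] H) (n : ℕ) :
    (M ⊗[k] (⨂[k]^n H)) ⊗[k] HDual k H →ₗ[k] M ⊗[k] (⨂[k]^n H) :=
  contractLeft (rainbow (HDual.ev k H) (n + 1)) _ ∘ₗ
      TensorProduct.map (iterComul k (HDual k H) (n + 1))
        ((TensorProduct.comm k _ _).toLinearMap ∘ₗ splitLeft δ n) ∘ₗ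
      (TensorProduct.comm k (M ⊗[k] (⨂[k]^n H)) (HDual k H)).toLinearMap

theorem coefLeftAct_tmul (γ : N →ₗ[k] HDual k H ⊗[k] N) (m : ℕ) (h : H)
    (y : ⨂[k]^m (HDual k H)) (b : N) :
    coefLeftAct γ m (h ⊗ₜ (y ⊗ₜ b)) = contractLeft (rainbow (HDual.ev k H).flip (m + 1)) _
      (iterComul k H (m + 1) h ⊗ₜ (snoc k (HDual k H) m).toLinearMap.rTensor _
        (TensorProduct.tensorTensorTensorComm k _ _ _ _ (split k (HDual k H) m y ⊗ₜ γ b))) := rfl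

theorem coefRightAct_tmul (δ : M →ₗ[k] M ⊗[k] H) (n : ℕ) (a : M) (x : ⨂[k]^n H)
    (l : HDual k H) :
    coefRightAct δ n ((a ⊗ₜ x) ⊗ₜ l) = contractLeft (rainbow (HDual.ev k H) (n + 1)) _
      (iterComul k (HDual k H) (n + 1) l ⊗ₜ TensorProduct.comm k _ _
        ((cons k H n).toLinearMap.lTensor _
          (TensorProduct.tensorTensorTensorComm k _ _ _ _ (δ a ⊗ₜ split k H n x)))) := rfl

/-- The element b₍₋₁₎ is the last letter of the extended word and so meets the first component of h.
Hence the action is a tensor product of two actions, with h₍₁₎ acting on N and h₍₂₎ on the word. -/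
theorem coefLeftAct_repr (γ : N →ₗ[k] HDual k H ⊗[k] N) (m : ℕ) {h : H}
    (y : ⨂[k]^m (HDual k H)) (b : N) {ι : Type*} (r : Coalgebra.Repr k h ι) :
    coefLeftAct γ m (h ⊗ₜ (y ⊗ₜ b)) = ∑ i ∈ r.index,
      leftAdj (HDual.ev k H).flip m (r.right i ⊗ₜ y) ⊗ₜ comoduleLeftAct γ (r.left i ⊗ₜ b) := by
  simp only [coefLeftAct_tmul, leftAdj_apply, comoduleLeftAct_tmul, iterComul_succ_repr _ _ r]
  generalize γ b = t
  generalize split k (HDual k H) m y = u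
  induction t with
  | zero => simp
  | add x y hx hy =>
    simp only [TensorProduct.tmul_add, map_add, hx, hy, Finset.sum_add_distrib]
  | tmul b₁ b₂ =>
    induction u with
    | zero => simp
    | add x y hx hy =>
      simp only [TensorProduct.add_tmul, TensorProduct.tmul_add, map_add, hx, hy,
        Finset.sum_add_distrib]
    | tmul y₁ y₂ =>
      simp [TensorProduct.sum_tmul, rainbow_cons_snoc]
      simp only [← TensorProduct.smul_tmul', smul_smul]

theorem coefRightAct_repr (δ : M →ₗ[k] M ⊗[k] H) (n : ℕ) (a : M) (x : ⨂[k]^n H)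
    {l : HDual k H} {ι : Type*} (r : Coalgebra.Repr k l ι) :
    coefRightAct δ n ((a ⊗ₜ x) ⊗ₜ l) = ∑ i ∈ r.index,
      comoduleRightAct δ (a ⊗ₜ r.right i) ⊗ₜ rightAdj (HDual.ev k H) n (x ⊗ₜ r.left i) := by
  simp only [coefRightAct_tmul, rightAdj_apply, comoduleRightAct_tmul,
    iterComul_succ_repr' _ _ r]
  generalize δ a = t
  generalize split k H n x = u
  induction t with
  | zero => simp
  | add x y hx hy =>
    simp only [TensorProduct.add_tmul, TensorProduct.tmul_add, map_add, hx, hy,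
      Finset.sum_add_distrib]
  | tmul b₁ b₂ =>
    induction u with
    | zero => simp
    | add x y hx hy =>
      simp only [TensorProduct.tmul_add, map_add, hx, hy, Finset.sum_add_distrib]
    | tmul y₁ y₂ =>
      simp [TensorProduct.sum_tmul, rainbow_snoc_cons]
      simp only [← TensorProduct.smul_tmul', smul_smul, mul_comm]

/-- The outermost arc pairs l₍₁₎ with h₍₂₎. Together with `coefLeftAct_cons` this exhibits the
scalar common to the two composites of π^H and ^{H*}π. -/
theorem coefRightAct_snoc (δ : M →ₗ[k] M ⊗[k] H) (n : ℕ) (a : M) (x : ⨂[k]^n H) {h : H}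
    {l : HDual k H} {ι κ : Type*} (r : Coalgebra.Repr k l ι) (s : Coalgebra.Repr k h κ) :
    coefRightAct δ (n + 1) ((a ⊗ₜ snoc k H n (x ⊗ₜ h)) ⊗ₜ l) = ∑ i ∈ r.index, ∑ j ∈ s.index,
      HDual.ev k H (r.left i) (s.right j) •
        ((snoc k H n).toLinearMap ∘ₗ (TensorProduct.mk k _ _).flip (s.left j)).lTensor M
          (coefRightAct δ n ((a ⊗ₜ x) ⊗ₜ r.right i)) := by
  simp only [coefRightAct_tmul, split_snoc_repr _ _ s, iterComul_succ_repr (n + 1) _ r]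
  generalize δ a = t
  generalize split k H n x = u
  induction t with
  | zero => simp
  | add x y hx hy =>
    simp only [TensorProduct.add_tmul, TensorProduct.tmul_add, map_add, hx, hy, smul_add,
      Finset.sum_add_distrib]
  | tmul b₁ b₂ =>
    induction u with
    | zero => simp
    | add x y hx hy =>
      simp only [TensorProduct.tmul_add, map_add, hx, hy, smul_add, Finset.sum_add_distrib]
    | tmul y₁ y₂ =>
      simp [TensorProduct.sum_tmul, TensorProduct.tmul_sum, cons_snoc, rainbow_cons_snoc, mul_smul]
      exact Finset.sum_comm

theorem coefLeftAct_cons (γ : N →ₗ[k] HDual k H ⊗[k] N) (m : ℕ) {h : H} {l : HDual k H}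
    (y : ⨂[k]^m (HDual k H)) (b : N) {ι κ : Type*} (r : Coalgebra.Repr k h ι)
    (s : Coalgebra.Repr k l κ) :
    coefLeftAct γ (m + 1) (h ⊗ₜ (cons k _ m (l ⊗ₜ y) ⊗ₜ b)) =
      ∑ i ∈ r.index, ∑ j ∈ s.index, HDual.ev k H (s.left j) (r.right i) •
        ((cons k _ m).toLinearMap ∘ₗ TensorProduct.mk k _ _ (s.right j)).rTensor N
          (coefLeftAct γ m (r.left i ⊗ₜ (y ⊗ₜ b))) := by
  simp only [coefLeftAct_tmul, split_cons_repr _ _ s, iterComul_succ_repr' (m + 1) _ r]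
  generalize γ b = t
  generalize split k (HDual k H) m y = u
  induction t with
  | zero => simp
  | add x y hx hy =>
    simp only [TensorProduct.tmul_add, map_add, hx, hy, smul_add, Finset.sum_add_distrib]
  | tmul b₁ b₂ =>
    induction u with
    | zero => simp
    | add x y hx hy =>
      simp only [TensorProduct.add_tmul, TensorProduct.tmul_add, map_add, hx, hy, smul_add,
        Finset.sum_add_distrib]
    | tmul y₁ y₂ =>
      simp [TensorProduct.sum_tmul, TensorProduct.tmul_sum, ← cons_snoc, rainbow_snoc_cons,
        mul_smul]
      exact Finset.sum_comm

/-- Here the Hopf compatibility of M enters. Since δ(ah) = a₍₀₎h₍₁₎ ⊗ a₍₁₎h₍₂₎, pairing an iterated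
coproduct of l with a word beginning with a₍₁₎h₍₂₎ is the same as pairing the next one with a₍₁₎ and
h₍₂₎ as separate letters. -/
theorem coefRightAct_act {ρ : M ⊗[k] H →ₗ[k] M} {δ : M →ₗ[k] M ⊗[k] H}
    (hM : IsRightHopfModule ρ δ) (n : ℕ) (a : M) (h : H) (x : ⨂[k]^n H) (l : HDual k H) :
    coefRightAct δ n ((ρ (a ⊗ₜ h) ⊗ₜ x) ⊗ₜ l) =
      actFirst ρ n (coefRightAct δ (n + 1) ((a ⊗ₜ cons k H n (h ⊗ₜ x)) ⊗ₜ l)) := by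
  have s := Coalgebra.Repr.arbitrary k h
  have hc : δ (ρ (a ⊗ₜ h)) = TensorProduct.map ρ (LinearMap.mul' k H)
      (TensorProduct.tensorTensorTensorComm k M H H H (δ a ⊗ₜ Coalgebra.comul h)) :=
    LinearMap.congr_fun hM.compat (a ⊗ₜ h)
  -- Merging two letters is transposed to splitting a factor, and splitting any factor of the
  -- iterated coproduct gives the next iterated coproduct.
  have key : ∀ (u v : H) (z : ⨂[k]^n H),
      rainbow (HDual.ev k H) (n + 1) (iterComul k _ (n + 1) l) (cons k H n ((u * v) ⊗ₜ z)) =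
      rainbow (HDual.ev k H) (n + 2) (iterComul k _ (n + 2) l)
        (cons k H (n + 1) (u ⊗ₜ cons k H n (v ⊗ₜ z))) := fun u v z => by
    rw [← mulAt_zero, ev_isBialgebraPairing.rainbow_mulAt, comulAt_iterComul]
  simp only [coefRightAct_tmul, split_cons_repr _ _ s, hc, ← s.eq]
  generalize δ a = t
  generalize split k H n x = u
  induction t with
  | zero => simp
  | add x y hx hy => simp only [TensorProduct.add_tmul, TensorProduct.tmul_add, map_add, hx, hy]
  | tmul a₁ a₂ =>
    induction u with
    | zero => simp
    | add x y hx hy =>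
      simp only [TensorProduct.tmul_add, map_add, Finset.sum_add_distrib, hx, hy]
    | tmul y₁ y₂ => simp [key, actFirst_cons, TensorProduct.sum_tmul, TensorProduct.tmul_sum]

/-- The counterpart of `coefRightAct_act` at the other end, from the Hopf compatibility of N. -/
theorem coefLeftAct_act {θ : HDual k H ⊗[k] N →ₗ[k] N} {γ : N →ₗ[k] HDual k H ⊗[k] N}
    (hN : IsLeftHopfModule θ γ) (m : ℕ) (h : H) (y : ⨂[k]^m (HDual k H)) (l : HDual k H) (b : N) :
    coefLeftAct γ m (h ⊗ₜ (y ⊗ₜ θ (l ⊗ₜ b))) =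
      actLast θ m (coefLeftAct γ (m + 1) (h ⊗ₜ (snoc k _ m (y ⊗ₜ l) ⊗ₜ b))) := by
  have s := Coalgebra.Repr.arbitrary k l
  have hc : γ (θ (l ⊗ₜ b)) = TensorProduct.map (LinearMap.mul' k (HDual k H)) θ
      (TensorProduct.tensorTensorTensorComm k _ _ _ _ (Coalgebra.comul l ⊗ₜ γ b)) :=
    LinearMap.congr_fun hN.compat (l ⊗ₜ b)
  have key : ∀ (u v : HDual k H) (z : ⨂[k]^m (HDual k H)),
      rainbow (HDual.ev k H).flip (m + 1) (iterComul k _ (m + 1) h)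
        (snoc k _ m (z ⊗ₜ (u * v))) =
      rainbow (HDual.ev k H).flip (m + 2) (iterComul k _ (m + 2) h)
        (snoc k _ (m + 1) (snoc k _ m (z ⊗ₜ u) ⊗ₜ v)) := fun u v z => by
    rw [← mulAt_last, ev_isBialgebraPairing.flip.rainbow_mulAt, comulAt_iterComul]
  simp only [coefLeftAct_tmul, split_snoc_repr _ _ s, hc, ← s.eq]
  generalize γ b = t
  generalize split k _ m y = u
  induction t with
  | zero => simp
  | add x y hx hy => simp only [TensorProduct.tmul_add, map_add, hx, hy]
  | tmul a₁ a₂ =>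
    induction u with
    | zero => simp
    | add x y hx hy =>
      simp only [TensorProduct.add_tmul, TensorProduct.tmul_add, map_add, Finset.sum_add_distrib,
        hx, hy]
    | tmul y₁ y₂ => simp [key, actLast_snoc, TensorProduct.sum_tmul, TensorProduct.tmul_sum]

theorem comoduleLeftAct_one {γ : N →ₗ[k] HDual k H ⊗[k] N}
    (h : ∀ b, TensorProduct.lid k N
      ((Coalgebra.counit (R := k) (A := HDual k H)).rTensor N (γ b)) = b) (b : N) :
    comoduleLeftAct γ (1 ⊗ₜ b) = b := by
  rw [comoduleLeftAct_tmul]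
  conv_rhs => rw [← h b]
  generalize γ b = t
  induction t with
  | zero => simp
  | add x y hx hy => simp only [TensorProduct.tmul_add, map_add, hx, hy]
  | tmul l b => simp [HDual.counit_apply]

/-- Coassociativity of γ produces l₍₁₎ paired with y and l₍₂₎ paired with x, and these combine to
⟨l, xy⟩. -/
theorem comoduleLeftAct_mul {γ : N →ₗ[k] HDual k H ⊗[k] N}
    (h : ∀ b, TensorProduct.assoc k _ _ N
      ((Coalgebra.comul (R := k) (A := HDual k H)).rTensor N (γ b)) = γ.lTensor _ (γ b))
    (x y : H) (b : N) :
    comoduleLeftAct γ (x ⊗ₜ comoduleLeftAct γ (y ⊗ₜ b)) = comoduleLeftAct γ ((x * y) ⊗ₜ b) := by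
  have h1 : ∀ t : HDual k H ⊗[k] N,
      comoduleLeftAct γ (x ⊗ₜ contractLeft (HDual.ev k H).flip N (y ⊗ₜ t)) =
      contractLeft (HDual.ev k H).flip N (x ⊗ₜ
        contractLeft (HDual.ev k H).flip _ (y ⊗ₜ γ.lTensor _ t)) := fun t => by
    induction t with
    | zero => simp
    | add x y hx hy => simp only [TensorProduct.tmul_add, map_add, hx, hy]
    | tmul l b => simp [comoduleLeftAct_tmul]
  rw [comoduleLeftAct_tmul γ y, h1, ← h, comoduleLeftAct_tmul]
  generalize γ b = t
  induction t with
  | zero => simp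
  | add x y hx hy => simp only [TensorProduct.tmul_add, map_add, hx, hy]
  | tmul l b =>
    have r := Coalgebra.Repr.arbitrary k l
    simp [TensorProduct.sum_tmul, TensorProduct.tmul_sum, ← r.eq,
      ev_isBialgebraPairing.mul_right_repr _ _ r, Finset.sum_smul, smul_smul, mul_comm]

/-- Both tensor factors carry actions and Δ is multiplicative, so the tensor product action is one
as well. -/
theorem coefLeftAct_mul {γ : N →ₗ[k] HDual k H ⊗[k] N}
    (hγ : ∀ b, TensorProduct.assoc k _ _ N
      ((Coalgebra.comul (R := k) (A := HDual k H)).rTensor N (γ b)) = γ.lTensor _ (γ b))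
    (m : ℕ) (h h' : H) (w : (⨂[k]^m (HDual k H)) ⊗[k] N) :
    coefLeftAct γ m (h ⊗ₜ coefLeftAct γ m (h' ⊗ₜ w)) = coefLeftAct γ m ((h * h') ⊗ₜ w) := by
  induction w with
  | zero => simp
  | add x y hx hy => simp only [TensorProduct.tmul_add, map_add, hx, hy]
  | tmul y b =>
    have r := Coalgebra.Repr.arbitrary k h
    have s := Coalgebra.Repr.arbitrary k h'
    rw [coefLeftAct_repr _ _ _ _ s, coefLeftAct_repr _ _ _ _ (r.mul s)]
    simp only [TensorProduct.tmul_sum, map_sum, coefLeftAct_repr _ _ _ _ r,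
      comoduleLeftAct_mul hγ, ev_isBialgebraPairing.flip.leftAdj_leftAdj]
    rw [Finset.sum_comm]
    exact (sum_repr_mul r s fun u v =>
      leftAdj (HDual.ev k H).flip m (v ⊗ₜ y) ⊗ₜ comoduleLeftAct γ (u ⊗ₜ b)).symm

theorem coefRightAct_mul {δ : M →ₗ[k] M ⊗[k] H}
    (hδ : ∀ a, TensorProduct.assoc k M H H (δ.rTensor H (δ a)) =
      (Coalgebra.comul (R := k) (A := H)).lTensor M (δ a))
    (n : ℕ) (l l' : HDual k H) (x : M ⊗[k] (⨂[k]^n H)) :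
    coefRightAct δ n (coefRightAct δ n (x ⊗ₜ l) ⊗ₜ l') = coefRightAct δ n (x ⊗ₜ (l * l')) := by
  induction x with
  | zero => simp
  | add x y hx hy => simp only [TensorProduct.add_tmul, map_add, hx, hy]
  | tmul a x =>
    have r := Coalgebra.Repr.arbitrary k l
    have s := Coalgebra.Repr.arbitrary k l'
    rw [coefRightAct_repr _ _ _ _ r, coefRightAct_repr _ _ _ _ (r.mul s)]
    simp only [TensorProduct.sum_tmul, map_sum, coefRightAct_repr _ _ _ _ s,
      comoduleRightAct_mul hδ, ev_isBialgebraPairing.rightAdj_rightAdj]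
    exact (sum_repr_mul r s fun u v =>
      comoduleRightAct δ (a ⊗ₜ v) ⊗ₜ rightAdj (HDual.ev k H) n (x ⊗ₜ u)).symm

theorem coefLeftAct_bar (γ : N →ₗ[k] HDual k H ⊗[k] N) (m : ℕ) (h : H)
    (w : (⨂[k]^(m + 1) (HDual k H)) ⊗[k] N) :
    coefLeftAct γ m (h ⊗ₜ (bar k _ m).rTensor N w) =
      (bar k _ m).rTensor N (coefLeftAct γ (m + 1) (h ⊗ₜ w)) := by
  induction w with
  | zero => simp
  | add x y hx hy => simp only [TensorProduct.tmul_add, map_add, hx, hy]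
  | tmul y b =>
    have r := Coalgebra.Repr.arbitrary k h
    simp only [LinearMap.rTensor_tmul, coefLeftAct_repr _ _ _ _ r, map_sum,
      ev_isBialgebraPairing.flip.bar_leftAdj]

theorem coefRightAct_bar (δ : M →ₗ[k] M ⊗[k] H) (n : ℕ) (l : HDual k H)
    (x : M ⊗[k] (⨂[k]^(n + 1) H)) :
    coefRightAct δ n ((bar k _ n).lTensor M x ⊗ₜ l) =
      (bar k _ n).lTensor M (coefRightAct δ (n + 1) (x ⊗ₜ l)) := by
  induction x with
  | zero => simp
  | add x y hx hy => simp only [TensorProduct.add_tmul, map_add, hx, hy]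
  | tmul a x =>
    have r := Coalgebra.Repr.arbitrary k l
    simp only [LinearMap.lTensor_tmul, coefRightAct_repr _ _ _ _ r, map_sum,
      ev_isBialgebraPairing.bar_rightAdj]

theorem coefPiLeft_snoc (γ : N →ₗ[k] HDual k H ⊗[k] N) (n m : ℕ) (a : M) (x : ⨂[k]^n H) (h : H)
    (w : (⨂[k]^m (HDual k H)) ⊗[k] N) :
    coefPiLeft γ n m ((a ⊗ₜ snoc k H n (x ⊗ₜ h)) ⊗ₜ w) =
      (a ⊗ₜ x) ⊗ₜ coefLeftAct γ m (h ⊗ₜ w) := by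
  simp [coefPiLeft, coefLeftAct]

theorem coefPiDualRight_cons (δ : M →ₗ[k] M ⊗[k] H) (n m : ℕ) (x : M ⊗[k] (⨂[k]^n H))
    (l : HDual k H) (y : ⨂[k]^m (HDual k H)) (b : N) :
    coefPiDualRight δ n m (x ⊗ₜ (cons k _ m (l ⊗ₜ y) ⊗ₜ b)) =
      coefRightAct δ n (x ⊗ₜ l) ⊗ₜ (y ⊗ₜ b) := by
  simp [coefPiDualRight, coefRightAct]

end CoefficientActions

/-! ### Bimodules whose two actions live on different tensor factors -/

section TensorCoefficients

variable {k : Type*} [Field k] {A W M : Type*} [AddCommGroup A] [Module k A]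
  [AddCommGroup W] [Module k W] [AddCommGroup M] [Module k M]

/-- The left action on `W ⊗ M` through the first factor. -/
def tensorLeftAct (M : Type*) [AddCommGroup M] [Module k M] (ℓ : A ⊗[k] W →ₗ[k] W) :
    A ⊗[k] (W ⊗[k] M) →ₗ[k] W ⊗[k] M :=
  ℓ.rTensor M ∘ₗ (TensorProduct.assoc k A W M).symm.toLinearMap

/-- The right action on `W ⊗ M` through the second factor. -/
def tensorRightAct (W : Type*) [AddCommGroup W] [Module k W] (r : M ⊗[k] A →ₗ[k] M) :
    (W ⊗[k] M) ⊗[k] A →ₗ[k] W ⊗[k] M :=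
  r.lTensor W ∘ₗ (TensorProduct.assoc k W M A).toLinearMap

@[simp]
theorem tensorLeftAct_tmul (ℓ : A ⊗[k] W →ₗ[k] W) (a : A) (w : W) (b : M) :
    tensorLeftAct M ℓ (a ⊗ₜ (w ⊗ₜ b)) = ℓ (a ⊗ₜ w) ⊗ₜ b := rfl

@[simp]
theorem tensorRightAct_tmul (r : M ⊗[k] A →ₗ[k] M) (w : W) (b : M) (a : A) :
    tensorRightAct W r ((w ⊗ₜ b) ⊗ₜ a) = w ⊗ₜ r (b ⊗ₜ a) := rfl

end TensorCoefficients

section BimoduleTensor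

variable {k : Type*} [Field k] {A : Type*} [Ring A] [Algebra k A] {W M : Type*}
  [AddCommGroup W] [Module k W] [AddCommGroup M] [Module k M]

theorem isNonunitalBimodule_tensor {ℓ : A ⊗[k] W →ₗ[k] W} {r : M ⊗[k] A →ₗ[k] M}
    (hℓ : ∀ a b w, ℓ (a ⊗ₜ ℓ (b ⊗ₜ w)) = ℓ ((a * b) ⊗ₜ w))
    (hr : ∀ w a b, r (r (w ⊗ₜ a) ⊗ₜ b) = r (w ⊗ₜ (a * b))) :
    IsNonunitalBimodule (tensorLeftAct M ℓ) (tensorRightAct W r) := by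
  refine ⟨fun a b w => ?_, fun w a b => ?_, fun a w b => ?_⟩
  · induction w with
    | zero => simp
    | add x y hx hy => simp only [TensorProduct.tmul_add, map_add, hx, hy]
    | tmul w c => simp [hℓ]
  · induction w with
    | zero => simp
    | add x y hx hy => simp only [TensorProduct.add_tmul, map_add, hx, hy]
    | tmul w c => simp [hr]
  · induction w with
    | zero => simp
    | add x y hx hy => simp only [TensorProduct.add_tmul, TensorProduct.tmul_add, map_add, hx, hy]
    | tmul w c => simp

end BimoduleTensor

/-! ### The bicomplex with Hopf module coefficients -/

section CoefficientBicomplex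

variable {k H : Type*} [Field k] [Ring H] [Bialgebra k H]
  {M : Type*} [AddCommGroup M] [Module k M] {N : Type*} [AddCommGroup N] [Module k N]

theorem coef_ext {Z : Type*} [AddCommGroup Z] [Module k Z] {n m : ℕ}
    {f g : CoefCx k H M N n m →ₗ[k] Z}
    (h : ∀ a x y b, f ((a ⊗ₜ x) ⊗ₜ (y ⊗ₜ b)) = g ((a ⊗ₜ x) ⊗ₜ (y ⊗ₜ b))) : f = g :=
  TensorProduct.ext_fourfold' h

variable [Module.Finite k H]

/-- `(a ⊗ x) ⊗ w ↦ x ⊗ (w ⊗ a)`. -/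
def moveLeftCoef (M X L : Type*) [AddCommGroup M] [Module k M] [AddCommGroup X] [Module k X]
    [AddCommGroup L] [Module k L] : (M ⊗[k] X) ⊗[k] L ≃ₗ[k] X ⊗[k] (L ⊗[k] M) :=
  TensorProduct.congr (TensorProduct.comm k M X) (LinearEquiv.refl k L) ≪≫ₗ
    TensorProduct.assoc k X M L ≪≫ₗ
    TensorProduct.congr (LinearEquiv.refl k X) (TensorProduct.comm k M L)

@[simp]
theorem moveLeftCoef_tmul {M X L : Type*} [AddCommGroup M] [Module k M] [AddCommGroup X]
    [Module k X] [AddCommGroup L] [Module k L] (a : M) (x : X) (w : L) :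
    moveLeftCoef (k := k) M X L ((a ⊗ₜ x) ⊗ₜ w) = x ⊗ₜ (w ⊗ₜ a) := by
  simp [moveLeftCoef]

/-- `x ⊗ (y ⊗ b) ↦ y ⊗ (b ⊗ x)`. -/
def moveRightCoef (X Y N : Type*) [AddCommGroup X] [Module k X] [AddCommGroup Y] [Module k Y]
    [AddCommGroup N] [Module k N] : X ⊗[k] (Y ⊗[k] N) ≃ₗ[k] Y ⊗[k] (N ⊗[k] X) :=
  TensorProduct.comm k X (Y ⊗[k] N) ≪≫ₗ TensorProduct.assoc k Y N X

@[simp]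
theorem moveRightCoef_tmul {X Y N : Type*} [AddCommGroup X] [Module k X] [AddCommGroup Y]
    [Module k Y] [AddCommGroup N] [Module k N] (x : X) (y : Y) (b : N) :
    moveRightCoef (k := k) X Y N (x ⊗ₜ (y ⊗ₜ b)) = y ⊗ₜ (b ⊗ₜ x) := by
  simp [moveRightCoef]

/-- The differential `d'` without the global sign `(-1)^n`. -/
def unsignedCoefD' (δ : M →ₗ[k] M ⊗[k] H) (θ : HDual k H ⊗[k] N →ₗ[k] N) (n m : ℕ) :
    CoefCx k H M N n (m + 1) →ₗ[k] CoefCx k H M N n m :=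
  ((bar k (HDual k H) m).rTensor N).lTensor _ + (-1 : k) ^ (m + 1) • coefPiDualLeft θ n m +
    coefPiDualRight δ n m

theorem coefD'_eq (δ : M →ₗ[k] M ⊗[k] H) (θ : HDual k H ⊗[k] N →ₗ[k] N) (n m : ℕ) :
    coefD' δ θ n m = (-1 : k) ^ n • unsignedCoefD' δ θ n m := by
  simp only [coefD', unsignedCoefD', pow_add _ n]
  module

/-- Moving M behind the other coefficients exhibits d as the Hochschild boundary of H in (H*)ᵐ ⊗ N ⊗
M, with left action on the first two factors and right action on M. -/
theorem moveLeftCoef_coefD (ρ : M ⊗[k] H →ₗ[k] M) (γ : N →ₗ[k] HDual k H ⊗[k] N) (n m : ℕ)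
    (z : CoefCx k H M N (n + 1) m) :
    moveLeftCoef _ _ _ (coefD ρ γ n m z) =
      hoch (tensorLeftAct M (coefLeftAct γ m))
        (tensorRightAct _ ρ) n
        (moveLeftCoef _ _ _ z) := by
  have h1 : ∀ (a : M) (x : ⨂[k]^(n + 1) H) (w : (⨂[k]^m (HDual k H)) ⊗[k] N),
      moveLeftCoef _ _ _ (coefPiLeft γ n m ((a ⊗ₜ x) ⊗ₜ w)) =
      lastFace (tensorLeftAct M (coefLeftAct γ m)) n
        (x ⊗ₜ (w ⊗ₜ a)) := fun a x w => by
    induction x using snoc_induction with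
    | hadd x y hx hy => simp only [TensorProduct.tmul_add, TensorProduct.add_tmul, map_add, hx, hy]
    | h x h => simp [coefPiLeft_snoc]
  have h2 : ∀ (a : M) (x : ⨂[k]^(n + 1) H) (w : (⨂[k]^m (HDual k H)) ⊗[k] N),
      moveLeftCoef _ _ _ (coefPiRight ρ n m ((a ⊗ₜ x) ⊗ₜ w)) =
      firstFace (tensorRightAct _ ρ) n
        (x ⊗ₜ (w ⊗ₜ a)) := fun a x w => by
    induction x using cons_induction with
    | hadd x y hx hy => simp only [TensorProduct.tmul_add, TensorProduct.add_tmul, map_add, hx, hy]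
    | h h x => simp [coefPiRight, actFirst_cons]
  induction z using TensorProduct.induction_on with
  | zero => simp only [map_zero]
  | add x y hx hy => simp only [map_add, hx, hy]
  | tmul x w =>
    induction x with
    | zero => simp only [TensorProduct.zero_tmul, map_zero]
    | add x y hx hy => simp only [TensorProduct.add_tmul, map_add, hx, hy]
    | tmul a x =>
      simp only [coefD, hoch, LinearMap.add_apply, LinearMap.smul_apply, map_add, map_smul, h1, h2,
        LinearMap.rTensor_tmul, LinearMap.lTensor_tmul, moveLeftCoef_tmul]

/-- Read cyclically, d' is, up to (-1)ⁿ, the Hochschild boundary of H* in N ⊗ (M ⊗ Hⁿ), with left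
action on N and right action on M ⊗ Hⁿ. -/
theorem moveRightCoef_coefD' (δ : M →ₗ[k] M ⊗[k] H) (θ : HDual k H ⊗[k] N →ₗ[k] N) (n m : ℕ)
    (z : CoefCx k H M N n (m + 1)) :
    moveRightCoef _ _ _ (unsignedCoefD' δ θ n m z) =
      hoch (tensorLeftAct _ θ)
        (tensorRightAct N (coefRightAct δ n)) m
        (moveRightCoef _ _ _ z) := by
  have h1 : ∀ (x : M ⊗[k] (⨂[k]^n H)) (y : ⨂[k]^(m + 1) (HDual k H)) (b : N),
      moveRightCoef _ _ _ (coefPiDualLeft θ n m (x ⊗ₜ (y ⊗ₜ b))) =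
      lastFace (tensorLeftAct _ θ) m
        (y ⊗ₜ (b ⊗ₜ x)) := fun x y b => by
    induction y using snoc_induction with
    | hadd x y hx hy => simp only [TensorProduct.tmul_add, TensorProduct.add_tmul, map_add, hx, hy]
    | h y l => simp [coefPiDualLeft_eq, actLast_snoc]
  have h2 : ∀ (x : M ⊗[k] (⨂[k]^n H)) (y : ⨂[k]^(m + 1) (HDual k H)) (b : N),
      moveRightCoef _ _ _ (coefPiDualRight δ n m (x ⊗ₜ (y ⊗ₜ b))) =
      firstFace (tensorRightAct N (coefRightAct δ n)) m
        (y ⊗ₜ (b ⊗ₜ x)) := fun x y b => by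
    induction y using cons_induction with
    | hadd x y hx hy => simp only [TensorProduct.tmul_add, TensorProduct.add_tmul, map_add, hx, hy]
    | h l y => simp [coefPiDualRight_cons]
  induction z using TensorProduct.induction_on with
  | zero => simp only [map_zero]
  | add x y hx hy => simp only [map_add, hx, hy]
  | tmul x w =>
    induction w with
    | zero => simp only [TensorProduct.tmul_zero, map_zero]
    | add x y hx hy => simp only [TensorProduct.tmul_add, map_add, hx, hy]
    | tmul y b =>
      simp only [unsignedCoefD', hoch, LinearMap.add_apply, LinearMap.smul_apply, map_add,
        map_smul, h1, h2, LinearMap.rTensor_tmul, LinearMap.lTensor_tmul, moveRightCoef_tmul]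

theorem coefD_comp_coefD {ρ : M ⊗[k] H →ₗ[k] M} {δ : M →ₗ[k] M ⊗[k] H}
    {θ : HDual k H ⊗[k] N →ₗ[k] N} {γ : N →ₗ[k] HDual k H ⊗[k] N}
    (hM : IsRightHopfModule ρ δ) (hN : IsLeftHopfModule θ γ) (n m : ℕ) :
    coefD ρ γ n m ∘ₗ coefD ρ γ (n + 1) m = 0 := by
  refine LinearMap.ext fun z => (moveLeftCoef _ _ _).injective ?_
  rw [LinearMap.comp_apply, moveLeftCoef_coefD, moveLeftCoef_coefD, ← LinearMap.comp_apply,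
    hoch_comp_hoch (isNonunitalBimodule_tensor (coefLeftAct_mul hN.coact_comul m) hM.act_mul),
    LinearMap.zero_apply, LinearMap.zero_apply, map_zero]

theorem unsignedCoefD'_comp {ρ : M ⊗[k] H →ₗ[k] M} {δ : M →ₗ[k] M ⊗[k] H}
    {θ : HDual k H ⊗[k] N →ₗ[k] N} {γ : N →ₗ[k] HDual k H ⊗[k] N}
    (hM : IsRightHopfModule ρ δ) (hN : IsLeftHopfModule θ γ) (n m : ℕ) :
    unsignedCoefD' δ θ n m ∘ₗ unsignedCoefD' δ θ n (m + 1) = 0 := by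
  refine LinearMap.ext fun z => (moveRightCoef _ _ _).injective ?_
  rw [LinearMap.comp_apply, moveRightCoef_coefD', moveRightCoef_coefD', ← LinearMap.comp_apply,
    hoch_comp_hoch (isNonunitalBimodule_tensor hN.act_mul
      fun w l l' => coefRightAct_mul hM.coact_comul n l l' w),
    LinearMap.zero_apply, LinearMap.zero_apply, map_zero]

/-- Operators on different tensor factors of the coefficient complex commute. -/
theorem rTensor_comm_lTensor {X X' Y Y' : Type*} [AddCommGroup X] [Module k X] [AddCommGroup X']
    [Module k X'] [AddCommGroup Y] [Module k Y] [AddCommGroup Y'] [Module k Y']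
    (f : X →ₗ[k] X') (g : Y →ₗ[k] Y') (z : X ⊗[k] Y) :
    f.rTensor Y' (g.lTensor X z) = g.lTensor X' (f.rTensor Y z) := by
  rw [← LinearMap.comp_apply, ← LinearMap.comp_apply, LinearMap.rTensor_comp_lTensor,
    LinearMap.lTensor_comp_rTensor]

theorem coefPiLeft_comm_bar (γ : N →ₗ[k] HDual k H ⊗[k] N) (n m : ℕ)
    (z : CoefCx k H M N (n + 1) (m + 1)) :
    coefPiLeft γ n m (((bar k (HDual k H) m).rTensor N).lTensor _ z) =
      ((bar k (HDual k H) m).rTensor N).lTensor _ (coefPiLeft γ n (m + 1) z) := by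
  refine LinearMap.congr_fun (f := coefPiLeft γ n m ∘ₗ ((bar k (HDual k H) m).rTensor N).lTensor _)
    (g := ((bar k (HDual k H) m).rTensor N).lTensor _ ∘ₗ coefPiLeft γ n (m + 1))
    (coef_ext fun a x y b => ?_) z
  induction x using snoc_induction with
  | hadd x y hx hy => simp only [TensorProduct.tmul_add, TensorProduct.add_tmul, map_add, hx, hy]
  | h x h =>
    simp only [LinearMap.comp_apply, LinearMap.lTensor_tmul, coefPiLeft_snoc, coefLeftAct_bar]

theorem bar_comm_coefPiDualRight (δ : M →ₗ[k] M ⊗[k] H) (n m : ℕ)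
    (z : CoefCx k H M N (n + 1) (m + 1)) :
    ((bar k H n).lTensor M).rTensor _ (coefPiDualRight δ (n + 1) m z) =
      coefPiDualRight δ n m (((bar k H n).lTensor M).rTensor _ z) := by
  refine LinearMap.congr_fun
    (f := ((bar k H n).lTensor M).rTensor _ ∘ₗ coefPiDualRight δ (n + 1) m)
    (g := coefPiDualRight δ n m ∘ₗ ((bar k H n).lTensor M).rTensor _)
    (coef_ext fun a x y b => ?_) z
  induction y using cons_induction with
  | hadd x y hx hy => simp only [TensorProduct.tmul_add, TensorProduct.add_tmul, map_add, hx, hy]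
  | h l y =>
    simp only [LinearMap.comp_apply, LinearMap.rTensor_tmul, coefPiDualRight_cons,
      coefRightAct_bar]

theorem coefPiRight_comm_coefPiDualRight {ρ : M ⊗[k] H →ₗ[k] M} {δ : M →ₗ[k] M ⊗[k] H}
    (hM : IsRightHopfModule ρ δ) (n m : ℕ) (z : CoefCx k H M N (n + 1) (m + 1)) :
    coefPiRight ρ n m (coefPiDualRight δ (n + 1) m z) =
      coefPiDualRight δ n m (coefPiRight ρ n (m + 1) z) := by
  refine LinearMap.congr_fun (f := coefPiRight ρ n m ∘ₗ coefPiDualRight δ (n + 1) m)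
    (g := coefPiDualRight δ n m ∘ₗ coefPiRight ρ n (m + 1)) (coef_ext fun a x y b => ?_) z
  induction y using cons_induction with
  | hadd x y hx hy => simp only [TensorProduct.tmul_add, TensorProduct.add_tmul, map_add, hx, hy]
  | h l y =>
    induction x using cons_induction with
    | hadd x y hx hy => simp only [TensorProduct.tmul_add, TensorProduct.add_tmul, map_add, hx, hy]
    | h h x =>
      simp only [LinearMap.comp_apply, coefPiRight, LinearMap.rTensor_tmul, coefPiDualRight_cons,
        actFirst_cons, coefRightAct_act hM]

theorem coefPiLeft_comm_coefPiDualLeft {θ : HDual k H ⊗[k] N →ₗ[k] N}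
    {γ : N →ₗ[k] HDual k H ⊗[k] N} (hN : IsLeftHopfModule θ γ) (n m : ℕ)
    (z : CoefCx k H M N (n + 1) (m + 1)) :
    coefPiLeft γ n m (coefPiDualLeft θ (n + 1) m z) =
      coefPiDualLeft θ n m (coefPiLeft γ n (m + 1) z) := by
  refine LinearMap.congr_fun (f := coefPiLeft γ n m ∘ₗ coefPiDualLeft θ (n + 1) m)
    (g := coefPiDualLeft θ n m ∘ₗ coefPiLeft γ n (m + 1)) (coef_ext fun a x y b => ?_) z
  induction x using snoc_induction with
  | hadd x y hx hy => simp only [TensorProduct.tmul_add, TensorProduct.add_tmul, map_add, hx, hy]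
  | h x h =>
    induction y using snoc_induction with
    | hadd x y hx hy => simp only [TensorProduct.tmul_add, TensorProduct.add_tmul, map_add, hx, hy]
    | h y l =>
      simp only [LinearMap.comp_apply, coefPiDualLeft_eq, LinearMap.lTensor_tmul, coefPiLeft_snoc,
        actLast_snoc, coefLeftAct_act hN]

/-- The last letter h and the first letter l interact through the scalar ⟨l₍₁₎, h₍₂₎⟩; in both
orders l₍₂₎ then acts on the left part and h₍₁₎ on the right part. -/
theorem coefPiLeft_comm_coefPiDualRight (δ : M →ₗ[k] M ⊗[k] H) (γ : N →ₗ[k] HDual k H ⊗[k] N)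
    (n m : ℕ) (z : CoefCx k H M N (n + 1) (m + 1)) :
    coefPiLeft γ n m (coefPiDualRight δ (n + 1) m z) =
      coefPiDualRight δ n m (coefPiLeft γ n (m + 1) z) := by
  have h1 : ∀ (u : M ⊗[k] (⨂[k]^n H)) (h : H) (w : (⨂[k]^m (HDual k H)) ⊗[k] N),
      coefPiLeft γ n m (((snoc k H n).toLinearMap ∘ₗ (TensorProduct.mk k _ _).flip h).lTensor M u
        ⊗ₜ w) = u ⊗ₜ coefLeftAct γ m (h ⊗ₜ w) := fun u h w => by
    induction u with
    | zero => simp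
    | add x y hx hy => simp only [TensorProduct.add_tmul, map_add, hx, hy]
    | tmul a x => exact coefPiLeft_snoc γ n m a x h w
  have h2 : ∀ (u : M ⊗[k] (⨂[k]^n H)) (l : HDual k H) (w : (⨂[k]^m (HDual k H)) ⊗[k] N),
      coefPiDualRight δ n m (u ⊗ₜ ((cons k _ m).toLinearMap ∘ₗ TensorProduct.mk k _ _ l).rTensor N
        w) = coefRightAct δ n (u ⊗ₜ l) ⊗ₜ w := fun u l w => by
    induction w with
    | zero => simp
    | add x y hx hy => simp only [TensorProduct.tmul_add, map_add, hx, hy]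
    | tmul y b => exact coefPiDualRight_cons δ n m u l y b
  refine LinearMap.congr_fun (f := coefPiLeft γ n m ∘ₗ coefPiDualRight δ (n + 1) m)
    (g := coefPiDualRight δ n m ∘ₗ coefPiLeft γ n (m + 1)) (coef_ext fun a x y b => ?_) z
  induction x using snoc_induction with
  | hadd x y hx hy => simp only [TensorProduct.tmul_add, TensorProduct.add_tmul, map_add, hx, hy]
  | h x h =>
    induction y using cons_induction with
    | hadd x y hx hy => simp only [TensorProduct.tmul_add, TensorProduct.add_tmul, map_add, hx, hy]
    | h l y =>
      have r := Coalgebra.Repr.arbitrary k l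
      have s := Coalgebra.Repr.arbitrary k h
      simp only [LinearMap.comp_apply, coefPiLeft_snoc, coefPiDualRight_cons,
        coefRightAct_snoc _ _ _ _ r s, coefLeftAct_cons _ _ _ _ s r, TensorProduct.sum_tmul,
        TensorProduct.tmul_sum, ← TensorProduct.smul_tmul', TensorProduct.tmul_smul, map_sum,
        map_smul, h1, h2]
      exact Finset.sum_comm

/-- Nine commutations. The pairs not treated above act on disjoint halves of M ⊗ Hⁿ ⊗ (H*)ᵐ ⊗ N and
commute by `rTensor_comm_lTensor`. -/
theorem coefD_comm_unsignedCoefD' {ρ : M ⊗[k] H →ₗ[k] M} {δ : M →ₗ[k] M ⊗[k] H}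
    {θ : HDual k H ⊗[k] N →ₗ[k] N} {γ : N →ₗ[k] HDual k H ⊗[k] N}
    (hM : IsRightHopfModule ρ δ) (hN : IsLeftHopfModule θ γ) (n m : ℕ) :
    coefD ρ γ n m ∘ₗ unsignedCoefD' δ θ (n + 1) m =
      unsignedCoefD' δ θ n m ∘ₗ coefD ρ γ n (m + 1) := by
  refine LinearMap.ext fun z => ?_
  have h1 : ((bar k H n).lTensor M).rTensor _ (coefPiDualLeft θ (n + 1) m z) =
      coefPiDualLeft θ n m (((bar k H n).lTensor M).rTensor _ z) := rTensor_comm_lTensor _ _ _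
  have h2 : coefPiRight ρ n m (((bar k (HDual k H) m).rTensor N).lTensor _ z) =
      ((bar k (HDual k H) m).rTensor N).lTensor _ (coefPiRight ρ n (m + 1) z) :=
    rTensor_comm_lTensor _ _ _
  have h3 : coefPiRight ρ n m (coefPiDualLeft θ (n + 1) m z) =
      coefPiDualLeft θ n m (coefPiRight ρ n (m + 1) z) := rTensor_comm_lTensor _ _ _
  simp only [coefD, unsignedCoefD', LinearMap.comp_apply, LinearMap.add_apply,
    LinearMap.smul_apply, map_add, map_smul, rTensor_comm_lTensor (X' := M ⊗[k] (⨂[k]^n H)),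
    h1, h2, h3, coefPiLeft_comm_bar, bar_comm_coefPiDualRight,
    coefPiRight_comm_coefPiDualRight hM, coefPiLeft_comm_coefPiDualLeft hN,
    coefPiLeft_comm_coefPiDualRight]
  module

theorem coef_isBicomplex {ρ : M ⊗[k] H →ₗ[k] M} {δ : M →ₗ[k] M ⊗[k] H}
    {θ : HDual k H ⊗[k] N →ₗ[k] N} {γ : N →ₗ[k] HDual k H ⊗[k] N}
    (hM : IsRightHopfModule ρ δ) (hN : IsLeftHopfModule θ γ) :
    IsBicomplex (C := CoefCx k H M N) (coefD ρ γ) (coefD' δ θ) := by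
  have e : coefD' (M := M) δ θ = fun n m => (-1 : k) ^ n • unsignedCoefD' δ θ n m := by
    funext n m
    exact coefD'_eq δ θ n m
  rw [e]
  exact isBicomplex_of_commute (coefD_comp_coefD hM hN) (unsignedCoefD'_comp hM hN)
    (coefD_comm_unsignedCoefD' hM hN)

end CoefficientBicomplex

/-! ### The dual of a left Hopf module over H* -/

section DualHopfModule

variable {k H : Type*} [Field k] [Ring H] [Bialgebra k H]
  {N : Type*} [AddCommGroup N] [Module k N] {P : Type*} [AddCommGroup P] [Module k P]

theorem dualAct_apply (γ : N →ₗ[k] HDual k H ⊗[k] N) (φ : Module.Dual k N) (h : H) (b : N) :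
    dualAct γ (φ ⊗ₜ h) b = φ (comoduleLeftAct γ (h ⊗ₜ b)) := by
  have e : dualAct γ (φ ⊗ₜ h) b =
      LinearMap.mul' k k (TensorProduct.map ((HDual.ev k H).flip h) φ (γ b)) := rfl
  rw [e, comoduleLeftAct_tmul]
  generalize γ b = t
  induction t with
  | zero => simp
  | add x y hx hy => simp only [TensorProduct.tmul_add, map_add, hx, hy]
  | tmul l c => simp

variable (P) in
/-- `q ⊗ x ↦ ⟨l, x⟩ q`. -/
def evalRight (l : HDual k H) : P ⊗[k] H →ₗ[k] P :=
  (TensorProduct.rid k P).toLinearMap ∘ₗ (HDual.ev k H l).lTensor P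

@[simp]
theorem evalRight_tmul (l : HDual k H) (a : P) (x : H) :
    evalRight P l (a ⊗ₜ x) = HDual.ev k H l x • a := by
  simp [evalRight]

theorem evalRight_rTensor {Q : Type*} [AddCommGroup Q] [Module k Q] (f : P →ₗ[k] Q)
    (l : HDual k H) (t : P ⊗[k] H) : evalRight Q l (f.rTensor H t) = f (evalRight P l t) := by
  induction t with
  | zero => simp
  | add x y hx hy => simp only [map_add, hx, hy]
  | tmul a x => simp

theorem evalRight_evalRight_comul (l l' : HDual k H) (t : P ⊗[k] H) :
    evalRight P l' (evalRight (P ⊗[k] H) l ((TensorProduct.assoc k P H H).symm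
      ((Coalgebra.comul (R := k) (A := H)).lTensor P t))) = evalRight P (l * l') t := by
  induction t with
  | zero => simp
  | add x y hx hy => simp only [map_add, hx, hy]
  | tmul a x =>
    have r := Coalgebra.Repr.arbitrary k x
    simp [← r.eq, TensorProduct.tmul_sum, HDual.ev_mul_repr l l' r, Finset.sum_smul, smul_smul]

/-- The left action of `H` on a Hopf module over `H*`. -/
theorem comoduleLeftAct_act [Module.Finite k H] {θ : HDual k H ⊗[k] N →ₗ[k] N}
    {γ : N →ₗ[k] HDual k H ⊗[k] N} (hN : IsLeftHopfModule θ γ) {h : H} {l : HDual k H} (b : N)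
    {ι κ : Type*} (r : Coalgebra.Repr k l ι) (s : Coalgebra.Repr k h κ) :
    comoduleLeftAct γ (h ⊗ₜ θ (l ⊗ₜ b)) = ∑ i ∈ r.index, ∑ j ∈ s.index,
      HDual.ev k H (r.left i) (s.right j) •
        θ (r.right i ⊗ₜ comoduleLeftAct γ (s.left j ⊗ₜ b)) := by
  have hc : γ (θ (l ⊗ₜ b)) = TensorProduct.map (LinearMap.mul' k (HDual k H)) θ
      (TensorProduct.tensorTensorTensorComm k _ _ _ _ (Coalgebra.comul l ⊗ₜ γ b)) :=
    LinearMap.congr_fun hN.compat (l ⊗ₜ b)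
  simp only [comoduleLeftAct_tmul, hc, ← r.eq]
  generalize γ b = t
  induction t with
  | zero => simp
  | add x y hx hy =>
    simp only [TensorProduct.tmul_add, map_add, hx, hy, smul_add, Finset.sum_add_distrib]
  | tmul l' c =>
    simp [TensorProduct.sum_tmul, TensorProduct.tmul_sum, HDual.ev_mul_repr _ _ s,
      Finset.sum_smul, smul_smul]

variable [Module.Finite k H]

/-- Functionals on the finite-dimensional H separate the elements of `P ⊗ H`. The coaction on N*,
defined through a basis, can therefore be handled through its basis-free characterisation. -/
theorem evalRight_ext {t t' : P ⊗[k] H} (h : ∀ l, evalRight P l t = evalRight P l t') :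
    t = t' := by
  let e := Module.finBasis k H
  have key : ∀ t : P ⊗[k] H, t = ∑ i, evalRight P (HDual.toDual.symm (e.coord i)) t ⊗ₜ e i := by
    intro t
    induction t with
    | zero => simp
    | add x y hx hy =>
      simp only [map_add, TensorProduct.add_tmul, Finset.sum_add_distrib, ← hx, ← hy]
    | tmul a x =>
      have hx : ∀ i, HDual.ev k H (HDual.toDual.symm (e.coord i)) x = e.repr x i := fun i => rfl
      simp only [evalRight_tmul, hx, TensorProduct.smul_tmul, ← TensorProduct.tmul_sum,
        e.sum_repr]
  rw [key t, key t']
  exact Finset.sum_congr rfl fun i _ => by rw [h]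

/-- The characterisation `φ₍₀₎(b) ⟨l, φ₍₁₎⟩ = φ(l · b)` of the coaction on `N*`. -/
theorem evalRight_dualCoact (θ : HDual k H ⊗[k] N →ₗ[k] N) (φ : Module.Dual k N)
    (l : HDual k H) :
    evalRight _ l (dualCoact θ φ) = φ ∘ₗ θ ∘ₗ TensorProduct.mk k (HDual k H) N l := by
  let e := Module.finBasis k H
  have hl : ∑ i, HDual.ev k H l (e i) • HDual.toDual.symm (e.coord i) = l :=
    e.sum_dual_apply_smul_coord (HDual.toDual l)
  refine LinearMap.ext fun b => ?_
  have e1 : dualCoact θ φ = ∑ i, (φ ∘ₗ θ ∘ₗ TensorProduct.mk k (HDual k H) N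
      (HDual.toDual.symm (e.coord i))) ⊗ₜ[k] e i := by
    rw [dualCoact, LinearMap.sum_apply]
    rfl
  conv_rhs => rw [← hl]
  simp only [e1, map_sum, evalRight_tmul, LinearMap.sum_apply, LinearMap.smul_apply,
    LinearMap.comp_apply, TensorProduct.mk_apply, map_smul]

/-- Evaluated at l and b, each axiom becomes one for N. Compatibility amounts to h ▹ (l·b) = ∑
⟨l₍₁₎, h₍₂₎⟩ l₍₂₎·(h₍₁₎ ▹ b), which is `comoduleLeftAct_act`. -/
theorem dual_isRightHopfModule {θ : HDual k H ⊗[k] N →ₗ[k] N} {γ : N →ₗ[k] HDual k H ⊗[k] N}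
    (hN : IsLeftHopfModule θ γ) : IsRightHopfModule (dualAct γ) (dualCoact θ) where
  act_one φ := LinearMap.ext fun b => by
    rw [dualAct_apply, comoduleLeftAct_one hN.coact_counit]
  act_mul φ x y := LinearMap.ext fun b => by
    rw [dualAct_apply, dualAct_apply, dualAct_apply, comoduleLeftAct_mul hN.coact_comul]
  coact_counit φ := by
    refine (evalRight_dualCoact θ φ 1).trans (LinearMap.ext fun b => ?_)
    simp [hN.act_one]
  coact_comul φ := by
    refine (TensorProduct.assoc k _ _ _).symm.injective (evalRight_ext fun l =>
      evalRight_ext fun l' => ?_)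
    rw [LinearEquiv.symm_apply_apply, evalRight_rTensor, evalRight_dualCoact,
      evalRight_dualCoact, evalRight_evalRight_comul, evalRight_dualCoact]
    refine LinearMap.ext fun b => ?_
    simp [hN.act_mul]
  compat := by
    refine TensorProduct.ext' fun φ h => evalRight_ext fun l => LinearMap.ext fun b => ?_
    have r := Coalgebra.Repr.arbitrary k l
    have s := Coalgebra.Repr.arbitrary k h
    -- The coaction of φ is replaced by an arbitrary tensor, so that linearity reduces the
    -- computation to pure tensors.
    have key : ∀ t : Module.Dual k N ⊗[k] H, evalRight _ l (TensorProduct.map (dualAct γ)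
        (LinearMap.mul' k H) (TensorProduct.tensorTensorTensorComm k _ _ _ _
          (t ⊗ₜ Coalgebra.comul (R := k) h))) b = ∑ i ∈ r.index, ∑ j ∈ s.index,
        HDual.ev k H (r.left i) (s.right j) *
          evalRight _ (r.right i) t (comoduleLeftAct γ (s.left j ⊗ₜ b)) := fun t => by
      induction t with
      | zero => simp
      | add x y hx hy =>
        simp only [TensorProduct.add_tmul, map_add, LinearMap.add_apply, hx, hy, mul_add,
          Finset.sum_add_distrib]
      | tmul ψ x =>
        simp only [← s.eq, TensorProduct.tmul_sum, map_sum,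
          TensorProduct.tensorTensorTensorComm_tmul, TensorProduct.map_tmul,
          LinearMap.mul'_apply, evalRight_tmul, LinearMap.sum_apply, LinearMap.smul_apply,
          dualAct_apply, ev_isBialgebraPairing.mul_right_repr _ _ r, smul_eq_mul,
          Finset.sum_mul]
        rw [Finset.sum_comm]
        exact Finset.sum_congr rfl fun i _ => Finset.sum_congr rfl fun j _ => by ring
    simp only [LinearMap.comp_apply, LinearEquiv.coe_coe, TensorProduct.map_tmul, key,
      evalRight_dualCoact, dualAct_apply, TensorProduct.mk_apply, comoduleLeftAct_act hN b r s,
      map_sum, map_smul, smul_eq_mul]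

end DualHopfModule

/-! ### The pairing of words with coefficients -/

section DualPairing

variable {k : Type*} [Field k] {Y Z : Type*} [AddCommGroup Y] [Module k Y] [AddCommGroup Z]
  [Module k Z]

/-- The pairing `⟨y ⊗ b, φ ⊗ z⟩ = φ(b) p(y, z)`. -/
def dualPairing (N : Type*) [AddCommGroup N] [Module k N] (p : Y →ₗ[k] Z →ₗ[k] k) :
    Y ⊗[k] N →ₗ[k] (Module.Dual k N ⊗[k] Z) →ₗ[k] k :=
  TensorProduct.dualDistrib k (Module.Dual k N) Z ∘ₗ TensorProduct.map (Module.Dual.eval k N) p ∘ₗ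
    (TensorProduct.comm k Y N).toLinearMap

variable {N : Type*} [AddCommGroup N] [Module k N]

@[simp]
theorem dualPairing_tmul (p : Y →ₗ[k] Z →ₗ[k] k) (y : Y) (b : N) (φ : Module.Dual k N) (z : Z) :
    dualPairing N p (y ⊗ₜ b) (φ ⊗ₜ z) = φ b * p y z := rfl

theorem dualPairing_apply (p : Y →ₗ[k] Z →ₗ[k] k) (y : Y) (b : N) (t : Module.Dual k N ⊗[k] Z) :
    dualPairing N p (y ⊗ₜ b) t =
      LinearMap.mul' k k (TensorProduct.map (Module.Dual.eval k N b) (p y) t) := by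
  induction t with
  | zero => simp
  | add x y hx hy => simp only [map_add, hx, hy]
  | tmul φ z => simp

theorem dualPairing_bijective [Module.Finite k N] [Module.Finite k Z] {p : Y →ₗ[k] Z →ₗ[k] k}
    (hp : Function.Bijective p) : Function.Bijective (dualPairing N p) :=
  (TensorProduct.comm k Y N ≪≫ₗ TensorProduct.congr (Module.evalEquiv k N)
    (LinearEquiv.ofBijective p hp) ≪≫ₗ
      TensorProduct.dualDistribEquiv k (Module.Dual k N) Z).bijective

/-- Finiteness of Y alone suffices: N* ⊗ Y* ≅ Hom(Y, N*) ≅ (Y ⊗ N)*, whatever the dimension of N. -/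
theorem dualPairing_flip_bijective [Module.Finite k Y] {p : Y →ₗ[k] Z →ₗ[k] k}
    (hp : Function.Bijective p.flip) : Function.Bijective (dualPairing N p).flip := by
  let e := TensorProduct.comm k (Module.Dual k N) Z ≪≫ₗ
    TensorProduct.congr (LinearEquiv.ofBijective p.flip hp) (LinearEquiv.refl k _) ≪≫ₗ
    dualTensorHomEquiv k Y (Module.Dual k N) ≪≫ₗ TensorProduct.lift.equiv (.id k) Y N k
  have he : (dualPairing N p).flip = e.toLinearMap := by
    refine TensorProduct.ext' fun φ z => TensorProduct.ext' fun y b => ?_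
    simp [e, TensorProduct.lift.equiv_apply, mul_comm]
  rw [he]
  exact e.bijective

end DualPairing

/-! ### The Panaite–Ştefan bicomplex as a linear dual -/

section PanaiteStefan

variable {k H : Type*} [Field k] [Ring H] [Bialgebra k H]
  {M : Type*} [AddCommGroup M] [Module k M] {N : Type*} [AddCommGroup N] [Module k N]
  [Module.Finite k H]

/-- In the diagonal action h₍₁₎ acts on φ and the rest on the word; transposed, h₍₁₎ acts on b and
h₍₂₎ on the word, as in `coefLeftAct_repr`. -/
theorem dualPairing_diagAct (γ : N →ₗ[k] HDual k H ⊗[k] N) (m : ℕ) (h : H)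
    (w : (⨂[k]^m (HDual k H)) ⊗[k] N) (t : Module.Dual k N ⊗[k] (⨂[k]^m H)) :
    dualPairing N (rainbow (HDual.ev k H) m) w (diagAct (dualAct γ) m (t ⊗ₜ h)) =
      dualPairing N (rainbow (HDual.ev k H) m) (coefLeftAct γ m (h ⊗ₜ w)) t := by
  have s := Coalgebra.Repr.arbitrary k h
  induction t with
  | zero => simp
  | add x y hx hy => simp only [TensorProduct.add_tmul, map_add, hx, hy]
  | tmul φ z =>
    have e : diagAct (dualAct γ) m ((φ ⊗ₜ z) ⊗ₜ h) = ∑ i ∈ s.index,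
        dualAct γ (φ ⊗ₜ s.left i) ⊗ₜ[k] (z * iterComul k H m (s.right i)) := by
      simp [diagAct, iterComul_succ_repr _ _ s, TensorProduct.tmul_sum]
    rw [e]
    induction w with
    | zero => simp
    | add x y hx hy =>
      simp only [TensorProduct.tmul_add, map_add, LinearMap.add_apply, hx, hy]
    | tmul y b =>
      simp only [coefLeftAct_repr _ _ _ _ s, map_sum, LinearMap.sum_apply, dualPairing_tmul,
        dualAct_apply, rainbow_mul_iterComul]

/-- The coaction inserts φ₍₁₎ as a new first letter, which is paired with the last letter l and
turns φ into φ(l · -). -/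
theorem dualPairing_dualCoact (θ : HDual k H ⊗[k] N →ₗ[k] N) (m : ℕ)
    (w : (⨂[k]^(m + 1) (HDual k H)) ⊗[k] N) (t : Module.Dual k N ⊗[k] (⨂[k]^m H)) :
    dualPairing N (rainbow (HDual.ev k H) (m + 1)) w ((cons k H m).toLinearMap.lTensor _
      (TensorProduct.assoc k _ _ _ ((dualCoact θ).rTensor _ t))) =
      dualPairing N (rainbow (HDual.ev k H) m) (actLast θ m w) t := by
  induction t with
  | zero => simp
  | add x y hx hy => simp only [map_add, hx, hy]
  | tmul φ z =>
    induction w with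
    | zero => simp
    | add x y hx hy => simp only [map_add, LinearMap.add_apply, hx, hy]
    | tmul y b =>
      induction y using snoc_induction with
      | hadd x y hx hy => simp only [TensorProduct.add_tmul, map_add, LinearMap.add_apply, hx, hy]
      | h y l =>
        have key : ∀ u : Module.Dual k N ⊗[k] H,
            dualPairing N (rainbow (HDual.ev k H) (m + 1)) (snoc k _ m (y ⊗ₜ l) ⊗ₜ b)
              ((cons k H m).toLinearMap.lTensor _ (TensorProduct.assoc k _ _ _ (u ⊗ₜ z))) =
            evalRight _ l u b * rainbow (HDual.ev k H) m y z := fun u => by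
          induction u with
          | zero => simp
          | add x y hx hy =>
            simp only [TensorProduct.add_tmul, map_add, LinearMap.add_apply, hx, hy, add_mul]
          | tmul ψ x => simp [rainbow_snoc_cons]; ring
        rw [LinearMap.rTensor_tmul, key, evalRight_dualCoact, actLast_snoc, dualPairing_tmul]
        rfl

theorem dualPairing_bar (m : ℕ) (w : (⨂[k]^(m + 1) (HDual k H)) ⊗[k] N)
    (t : Module.Dual k N ⊗[k] (⨂[k]^m H)) :
    dualPairing N (rainbow (HDual.ev k H) (m + 1)) w
      ((∑ j : Fin m, (-1 : k) ^ ((j : ℕ) + 1) • comulAt k H m j).lTensor _ t) =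
      (-1) ^ (m + 1) *
        dualPairing N (rainbow (HDual.ev k H) m) ((bar k (HDual k H) m).rTensor N w) t := by
  induction t with
  | zero => simp
  | add x y hx hy => simp only [map_add, hx, hy, mul_add]
  | tmul φ z =>
    induction w with
    | zero => simp
    | add x y hx hy => simp only [map_add, LinearMap.add_apply, hx, hy, mul_add]
    | tmul y b =>
      rw [LinearMap.lTensor_tmul, LinearMap.rTensor_tmul, dualPairing_tmul, dualPairing_tmul,
        ev_isBialgebraPairing.rainbow_bar]
      ring

/-- The new last letter is a product, and pairing it with l amounts to pairing an iterated coproduct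
of l with the separate letters. -/
theorem dualPairing_diagCoact (δ : M →ₗ[k] M ⊗[k] H) (n m : ℕ)
    (f : PS k H M (Module.Dual k N) n m) (x : M ⊗[k] (⨂[k]^n H)) (l : HDual k H)
    (y : ⨂[k]^m (HDual k H)) (b : N) :
    dualPairing N (rainbow (HDual.ev k H) (m + 1)) (cons k _ m (l ⊗ₜ y) ⊗ₜ b)
      ((snoc k H m).toLinearMap.lTensor _ (TensorProduct.assoc k _ _ _
        (f.rTensor H (diagCoact δ n x)))) =
      dualPairing N (rainbow (HDual.ev k H) m) (y ⊗ₜ b) (f (coefRightAct δ n (x ⊗ₜ l))) := by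
  have key : ∀ (t : Module.Dual k N ⊗[k] (⨂[k]^m H)) (h : H),
      dualPairing N (rainbow (HDual.ev k H) (m + 1)) (cons k _ m (l ⊗ₜ y) ⊗ₜ b)
        ((snoc k H m).toLinearMap.lTensor _ (TensorProduct.assoc k _ _ _ (t ⊗ₜ h))) =
      HDual.ev k H l h * dualPairing N (rainbow (HDual.ev k H) m) (y ⊗ₜ b) t := fun t h => by
    induction t with
    | zero => simp
    | add x y hx hy => simp only [TensorProduct.add_tmul, map_add, hx, hy, mul_add]
    | tmul φ z => simp [rainbow_cons_snoc]; ring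
  have e1 : diagCoact δ n x = (prodAll k H (n + 1)).lTensor _ (splitLeft δ n x) := rfl
  have e2 : coefRightAct δ n (x ⊗ₜ l) = contractLeft (rainbow (HDual.ev k H) (n + 1)) _
      (iterComul k _ (n + 1) l ⊗ₜ TensorProduct.comm k _ _ (splitLeft δ n x)) := rfl
  rw [e1, e2]
  generalize splitLeft δ n x = u
  induction u with
  | zero => simp
  | add x y hx hy => simp only [TensorProduct.tmul_add, map_add, hx, hy]
  | tmul v z =>
    rw [LinearMap.lTensor_tmul, LinearMap.rTensor_tmul, key, TensorProduct.comm_tmul,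
      contractLeft_tmul, map_smul, map_smul, ev_isBialgebraPairing.rainbow_iterComul, smul_eq_mul]

variable (N) in
theorem dualPairing_rainbow_flip_bijective (m : ℕ) :
    Function.Bijective (dualPairing N (rainbow (HDual.ev k H) m)).flip :=
  dualPairing_flip_bijective (LinearMap.IsPerfPair.bijective_right (rainbow (HDual.ev k H) m))

variable (k H M N) in
/-- The isomorphism of the Panaite-Ştefan cochains with the dual of the complex with coefficients,
without its sign. -/
def psDual (n m : ℕ) :
    PS k H M (Module.Dual k N) n m ≃ₗ[k] Module.Dual k (CoefCx k H M N n m) :=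
  homDualEquiv (k := k) (Y := (⨂[k]^m (HDual k H)) ⊗[k] N) (Z := Module.Dual k N ⊗[k] (⨂[k]^m H))
    (M ⊗[k] (⨂[k]^n H)) (dualPairing N (rainbow (HDual.ev k H) m))
    (dualPairing_rainbow_flip_bijective N m)

@[simp]
theorem psDual_tmul (n m : ℕ) (f : PS k H M (Module.Dual k N) n m) (x : M ⊗[k] (⨂[k]^n H))
    (w : (⨂[k]^m (HDual k H)) ⊗[k] N) :
    psDual k H M N n m f (x ⊗ₜ w) = dualPairing N (rainbow (HDual.ev k H) m) w (f x) := rfl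

theorem psDual_psHoch (ρ : M ⊗[k] H →ₗ[k] M) (γ : N →ₗ[k] HDual k H ⊗[k] N) (n m : ℕ)
    (f : PS k H M (Module.Dual k N) n m) :
    psDual k H M N (n + 1) m (psHoch ρ (dualAct γ) n m f) =
      psDual k H M N n m f ∘ₗ coefD ρ γ n m := by
  have h : ∀ (a : M) (x : ⨂[k]^(n + 1) H) (w : (⨂[k]^m (HDual k H)) ⊗[k] N),
      dualPairing N (rainbow (HDual.ev k H) m) w (diagAct (dualAct γ) m (f.rTensor H
        ((TensorProduct.assoc k _ _ _).symm
          ((snoc k H n).symm.toLinearMap.lTensor M (a ⊗ₜ x))))) =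
      psDual k H M N n m f (coefPiLeft γ n m ((a ⊗ₜ x) ⊗ₜ w)) := fun a x w => by
    induction x using snoc_induction with
    | hadd x y hx hy => simp only [TensorProduct.tmul_add, TensorProduct.add_tmul, map_add, hx, hy]
    | h x h => simp [coefPiLeft_snoc, dualPairing_diagAct]
  refine TensorProduct.ext (TensorProduct.ext' fun a x => LinearMap.ext fun w => ?_)
  simp only [LinearMap.compr₂ₛₗ_apply, TensorProduct.mk_apply, psDual_tmul, psHoch,
    LinearMap.coe_mk, AddHom.coe_mk, LinearMap.add_apply, LinearMap.smul_apply,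
    LinearMap.comp_apply, LinearEquiv.coe_coe, map_add, map_smul, h, coefD, coefPiRight,
    LinearMap.rTensor_tmul]
  abel

/-- Signs are balanced as in `gsDual_gsCoHoch`; the action θ on N takes the place of the adjoint
action in π^{H*}. -/
theorem psDual_psCoHoch (δ : M →ₗ[k] M ⊗[k] H) (θ : HDual k H ⊗[k] N →ₗ[k] N) (n m : ℕ)
    (f : PS k H M (Module.Dual k N) n m) :
    (-1 : k) ^ (m + 1) • psDual k H M N n (m + 1)
        ((-1 : k) ^ n • psCoHoch δ (dualCoact θ) n m f) =
      psDual k H M N n m f ∘ₗ coefD' δ θ n m := by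
  have h : ∀ (x : M ⊗[k] (⨂[k]^n H)) (y : ⨂[k]^(m + 1) (HDual k H)) (b : N),
      dualPairing N (rainbow (HDual.ev k H) (m + 1)) (y ⊗ₜ b)
        ((snoc k H m).toLinearMap.lTensor _ (TensorProduct.assoc k _ _ _
          (f.rTensor H (diagCoact δ n x)))) =
      psDual k H M N n m f (coefPiDualRight δ n m (x ⊗ₜ (y ⊗ₜ b))) := fun x y b => by
    induction y using cons_induction with
    | hadd x y hx hy =>
      simp only [TensorProduct.tmul_add, TensorProduct.add_tmul, map_add, LinearMap.add_apply,
        hx, hy]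
    | h l y => rw [coefPiDualRight_cons, psDual_tmul, dualPairing_diagCoact]
  have hs : (-1 : k) ^ (m + 1) * (-1 : k) ^ (m + 1) = 1 := by rw [← mul_pow]; simp
  refine TensorProduct.ext (LinearMap.ext fun x => TensorProduct.ext' fun y b => ?_)
  simp only [LinearMap.compr₂ₛₗ_apply, TensorProduct.mk_apply, psDual_tmul, psCoHoch,
    LinearMap.coe_mk, AddHom.coe_mk, LinearMap.add_apply, LinearMap.smul_apply,
    LinearMap.comp_apply, LinearEquiv.coe_coe, map_add, map_smul, h, dualPairing_bar,
    dualPairing_dualCoact, coefD', coefPiDualLeft_eq, LinearMap.lTensor_tmul, smul_eq_mul,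
    pow_add _ n]
  linear_combination ((-1) ^ n * dualPairing N (rainbow (HDual.ev k H) m)
      ((bar k (HDual k H) m).rTensor N (y ⊗ₜ b)) (f x) +
    (-1) ^ n * psDual k H M N n m f (coefPiDualRight δ n m (x ⊗ₜ (y ⊗ₜ b)))) * hs

theorem psDual_spec (ρ : M ⊗[k] H →ₗ[k] M) (δ : M →ₗ[k] M ⊗[k] H)
    (θ : HDual k H ⊗[k] N →ₗ[k] N) (γ : N →ₗ[k] HDual k H ⊗[k] N) :
    ∃ Φ : ∀ n m : ℕ, PS k H M (Module.Dual k N) n m ≃ₗ[k] Module.Dual k (CoefCx k H M N n m),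
      (∀ (n m : ℕ) (f : PS k H M (Module.Dual k N) n m) (x : M ⊗[k] (⨂[k]^n H))
        (y : ⨂[k]^m (HDual k H)) (b : N), Φ n m f (x ⊗ₜ[k] (y ⊗ₜ[k] b)) =
          (-1) ^ (m * (m + 1) / 2) * LinearMap.mul' k k
            (TensorProduct.map (Module.Dual.eval k N b) (rainbow (HDual.ev k H) m y) (f x))) ∧
      (∀ (n m : ℕ) (f : PS k H M (Module.Dual k N) n m),
        Φ (n + 1) m (psHoch ρ (dualAct γ) n m f) = Φ n m f ∘ₗ coefD ρ γ n m) ∧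
      (∀ (n m : ℕ) (f : PS k H M (Module.Dual k N) n m),
        Φ n (m + 1) ((-1 : k) ^ n • psCoHoch δ (dualCoact θ) n m f) =
          Φ n m f ∘ₗ coefD' δ θ n m) := by
  refine ⟨fun n m => psDual k H M N n m ≪≫ₗ LinearEquiv.smulOfNeZero k _ _ (triSign_ne_zero m),
    fun n m f x y b => ?_, fun n m f => ?_, fun n m f => ?_⟩
  · simp [triSign, dualPairing_apply]
  · simp only [LinearEquiv.trans_apply, LinearEquiv.smulOfNeZero_apply, psDual_psHoch,
      LinearMap.smul_comp]
  · simp only [LinearEquiv.trans_apply, LinearEquiv.smulOfNeZero_apply, triSign_succ, mul_smul,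
      psDual_psCoHoch, LinearMap.smul_comp]

end PanaiteStefan

end BialgCx

end

/-! ### The theorem -/

theorem mainTheorem5 (k : Type*) [Field k] (H : Type*) [Ring H] [Bialgebra k H]
    [Module.Finite k H] :
    -- the four pairs of differentials give bicomplex structures
    (∀ r : Fin 4, BialgCx.IsBicomplex (C := BialgCx.Cx k H)
      (BialgCx.tableD k H r) (BialgCx.tableD' k H r)) ∧
    -- `Hⁿ ⊗ (H*)ᵐ` is `Hom(Hᵐ, Hⁿ)`
    (∀ n m : ℕ, ∃ e : BialgCx.Cx k H n m ≃ₗ[k] ((⨂[k]^m H) →ₗ[k] (⨂[k]^n H)),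
      ∀ (x : ⨂[k]^n H) (y : ⨂[k]^m (BialgCx.HDual k H)) (z : ⨂[k]^m H),
        e (x ⊗ₜ[k] y) z = BialgCx.rainbow (BialgCx.HDual.ev k H) m y z • x) ∧
    -- the last bicomplex is the one whose linear dual is the Gerstenhaber-Schack bicomplex
    (∃ Φ : ∀ n m : ℕ, BialgCx.GS k H n m ≃ₗ[k] Module.Dual k (BialgCx.Cx k H n m),
      (∀ (n m : ℕ) (f : BialgCx.GS k H n m) (x : ⨂[k]^n H) (y : ⨂[k]^m (BialgCx.HDual k H)),
        Φ n m f (x ⊗ₜ[k] y) =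
          (-1) ^ (m * (m + 1) / 2) * BialgCx.rainbow (BialgCx.HDual.ev k H) m y (f x)) ∧
      (∀ (n m : ℕ) (f : BialgCx.GS k H n m),
        Φ (n + 1) m (BialgCx.gsHoch k H n m f) = Φ n m f ∘ₗ BialgCx.tableD k H 3 n m) ∧
      (∀ (n m : ℕ) (f : BialgCx.GS k H n m),
        Φ n (m + 1) ((-1 : k) ^ n • BialgCx.gsCoHoch k H n m f) =
          Φ n m f ∘ₗ BialgCx.tableD' k H 3 n m)) ∧
    -- Hopf module coefficients
    (∀ (M : Type*) [AddCommGroup M] [Module k M] (N : Type*) [AddCommGroup N] [Module k N]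
      (ρ : M ⊗[k] H →ₗ[k] M) (δ : M →ₗ[k] M ⊗[k] H)
      (θ : BialgCx.HDual k H ⊗[k] N →ₗ[k] N) (γ : N →ₗ[k] BialgCx.HDual k H ⊗[k] N),
      BialgCx.IsRightHopfModule ρ δ → BialgCx.IsLeftHopfModule θ γ →
      BialgCx.IsBicomplex (C := BialgCx.CoefCx k H M N)
        (BialgCx.coefD ρ γ) (BialgCx.coefD' δ θ) ∧
      -- `N*` is a right-right Hopf module over `H`
      BialgCx.IsRightHopfModule (BialgCx.dualAct γ) (BialgCx.dualCoact θ) ∧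
      -- for finite-dimensional `N`, `M ⊗ Hⁿ ⊗ (H*)ᵐ ⊗ N` is `Hom(N* ⊗ Hᵐ, M ⊗ Hⁿ)`
      (Module.Finite k N → ∀ n m : ℕ,
        ∃ e : BialgCx.CoefCx k H M N n m ≃ₗ[k]
            ((Module.Dual k N ⊗[k] (⨂[k]^m H)) →ₗ[k] (M ⊗[k] (⨂[k]^n H))),
          ∀ (x : M ⊗[k] (⨂[k]^n H)) (y : ⨂[k]^m (BialgCx.HDual k H)) (b : N)
            (φ : Module.Dual k N) (z : ⨂[k]^m H),
            e (x ⊗ₜ[k] (y ⊗ₜ[k] b)) (φ ⊗ₜ[k] z) =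
              (φ b * BialgCx.rainbow (BialgCx.HDual.ev k H) m y z) • x) ∧
      -- its linear dual is the Panaite-Ştefan bicomplex of the Hopf modules `M` and `N*`
      (∃ Φ : ∀ n m : ℕ, BialgCx.PS k H M (Module.Dual k N) n m ≃ₗ[k]
          Module.Dual k (BialgCx.CoefCx k H M N n m),
        (∀ (n m : ℕ) (f : BialgCx.PS k H M (Module.Dual k N) n m) (x : M ⊗[k] (⨂[k]^n H))
          (y : ⨂[k]^m (BialgCx.HDual k H)) (b : N),
          Φ n m f (x ⊗ₜ[k] (y ⊗ₜ[k] b)) =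
            (-1) ^ (m * (m + 1) / 2) * LinearMap.mul' k k
              (TensorProduct.map (Module.Dual.eval k N b)
                (BialgCx.rainbow (BialgCx.HDual.ev k H) m y) (f x))) ∧
        (∀ (n m : ℕ) (f : BialgCx.PS k H M (Module.Dual k N) n m),
          Φ (n + 1) m (BialgCx.psHoch ρ (BialgCx.dualAct γ) n m f) =
            Φ n m f ∘ₗ BialgCx.coefD ρ γ n m) ∧
        (∀ (n m : ℕ) (f : BialgCx.PS k H M (Module.Dual k N) n m),
          Φ n (m + 1) ((-1 : k) ^ n • BialgCx.psCoHoch δ (BialgCx.dualCoact θ) n m f) =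
            Φ n m f ∘ₗ BialgCx.coefD' δ θ n m))) := by
  refine ⟨BialgCx.table_isBicomplex, fun n m => ?_, BialgCx.gsDual_spec,
    fun M _ _ N _ _ ρ δ θ γ hM hN => ⟨BialgCx.coef_isBicomplex hM hN,
      BialgCx.dual_isRightHopfModule hN, fun _ n m => ?_, BialgCx.psDual_spec ρ δ θ γ⟩⟩
  · have hq := LinearMap.IsPerfPair.bijective_left (BialgCx.rainbow (BialgCx.HDual.ev k H) m)
    exact ⟨BialgCx.tensorHomEquiv _ _ hq, fun x y z => BialgCx.tensorHomEquiv_tmul _ hq x y z⟩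
  · have hq := BialgCx.dualPairing_bijective (N := N)
      (LinearMap.IsPerfPair.bijective_left (BialgCx.rainbow (BialgCx.HDual.ev k H) m))
    exact ⟨BialgCx.tensorHomEquiv (Z := Module.Dual k N ⊗[k] (⨂[k]^m H)) _ _ hq,
      fun x y b φ z => BialgCx.tensorHomEquiv_tmul (Z := Module.Dual k N ⊗[k] (⨂[k]^m H))
        _ hq x (y ⊗ₜ[k] b) (φ ⊗ₜ[k] z)⟩
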